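/- Let $\mathbb X$ and $\Theta$ be Borel subsets of Euclidean spaces or, more generally, Polish spaces, with their Borel $\sigma$-fields. Let $\mu$ be a $\sigma$-finite measure on $\mathbb X$, let $f(x\mid\theta)\ge 0$ be jointly measurable with $\int f(x\mid\theta)\,d\mu(x)=1$ for every $\theta\in\Theta$, let $G_0$ be a probability measure on $\Theta$, and let $\alpha_n\in(0,1)$, $n\ge 1$. For a probability measure $H$ on $\Theta$ write $$f_H(x)=\int_\Theta f(x\mid\theta)\,dH(\theta),\qquad dF_H=f_H\,d\mu,\qquad P_H(A\mid x)=\frac{\int_A f(x\mid\theta)\,dH(\theta)}{\int_\Theta f(x\mid\theta)\,dH(\theta)} .$$ Let $((X_n,\theta_n))_{n\ge1}$ be a process on a probability space $(\Omega,\mathcal A,P)$, with values in $\mathbb X\times\Theta$, such that for every $n\ge 0$ the conditional law of $\theta_{n+1}$ given $X_{1:n}=(X_1,\dots,X_n)$ is $G_n$, and the conditional law of $X_{n+1}$ given $(X_{1:n},\theta_{n+1})$ has density $f(\cdot\mid\theta_{n+1})$ with respect to $\mu$. Here $(G_n)$ is given by Newton's recursive rule $$G_n(A)=(1-\alpha_n)\,G_{n-1}(A)+\alpha_n\,P_{G_{n-1}}(A\mid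 X_n),\qquad n\ge1,$$ (the denominator $f_{G_{n-1}}(X_n)$ is almost surely positive and finite). Assume that $\sum_n\alpha_n=\infty$ and $\sum_n\alpha_n^2<\infty$, and let $(r_n)_{n\ge1}$ be a monotone (nondecreasing) sequence of positive numbers such that, as $n\to\infty$, $$r_n\sim\Big(\sum_{j>n}\alpha_j^2\Big)^{-1},\qquad \sqrt{r_n}\,\sup_{k\ge n}\alpha_k\to0,\qquad\text{and}\qquad \sum_{k\ge1}r_k^2\,\alpha_{k+1}^4<\infty .$$ Then there is a random probability measure $G$ on $\Theta$ such that, almost surely, $G_n$ converges weakly to $G$, and for every such $G$ the following holds. Let $k\ge1$, let $A_1,\dots,A_k\subseteq\Theta$ be Borel sets, and let $0<\gamma<1$. Write $\mathbf G_n(\mathbf A)=[G_n(A_1),\dots,G_n(A_k)]^T$, let $\chi^2_{1-\gamma}$ be the $(1-\gamma)$-quantile of the chi-square distribution with $k$ degrees of freedom, and let $C_n=C_n(A_1,\dots,A_k)$ be the $k\times k$ matrix with entries $$\int_{\mathbb X}P_{G_n}(A_i\mid x)\,P_{G_n}(A_{i'}\mid x)\,dF_{G_n}(x)-G_n(A_i)\,G_n(A_{i'}).$$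 Then for every $\varepsilon>0$ the ellipsoid $$E_n^{(\varepsilon)}=\Big\{\mathbf s\in\mathbb R^k:\ (\mathbf s-\mathbf G_n(\mathbf A))^T\,(C_n+\varepsilon I)^{-1}\,(\mathbf s-\mathbf G_n(\mathbf A))\le\frac{\chi^2_{1-\gamma}}{r_n}\Big\}$$ satisfies $$\liminf_{n\to\infty}P\big([G(A_1),\dots,G(A_k)]^T\in E_n^{(\varepsilon)}\ \big|\ X_{1:n}\big)\ \ge\ 1-\gamma\qquad\text{a.s.}$$ -/

import Mathlib

open MeasureTheory ProbabilityTheory Filter Topology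
open scoped ENNReal NNReal Matrix

noncomputable section

namespace NewtonRule

variable {Ω S T : Type*} [MeasurableSpace S] [MeasurableSpace T]

/-- The mixture density `f_H(x) = ∫ f(x ∣ t) dH(t)`, where `f x t` stands for `f(x ∣ t)`. -/
def mixDensity (f : S → T → ℝ≥0) (H : Measure T) (x : S) : ℝ≥0∞ :=
  ∫⁻ t, (f x t : ℝ≥0∞) ∂H

/-- The mixture distribution `F_H`, with density `f_H` with respect to `μ`. -/
def mixMeasure (μ : Measure S) (f : S → T → ℝ≥0) (H : Measure T) : Measure S :=
  μ.withDensity (mixDensity f H)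

/-- The posterior `P_H(A ∣ x) = ∫_A f(x ∣ t) dH(t) / ∫ f(x ∣ t) dH(t)`. It is the zero measure
where `f_H(x)` is `0` or `∞`; the set of such `x` is null for `F_H`. -/
def mixPosterior (f : S → T → ℝ≥0) (H : Measure T) (x : S) : Measure T :=
  (mixDensity f H x)⁻¹ • H.withDensity (fun t => (f x t : ℝ≥0∞))

/-- Newton's recursive rule: `newtonG f α G₀ x n` is `G_n` computed from the data
`x 1, …, x n` (the value `x 0` is not used, nor is `α 0`). -/
def newtonG (f : S → T → ℝ≥0) (α : ℕ → ℝ) (G₀ : Measure T) (x : ℕ → S) : ℕ → Measure T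
  | 0 => G₀
  | n + 1 =>
      ENNReal.ofReal (1 - α (n + 1)) • newtonG f α G₀ x n +
        ENNReal.ofReal (α (n + 1)) • mixPosterior f (newtonG f α G₀ x n) (x (n + 1))

/-- The sigma-field generated by `X_1, …, X_n` (trivial for `n = 0`). -/
abbrev past (X : ℕ → Ω → S) (n : ℕ) : MeasurableSpace Ω :=
  ⨆ i ∈ Finset.Icc 1 n, MeasurableSpace.comap (X i) inferInstance

/-- The process `((X_n, θ_n))_{n ≥ 1}` follows Newton's model under `P`:
`θ_{n+1}` given `X_{1:n}` has law `G_n`, and `X_{n+1}` given `X_{1:n}` and `θ_{n+1}` has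
density `f(· ∣ θ_{n+1})` with respect to `μ`, for every `n ≥ 0`. -/
structure IsNewtonModel [MeasurableSpace Ω] (P : Measure Ω) (μ : Measure S) (f : S → T → ℝ≥0)
    (α : ℕ → ℝ) (G₀ : Measure T) (X : ℕ → Ω → S) (θ : ℕ → Ω → T) : Prop where
  measurable_obs : ∀ n, 1 ≤ n → Measurable (X n)
  measurable_latent : ∀ n, 1 ≤ n → Measurable (θ n)
  latent_law : ∀ n : ℕ, ∀ A : Set T, MeasurableSet A →
    P⟦θ (n + 1) ⁻¹' A | past X n⟧
      =ᵐ[P] fun ω => (newtonG f α G₀ (fun i => X i ω) n).real A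
  obs_law : ∀ n : ℕ, ∀ B : Set S, MeasurableSet B →
    P⟦X (n + 1) ⁻¹' B | past X n ⊔ MeasurableSpace.comap (θ (n + 1)) inferInstance⟧
      =ᵐ[P] fun ω => (μ.withDensity (fun x => (f x (θ (n + 1) ω) : ℝ≥0∞))).real B

/-- The random probability measure `G` (a Markov kernel from `Ω`) is the almost sure weak limit
of the random measures `Gn n`. -/
def IsWeakLimit [MeasurableSpace Ω] [TopologicalSpace T] (P : Measure Ω)
    (Gn : ℕ → Ω → Measure T) (G : Kernel Ω T) : Prop :=
  ∀ᵐ ω ∂P, ∀ h : BoundedContinuousFunction T ℝ,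
    Tendsto (fun n => ∫ t, h t ∂(Gn n ω)) atTop (𝓝 (∫ t, h t ∂(G ω)))

/-- The matrix with entries
`∫ P_H(A_i ∣ x) P_H(A_j ∣ x) dF_H(x) - H(A_i) H(A_j)`; for `H = G_n` it is `C_n(A_1, …, A_k)`. -/
def covMatrix {k : ℕ} (μ : Measure S) (f : S → T → ℝ≥0) (H : Measure T) (A : Fin k → Set T) :
    Matrix (Fin k) (Fin k) ℝ :=
  Matrix.of fun i j =>
    (∫ x, (mixPosterior f H x).real (A i) * (mixPosterior f H x).real (A j) ∂(mixMeasure μ f H)) -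
      H.real (A i) * H.real (A j)

/-- The chi-square distribution with `k` degrees of freedom: the law of the sum of the squares
of `k` independent standard Gaussian variables. -/
def chiSquare (k : ℕ) : Measure ℝ :=
  (Measure.pi fun _ : Fin k => gaussianReal 0 1).map fun z => ∑ i, z i ^ 2

/-- The `p`-quantile of a distribution on the real line, for `0 < p < 1`. -/
def quantile (ν : Measure ℝ) (p : ℝ) : ℝ :=
  sInf {x : ℝ | p ≤ ν.real (Set.Iic x)}

/-- The ellipsoid `{s : (s - g)ᵀ (C + ε I)⁻¹ (s - g) ≤ c}`. -/
def ellipsoid {k : ℕ} (g : Fin k → ℝ) (C : Matrix (Fin k) (Fin k) ℝ) (ε c : ℝ) :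
    Set (Fin k → ℝ) :=
  {s | (s - g) ⬝ᵥ ((C + ε • (1 : Matrix (Fin k) (Fin k) ℝ))⁻¹ *ᵥ (s - g)) ≤ c}

end NewtonRule

end

namespace NewtonRule

/-! Given the past, `X_{n+1}` has law `F_{G_n}`, and averaging the posterior `P_{G_n}(· ∣ x)` over
that law returns `G_n`. So every `G_n(A)` is a bounded martingale with increments at most `α_{n+1}`,
and the increment of `(G_n(A_1), …, G_n(A_k))` has conditional covariance `α_{n+1}² C_n`. The almost
sure limits on single sets are glued into a random probability measure by
`exists_kernel_tendsto_real`. It is also the weak limit, and weak limits are almost surely unique,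
so every `G` in the statement is a setwise limit too.

The matrices `C_n` converge almost surely: the second moment of a posterior mean is a supremum of
linear functionals of `G_n`, hence a bounded submartingale (`posteriorSq_le_condExp`), and
polarization recovers the entries of `C_n`.

Given `X_{1:n}`, the vector `√r_n (G - G_n)(A)` is a rescaled martingale tail. Its conditional
variances add up to about `C_n`, since `r_n ∑_{j>n} α_j² → 1` and the later matrices differ little
from `C_n`. Comparing with the exponential martingale of a Gaussian with variance frozen at time `n`
(`condExp_cos_tail_le`) bounds the conditional characteristic function. Lévy's upward theorem
removes the oscillation of the variances, and the limit is Gaussian with random covariance `C = lim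
C_n` (`tendsto_condExp_cos_tail`). Second moment bounds pass from countably many frequencies to all
of them, so almost surely the regular conditional laws converge weakly
(`le_liminf_condProb_ellipsoid`).

The matrix `C` may be singular. The term `ε I` makes `C + ε I` invertible and leaves slack: the form
of `(C + ε I)⁻¹` at `C^{1/2} z` is at most `ρ ‖z‖²` with `ρ < 1`. So the limiting ellipsoid contains
an open set whose preimage under `C^{1/2}` contains the chi-square ball, and the portmanteau
inequality for open sets gives the coverage. -/

/-! ### Conditional drift and Taylor estimates. -/

theorem condExp_mono_of_setIntegral_le {Ω : Type*} {m m0 : MeasurableSpace Ω} {P : Measure Ω}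
    [IsFiniteMeasure P] (hm : m ≤ m0) {f g : Ω → ℝ} (hf : Integrable f P) (hg : Integrable g P)
    (h : ∀ s, MeasurableSet[m] s → ∫ ω in s, f ω ∂P ≤ ∫ ω in s, g ω ∂P) :
    P[f | m] ≤ᵐ[P] P[g | m] := by
  refine ae_le_of_ae_le_trim (hm := hm) ?_
  refine ae_le_of_forall_setIntegral_le
    (integrable_condExp.trim hm stronglyMeasurable_condExp)
    (integrable_condExp.trim hm stronglyMeasurable_condExp) fun s hs _ => ?_
  rw [← setIntegral_trim hm stronglyMeasurable_condExp hs,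
    ← setIntegral_trim hm stronglyMeasurable_condExp hs,
    setIntegral_condExp hm hf hs, setIntegral_condExp hm hg hs]
  exact h s hs

/-- A set of `ℱ n` lies in every `ℱ (n + i)`, so the integral over it of each increment of `R` is at
most that of `b i`. The increments telescope, and dominated convergence reaches the limit `R'`. -/
theorem condExp_le_of_telescoping {Ω : Type*} {m0 : MeasurableSpace Ω} {P : Measure Ω}
    [IsProbabilityMeasure P] (ℱ : Filtration ℕ m0) (n : ℕ) {R : ℕ → Ω → ℝ} {R' B : Ω → ℝ}
    {b : ℕ → Ω → ℝ} {C : ℝ} (hRm : ∀ i, AEStronglyMeasurable (R i) P)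
    (hR : ∀ i, ∀ᵐ ω ∂P, ‖R i ω‖ ≤ C) (hb : ∀ i, Integrable (b i) P)
    (hstep : ∀ i, P[fun ω => R (i + 1) ω - R i ω - b i ω | ℱ (n + i)] ≤ᵐ[P] 0)
    (hB : Integrable B P) (hsum : ∀ N, ∀ᵐ ω ∂P, ∑ i ∈ Finset.range N, b i ω ≤ B ω)
    (hlim : ∀ᵐ ω ∂P, Tendsto (fun i => R i ω) atTop (𝓝 (R' ω))) :
    P[R' | ℱ n] ≤ᵐ[P] P[fun ω => R 0 ω + B ω | ℱ n] := by
  have hRi : ∀ i, Integrable (R i) P := fun i => Integrable.of_bound (hRm i) C (hR i)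
  have hR'm : AEStronglyMeasurable R' P := aestronglyMeasurable_of_tendsto_ae atTop hRm hlim
  have hR'b : ∀ᵐ ω ∂P, ‖R' ω‖ ≤ C := by
    filter_upwards [hlim, ae_all_iff.2 hR] with ω h1 h2
    exact le_of_tendsto h1.norm (Eventually.of_forall h2)
  refine condExp_mono_of_setIntegral_le (ℱ.le n) (Integrable.of_bound hR'm C hR'b)
    ((hRi 0).add hB) fun s hs => ?_
  have hsm := ℱ.le n s hs
  have hfin : ∀ N, ∫ ω in s, R N ω ∂P ≤
      ∫ ω in s, (R 0 ω + ∑ i ∈ Finset.range N, b i ω) ∂P := by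
    intro N
    induction N with
    | zero => simp
    | succ N ih =>
      have hs' : MeasurableSet[ℱ (n + N)] s := ℱ.mono (Nat.le_add_right n N) s hs
      have hint : Integrable (fun ω => R (N + 1) ω - R N ω - b N ω) P :=
        ((hRi _).sub (hRi _)).sub (hb _)
      have h1 : ∫ ω in s, (R (N + 1) ω - R N ω - b N ω) ∂P ≤ 0 := by
        rw [← setIntegral_condExp (ℱ.le _) hint hs']
        exact integral_nonpos_of_ae (ae_restrict_of_ae (hstep N))
      have hsumi : Integrable (fun ω => ∑ i ∈ Finset.range N, b i ω) P :=
        integrable_finsetSum _ fun i _ => hb i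
      rw [integral_sub (f := fun ω => R (N + 1) ω - R N ω)
          ((hRi _).sub (hRi _)).integrableOn (hb _).integrableOn,
        integral_sub (hRi _).integrableOn (hRi _).integrableOn] at h1
      rw [integral_add (hRi 0).integrableOn hsumi.integrableOn] at ih
      simp only [Finset.sum_range_succ]
      rw [integral_add (g := fun ω => ∑ i ∈ Finset.range N, b i ω + b N ω)
          (hRi 0).integrableOn (hsumi.add (hb N)).integrableOn,
        integral_add hsumi.integrableOn (hb _).integrableOn]
      linarith
  have hle : ∀ N, ∫ ω in s, R N ω ∂P ≤ ∫ ω in s, (R 0 ω + B ω) ∂P := fun N => by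
    refine (hfin N).trans (integral_mono_ae
      ((hRi 0).add (integrable_finsetSum _ fun i _ => hb i)).integrableOn
      ((hRi 0).add hB).integrableOn (ae_restrict_of_ae ?_))
    filter_upwards [hsum N] with ω hω
    simpa using hω
  refine le_of_tendsto (tendsto_integral_of_dominated_convergence (fun _ => C)
    (fun i => (hRm i).restrict) (integrable_const _) (fun i => ae_restrict_of_ae (hR i))
    (ae_restrict_of_ae hlim)) (Eventually.of_forall hle)

/-- Second order Taylor expansion with a cubic error valid for every `d`. When `|d| ≥ 1` the cubic
term dominates all the others, so no smallness of the increments is needed later. -/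
theorem cos_add_le (x d : ℝ) :
    Real.cos (x + d) ≤
      Real.cos x - d * Real.sin x - d ^ 2 / 2 * Real.cos x + 4 * |d| ^ 3 := by
  have hs := abs_le.1 (Real.abs_sin_le_one x)
  have hc := abs_le.1 (Real.abs_cos_le_one x)
  have hd0 := abs_nonneg d
  rcases le_total |d| 1 with hd | hd
  · have h1 := Real.cos_bound hd
    have h2 := Real.sin_bound hd
    have h4 : |d| ^ 4 ≤ |d| ^ 3 := pow_le_pow_of_le_one hd0 hd (by norm_num)
    have h5 : |d| ^ 5 ≤ |d| ^ 3 := pow_le_pow_of_le_one hd0 hd (by norm_num)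
    have h3 : |d ^ 3| = |d| ^ 3 := abs_pow d 3
    have e1 : |Real.cos d - (1 - d ^ 2 / 2)| ≤ |d| ^ 3 := by nlinarith [pow_nonneg hd0 3]
    have e2 : |Real.sin d - d| ≤ |d| ^ 3 := by
      have : |Real.sin d - d| ≤ |Real.sin d - (d - d ^ 3 / 6)| + |-(d ^ 3 / 6)| := by
        refine le_trans (le_of_eq ?_) (abs_add_le _ _)
        congr 1; ring
      rw [abs_neg, abs_div, h3, abs_of_pos (by norm_num : (0 : ℝ) < 6)] at this
      nlinarith [pow_nonneg hd0 3]
    have p1 : Real.cos x * (Real.cos d - (1 - d ^ 2 / 2)) ≤ |d| ^ 3 := by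
      refine (le_abs_self _).trans ?_
      rw [abs_mul]
      nlinarith [Real.abs_cos_le_one x, abs_nonneg (Real.cos x), abs_nonneg
        (Real.cos d - (1 - d ^ 2 / 2))]
    have p2 : -(Real.sin x * (Real.sin d - d)) ≤ |d| ^ 3 := by
      refine (neg_le_abs _).trans ?_
      rw [abs_mul]
      nlinarith [Real.abs_sin_le_one x, abs_nonneg (Real.sin x), abs_nonneg (Real.sin d - d)]
    rw [Real.cos_add]
    nlinarith [pow_nonneg hd0 3]
  · have h1 : d * Real.sin x ≤ |d| := by
      refine (le_abs_self _).trans ?_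
      rw [abs_mul]
      exact mul_le_of_le_one_right hd0 (Real.abs_sin_le_one x)
    have h2 : d ^ 2 / 2 * Real.cos x ≤ |d| ^ 2 := by
      rw [sq_abs]
      nlinarith [sq_nonneg d]
    have h3 : |d| ≤ |d| ^ 3 := le_self_pow₀ hd (by norm_num)
    have h4 : |d| ^ 2 ≤ |d| ^ 3 := pow_le_pow_right₀ hd (by norm_num)
    linarith [Real.cos_le_one (x + d)]

theorem abs_exp_neg_sub_le {y : ℝ} (hy : 0 ≤ y) : |Real.exp (-y) - (1 - y)| ≤ y ^ 2 := by
  have h1 : 1 - y ≤ Real.exp (-y) := by linarith [Real.add_one_le_exp (-y)]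
  have h2 : Real.exp (-y) ≤ 1 - y + y ^ 2 := by
    rw [Real.exp_neg, inv_le_comm₀ (Real.exp_pos _) (by nlinarith)]
    refine le_trans ?_ (Real.add_one_le_exp y)
    rw [inv_le_iff_one_le_mul₀ (by nlinarith)]
    nlinarith [pow_nonneg hy 3]
  rw [abs_le]; constructor <;> linarith [sq_nonneg y]

/-! ### The conditional characteristic function of a martingale tail. -/

theorem condExp_mul_add_mul_eq_zero {Ω : Type*} {m m0 : MeasurableSpace Ω} {P : Measure Ω}
    [IsFiniteMeasure P] (hm : m ≤ m0) {g h D E : Ω → ℝ} {c : ℝ}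
    (hg : StronglyMeasurable[m] g) (hh : StronglyMeasurable[m] h)
    (hgc : ∀ ω, ‖g ω‖ ≤ c) (hhc : ∀ ω, ‖h ω‖ ≤ c) (hD : Integrable D P) (hE : Integrable E P)
    (hD0 : P[D | m] =ᵐ[P] 0) (hE0 : P[E | m] =ᵐ[P] 0) :
    Integrable (g * D + h * E) P ∧ P[g * D + h * E | m] =ᵐ[P] 0 := by
  have i1 : Integrable (g * D) P :=
    hD.bdd_mul (hg.mono hm).aestronglyMeasurable (Eventually.of_forall hgc)
  have i2 : Integrable (h * E) P :=
    hE.bdd_mul (hh.mono hm).aestronglyMeasurable (Eventually.of_forall hhc)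
  refine ⟨i1.add i2, ?_⟩
  filter_upwards [condExp_add i1 i2 m,
    condExp_stronglyMeasurable_mul_of_bound hm hg hD c (Eventually.of_forall hgc),
    condExp_stronglyMeasurable_mul_of_bound hm hh hE c (Eventually.of_forall hhc), hD0, hE0]
    with ω h1 h2 h3 h4 h5
  simp [h1, h2, h3, h4, h5]

/-- One step of the exponential-martingale comparison. -/
theorem cos_exp_step_le {x d e a v v₀ K η : ℝ} {s : ℝ} (ha : 0 ≤ a) (hK : 0 ≤ K) (haη : a ≤ η)
    (hd : |d| ≤ K * a) (hv₀ : 0 ≤ v₀) (hv₀K : v₀ ≤ K ^ 2)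
    (he : Real.exp ((s + a ^ 2) * v₀ / 2) ≤ e) {W : ℝ} (hW : |v - v₀| ≤ W) :
    Real.cos (x + d) * Real.exp ((s + a ^ 2) * v₀ / 2) - Real.cos x * Real.exp (s * v₀ / 2) -
        e * a ^ 2 * (W + (4 * K ^ 3 * η + K ^ 4 * η ^ 2)) ≤
      (-(Real.exp ((s + a ^ 2) * v₀ / 2) * Real.sin x)) * d +
        (-(Real.exp ((s + a ^ 2) * v₀ / 2) * Real.cos x / 2)) * (d ^ 2 - a ^ 2 * v) := by
  -- The growth of the Gaussian compensator in one step; dividing by the new compensator `E` leaves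
  -- the factor `exp (-y)`.
  set y := a ^ 2 * v₀ / 2 with hy
  have hy0 : 0 ≤ y := by positivity
  set E := Real.exp ((s + a ^ 2) * v₀ / 2) with hE
  have hE0 : 0 < E := Real.exp_pos _
  have hEs : Real.exp (s * v₀ / 2) = E * Real.exp (-y) := by
    rw [hE, ← Real.exp_add]; congr 1; rw [hy]; ring
  have hc := Real.abs_cos_le_one x
  have h1 := cos_add_le x d
  have h2 : -(Real.cos x * (Real.exp (-y) - (1 - y))) ≤ y ^ 2 := by
    refine (neg_le_abs _).trans ?_
    rw [abs_mul]
    exact (mul_le_of_le_one_left (abs_nonneg _) hc).trans (abs_exp_neg_sub_le hy0)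
  have hη : 0 ≤ η := ha.trans haη
  have h3 : |d| ^ 3 ≤ a ^ 2 * (K ^ 3 * η) := by
    calc |d| ^ 3 ≤ (K * a) ^ 3 := pow_le_pow_left₀ (abs_nonneg d) hd 3
      _ = a ^ 2 * K ^ 3 * a := by ring
      _ ≤ a ^ 2 * K ^ 3 * η := by gcongr
      _ = _ := by ring
  have h4 : y ^ 2 ≤ a ^ 2 * (K ^ 4 * η ^ 2) := by
    have : y ≤ a ^ 2 * K ^ 2 := by
      rw [hy]; nlinarith [mul_le_mul_of_nonneg_left hv₀K (sq_nonneg a), mul_nonneg (sq_nonneg a) hv₀]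
    calc y ^ 2 ≤ (a ^ 2 * K ^ 2) ^ 2 := pow_le_pow_left₀ hy0 this 2
      _ = a ^ 2 * K ^ 4 * a ^ 2 := by ring
      _ ≤ a ^ 2 * K ^ 4 * η ^ 2 := by gcongr
      _ = _ := by ring
  have h5 : Real.cos x * a ^ 2 / 2 * (v₀ - v) ≤ a ^ 2 * W := by
    have hW0 : 0 ≤ W := (abs_nonneg _).trans hW
    refine (le_abs_self _).trans ?_
    rw [abs_mul, abs_div, abs_mul, abs_of_nonneg (sq_nonneg a), abs_sub_comm]
    have : |Real.cos x| * a ^ 2 / |2| ≤ a ^ 2 := by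
      rw [abs_of_pos (by norm_num : (0 : ℝ) < 2)]; nlinarith [sq_nonneg a]
    exact mul_le_mul this hW (abs_nonneg _) (sq_nonneg a)
  have hB : 0 ≤ a ^ 2 * (W + (4 * K ^ 3 * η + K ^ 4 * η ^ 2)) := by
    have hW0 : 0 ≤ W := (abs_nonneg _).trans hW
    positivity
  -- The second order Taylor term of the cosine and the first order term of `exp (-y)` cancel up to
  -- the difference `v₀ - v`, which costs `a ^ 2 * W`. The rest is of higher order.
  have key : Real.cos (x + d) - Real.cos x * Real.exp (-y) ≤
      -Real.sin x * d - Real.cos x / 2 * (d ^ 2 - a ^ 2 * v) +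
        a ^ 2 * (W + (4 * K ^ 3 * η + K ^ 4 * η ^ 2)) := by
    have hy' : Real.cos x * y = Real.cos x * a ^ 2 / 2 * v₀ := by rw [hy]; ring
    linarith
  rw [hEs]
  nlinarith [mul_le_mul_of_nonneg_left key hE0.le, mul_le_mul_of_nonneg_right he hB]

/-- A bound for the conditional characteristic function of the tail of a bounded-increment
martingale with conditional variances `a j ^ 2 * v j`. -/
theorem condExp_cos_tail_le {Ω : Type*} {m0 : MeasurableSpace Ω} {P : Measure Ω}
    [IsProbabilityMeasure P] (ℱ : Filtration ℕ m0) (n : ℕ) {U v : ℕ → Ω → ℝ} {U' W : Ω → ℝ}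
    {a : ℕ → ℝ} {K η t : ℝ} (φ : ℝ) (hK : 0 ≤ K) (ha : ∀ j, 0 ≤ a j)
    (hU : ∀ j, StronglyMeasurable[ℱ j] (U j)) (hv : ∀ j, StronglyMeasurable[ℱ j] (v j))
    (hv0 : ∀ j ω, 0 ≤ v j ω) (hvK : ∀ j ω, v j ω ≤ K ^ 2)
    (hd : ∀ j ω, |U (j + 1) ω - U j ω| ≤ K * a j)
    (hmart : ∀ j, P[fun ω => U (j + 1) ω - U j ω | ℱ j] =ᵐ[P] 0)
    (hvar : ∀ j, P[fun ω => (U (j + 1) ω - U j ω) ^ 2 - a j ^ 2 * v j ω | ℱ j] =ᵐ[P] 0)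
    (hlim : ∀ᵐ ω ∂P, Tendsto (fun j => U j ω) atTop (𝓝 (U' ω)))
    (ht : HasSum (fun i => a (n + i) ^ 2) t) (hη : ∀ i, a (n + i) ≤ η)
    (hWi : Integrable W P) (hW : ∀ i ω, |v (n + i) ω - v n ω| ≤ W ω) :
    P[fun ω => Real.cos (U' ω - U n ω + φ) | ℱ n] ≤ᵐ[P] fun ω =>
      Real.cos φ * Real.exp (-(t * v n ω / 2)) +
        Real.exp (t * K ^ 2 / 2) * t * ((P[W | ℱ n]) ω + (4 * K ^ 3 * η + K ^ 4 * η ^ 2)) := by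
  set s : ℕ → ℝ := fun i => ∑ l ∈ Finset.range i, a (n + l) ^ 2 with hs
  -- The compensator uses the variance at time `n`, not the running one. It is then `ℱ n`-measurable
  -- and can be pulled out of the conditional expectation at the end; the price is the oscillation
  -- `W`.
  set R : ℕ → Ω → ℝ := fun i ω =>
    Real.cos (U (n + i) ω - U n ω + φ) * Real.exp (s i * v n ω / 2) with hR
  set e := Real.exp (t * K ^ 2 / 2) with he
  set κ := 4 * K ^ 3 * η + K ^ 4 * η ^ 2 with hκ
  set b : ℕ → Ω → ℝ := fun i ω => e * a (n + i) ^ 2 * (W ω + κ) with hb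
  have hη0 : 0 ≤ η := (ha _).trans (hη 0)
  have hs0 : ∀ i, 0 ≤ s i := fun i => Finset.sum_nonneg fun l _ => sq_nonneg _
  have hst : ∀ i, s i ≤ t := fun i => sum_le_hasSum _ (fun l _ => sq_nonneg _) ht
  have hW0 : ∀ ω, 0 ≤ W ω := fun ω => (abs_nonneg _).trans (hW 0 ω)
  have hκ0 : 0 ≤ κ := by positivity
  have he0 : 0 < e := Real.exp_pos _
  have hexp : ∀ i ω, Real.exp (s i * v n ω / 2) ≤ e := fun i ω => by
    refine Real.exp_le_exp.2 ?_
    have := mul_le_mul (hst i) (hvK n ω) (hv0 n ω) ((hs0 i).trans (hst i))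
    linarith
  have hmono : ∀ i, ℱ n ≤ ℱ (n + i) := fun i => ℱ.mono (Nat.le_add_right n i)
  have hRm : ∀ i, StronglyMeasurable[ℱ (n + i)] (R i) := fun i => by
    have h1 := hU (n + i)
    have h2 := (hU n).mono (hmono i)
    have h3 := (hv n).mono (hmono i)
    exact (Real.continuous_cos.comp_stronglyMeasurable ((h1.sub h2).add_const φ)).mul
      (Real.continuous_exp.comp_stronglyMeasurable ((h3.measurable.const_mul (s i)).div_const 2).stronglyMeasurable)
  have hRb : ∀ i ω, ‖R i ω‖ ≤ e := fun i ω => by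
    rw [hR, norm_mul, Real.norm_eq_abs, Real.norm_eq_abs, Real.abs_exp]
    exact (mul_le_of_le_one_left (Real.exp_pos _).le (Real.abs_cos_le_one _)).trans (hexp i ω)
  have hbi : ∀ i, Integrable (b i) P := fun i => (hWi.add (integrable_const κ)).const_mul _
  have hUd : ∀ j, Integrable (fun ω => U (j + 1) ω - U j ω) P := fun j =>
    Integrable.of_bound (((hU (j + 1)).mono (ℱ.le _)).sub ((hU j).mono (ℱ.le _))).aestronglyMeasurable
      (K * a j) (Eventually.of_forall (hd j))
  have hUd2 : ∀ j, Integrable (fun ω => (U (j + 1) ω - U j ω) ^ 2 - a j ^ 2 * v j ω) P := fun j => by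
    refine Integrable.sub (Integrable.of_bound
      ((((hU (j + 1)).mono (ℱ.le _)).sub ((hU j).mono (ℱ.le _))).pow 2).aestronglyMeasurable
      ((K * a j) ^ 2) (Eventually.of_forall fun ω => ?_)) (Integrable.const_mul
        (Integrable.of_bound ((hv j).mono (ℱ.le _)).aestronglyMeasurable (K ^ 2)
          (Eventually.of_forall fun ω => ?_)) _)
    · rw [norm_pow, Real.norm_eq_abs]
      exact pow_le_pow_left₀ (abs_nonneg _) (hd j ω) 2
    · rw [Real.norm_eq_abs, abs_of_nonneg (hv0 j ω)]; exact hvK j ω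
  have hstep : ∀ i, P[fun ω => R (i + 1) ω - R i ω - b i ω | ℱ (n + i)] ≤ᵐ[P] 0 := by
    intro i
    set x : Ω → ℝ := fun ω => U (n + i) ω - U n ω + φ with hx
    have hE : StronglyMeasurable[ℱ (n + i)] (fun ω => Real.exp (s (i + 1) * v n ω / 2)) :=
      Real.continuous_exp.comp_stronglyMeasurable
        ((((hv n).mono (hmono i)).measurable.const_mul _).div_const 2).stronglyMeasurable
    have hxm : StronglyMeasurable[ℱ (n + i)] x :=
      ((hU (n + i)).sub ((hU n).mono (hmono i))).add_const φ
    have hbd : ∀ (ω : Ω) (r : ℝ), |r| ≤ 1 → |Real.exp (s (i + 1) * v n ω / 2) * r| ≤ e := by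
      intro ω r hr
      rw [abs_mul, Real.abs_exp]
      exact (mul_le_of_le_one_right (Real.exp_pos _).le hr).trans (hexp _ ω)
    -- The first and second order terms have predictable coefficients and conditional mean zero.
    obtain ⟨hi, h0⟩ := condExp_mul_add_mul_eq_zero (P := P) (ℱ.le (n + i)) (c := e)
      (g := fun ω => -(Real.exp (s (i + 1) * v n ω / 2) * Real.sin (x ω)))
      (h := fun ω => -(Real.exp (s (i + 1) * v n ω / 2) * Real.cos (x ω) / 2))
      (hE.mul (Real.continuous_sin.comp_stronglyMeasurable hxm)).neg
      ((hE.mul (Real.continuous_cos.comp_stronglyMeasurable hxm)).measurable.div_const 2).neg.stronglyMeasurable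
      (fun ω => by
        rw [norm_neg]; exact hbd ω _ (Real.abs_sin_le_one _))
      (fun ω => by
        rw [norm_neg, mul_div_assoc]
        refine hbd ω _ ?_
        rw [abs_div, abs_of_pos (by norm_num : (0 : ℝ) < 2)]
        linarith [Real.abs_cos_le_one (x ω)])
      (hUd (n + i)) (hUd2 (n + i)) (hmart _) (hvar _)
    refine (condExp_mono ?_ hi (Eventually.of_forall fun ω => ?_)).trans h0.le
    · exact ((Integrable.of_bound ((hRm (i + 1)).mono (ℱ.le _)).aestronglyMeasurable e
        (Eventually.of_forall (hRb _))).sub (Integrable.of_bound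
        ((hRm i).mono (ℱ.le _)).aestronglyMeasurable e (Eventually.of_forall (hRb _)))).sub (hbi i)
    · have hss : s (i + 1) = s i + a (n + i) ^ 2 := Finset.sum_range_succ _ _
      have := cos_exp_step_le (x := x ω) (d := U (n + i + 1) ω - U (n + i) ω) (e := e)
        (v := v (n + i) ω) (v₀ := v n ω) (s := s i) (ha (n + i)) hK (hη i) (hd (n + i) ω)
        (hv0 n ω) (hvK n ω) (by rw [← hss]; exact hexp _ ω) (hW i ω)
      simp only [Pi.add_apply, Pi.mul_apply, hR, hb]
      rw [hss]
      have hxe : U (n + (i + 1)) ω - U n ω + φ = x ω + (U (n + i + 1) ω - U (n + i) ω) := by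
        rw [hx, ← add_assoc]; ring
      rw [hxe]
      exact this
  have hBi : Integrable (fun ω => e * t * (W ω + κ)) P := (hWi.add (integrable_const κ)).const_mul _
  have hst' : Tendsto s atTop (𝓝 t) := ht.tendsto_sum_nat
  have main := condExp_le_of_telescoping (P := P) ℱ n (R := R) (b := b) (C := e)
    (R' := fun ω => Real.exp (t * v n ω / 2) * Real.cos (U' ω - U n ω + φ))
    (B := fun ω => e * t * (W ω + κ))
    (fun i => ((hRm i).mono (ℱ.le _)).aestronglyMeasurable)
    (fun i => Eventually.of_forall (hRb i)) hbi hstep hBi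
    (fun N => Eventually.of_forall fun ω => by
      simp only [hb]
      rw [← Finset.sum_mul, ← Finset.mul_sum]
      exact mul_le_mul_of_nonneg_right (mul_le_mul_of_nonneg_left (hst N) he0.le)
        (add_nonneg (hW0 ω) hκ0)) (by
      filter_upwards [hlim] with ω hω
      have h1 : Tendsto (fun i => U (n + i) ω) atTop (𝓝 (U' ω)) := by
        simpa [add_comm] using (tendsto_add_atTop_iff_nat n).2 hω
      rw [mul_comm]
      exact ((Real.continuous_cos.tendsto _).comp ((h1.sub_const _).add_const φ)).mul
        ((Real.continuous_exp.tendsto _).comp ((hst'.mul_const _).div_const 2)))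
  have hU'm : AEStronglyMeasurable U' P :=
    aestronglyMeasurable_of_tendsto_ae atTop
      (fun j => ((hU j).mono (ℱ.le _)).aestronglyMeasurable) hlim
  have hcosi : Integrable (fun ω => Real.cos (U' ω - U n ω + φ)) P :=
    Integrable.of_bound (Real.continuous_cos.comp_aestronglyMeasurable
      ((hU'm.sub ((hU n).mono (ℱ.le _)).aestronglyMeasurable).add_const φ)) 1
      (Eventually.of_forall fun ω => Real.abs_cos_le_one _)
  have hEm : StronglyMeasurable[ℱ n] (fun ω => Real.exp (t * v n ω / 2)) :=
    Real.continuous_exp.comp_stronglyMeasurable (((hv n).measurable.const_mul _).div_const 2).stronglyMeasurable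
  have hEb : ∀ ω, ‖Real.exp (t * v n ω / 2)‖ ≤ e := fun ω => by
    rw [Real.norm_eq_abs, Real.abs_exp]
    refine Real.exp_le_exp.2 ?_
    have := mul_le_mul_of_nonneg_left (hvK n ω) ((hs0 0).trans (hst 0))
    linarith
  -- In the limit the compensator is `exp (t * v n / 2)`; it is pulled out here, and multiplying by
  -- its inverse, which is at most one, gives the claim.
  have pull := condExp_stronglyMeasurable_mul_of_bound (ℱ.le n) hEm hcosi e
    (Eventually.of_forall hEb)
  have hrhs : P[fun ω => R 0 ω + e * t * (W ω + κ) | ℱ n] =ᵐ[P]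
      fun ω => Real.cos φ + e * t * ((P[W | ℱ n]) ω + κ) := by
    have h1 : (fun ω => R 0 ω + e * t * (W ω + κ)) =
        (fun _ => Real.cos φ + e * t * κ) + (e * t) • W := by
      ext ω; simp [hR, hs]; ring
    rw [h1]
    filter_upwards [condExp_add (integrable_const (Real.cos φ + e * t * κ))
      (hWi.smul (e * t)) (ℱ n), condExp_smul (μ := P) (e * t) W (ℱ n)] with ω h2 h3
    rw [h2, Pi.add_apply, h3, condExp_const (ℱ.le n)]
    simp; ring
  have hWn : 0 ≤ᵐ[P] P[W | ℱ n] := condExp_nonneg (Eventually.of_forall hW0)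
  filter_upwards [main, pull, hrhs, hWn] with ω h1 h2 h3 h4
  have h5 : Real.exp (t * v n ω / 2) * (P[fun ω => Real.cos (U' ω - U n ω + φ) | ℱ n]) ω ≤
      Real.cos φ + e * t * ((P[W | ℱ n]) ω + κ) := by
    rw [← h3]
    refine le_trans (le_of_eq ?_) h1
    exact h2.symm
  have ht0 : 0 ≤ t := (hs0 0).trans (hst 0)
  have h4' : 0 ≤ (P[W | ℱ n]) ω := h4
  have hX : 0 ≤ e * t * ((P[W | ℱ n]) ω + κ) := by positivity
  have hE1 : Real.exp (-(t * v n ω / 2)) ≤ 1 := Real.exp_le_one_iff.2 (by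
    have := mul_nonneg ht0 (hv0 n ω); linarith)
  have h6 := mul_le_mul_of_nonneg_left h5 (Real.exp_pos (-(t * v n ω / 2))).le
  rw [← mul_assoc, ← Real.exp_add, neg_add_cancel, Real.exp_zero, one_mul] at h6
  refine h6.trans ?_
  rw [mul_add, mul_comm (Real.cos φ)]
  exact add_le_add_right (mul_le_of_le_one_left hX hE1) _

/-- The conditional second moment of the tail of a martingale. -/
theorem condExp_sq_tail_le {Ω : Type*} {m0 : MeasurableSpace Ω} {P : Measure Ω}
    [IsProbabilityMeasure P] (ℱ : Filtration ℕ m0) (n : ℕ) {U v : ℕ → Ω → ℝ} {U' : Ω → ℝ}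
    {a : ℕ → ℝ} {K t C : ℝ} (hU : ∀ j, StronglyMeasurable[ℱ j] (U j))
    (hv : ∀ j, StronglyMeasurable[ℱ j] (v j))
    (hv0 : ∀ j ω, 0 ≤ v j ω) (hvK : ∀ j ω, v j ω ≤ K ^ 2) (hUC : ∀ j ω, |U j ω| ≤ C)
    (hmart : ∀ j, P[fun ω => U (j + 1) ω - U j ω | ℱ j] =ᵐ[P] 0)
    (hvar : ∀ j, P[fun ω => (U (j + 1) ω - U j ω) ^ 2 - a j ^ 2 * v j ω | ℱ j] =ᵐ[P] 0)
    (hlim : ∀ᵐ ω ∂P, Tendsto (fun j => U j ω) atTop (𝓝 (U' ω)))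
    (ht : HasSum (fun i => a (n + i) ^ 2) t) :
    P[fun ω => (U' ω - U n ω) ^ 2 | ℱ n] ≤ᵐ[P] fun _ => K ^ 2 * t := by
  have hmono : ∀ i, ℱ n ≤ ℱ (n + i) := fun i => ℱ.mono (Nat.le_add_right n i)
  have hdm : ∀ i, StronglyMeasurable[ℱ (n + i)] (fun ω => U (n + i) ω - U n ω) := fun i =>
    (hU (n + i)).sub ((hU n).mono (hmono i))
  have hdb : ∀ i j ω, |U i ω - U j ω| ≤ 2 * C := fun i j ω => by
    have := abs_sub (U i ω) (U j ω)
    linarith [hUC i ω, hUC j ω]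
  have hsqb : ∀ i j ω, ‖(U i ω - U j ω) ^ 2‖ ≤ (2 * C) ^ 2 := fun i j ω => by
    rw [norm_pow]
    exact pow_le_pow_left₀ (abs_nonneg _) (hdb i j ω) 2
  have hsqm : ∀ i j, AEStronglyMeasurable (fun ω => (U i ω - U j ω) ^ 2) P := fun i j =>
    ((((hU i).mono (ℱ.le _)).sub ((hU j).mono (ℱ.le _))).pow 2).aestronglyMeasurable
  have hsqi : ∀ i j, Integrable (fun ω => (U i ω - U j ω) ^ 2) P := fun i j =>
    Integrable.of_bound (hsqm i j) _ (Eventually.of_forall (hsqb i j))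
  have hUd : ∀ j, Integrable (fun ω => U (j + 1) ω - U j ω) P := fun j =>
    Integrable.of_bound (((hU (j + 1)).mono (ℱ.le _)).sub ((hU j).mono (ℱ.le _))).aestronglyMeasurable
      _ (Eventually.of_forall (hdb _ j))
  have hvi : ∀ j, Integrable (v j) P := fun j =>
    Integrable.of_bound ((hv j).mono (ℱ.le _)).aestronglyMeasurable (K ^ 2)
      (Eventually.of_forall fun ω => by
        rw [Real.norm_eq_abs, abs_of_nonneg (hv0 j ω)]; exact hvK j ω)
  have main := condExp_le_of_telescoping (P := P) ℱ n
    (R := fun i ω => (U (n + i) ω - U n ω) ^ 2) (b := fun i _ => a (n + i) ^ 2 * K ^ 2)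
    (R' := fun ω => (U' ω - U n ω) ^ 2) (B := fun _ => K ^ 2 * t) (C := (2 * C) ^ 2)
    (fun i => hsqm _ _) (fun i => Eventually.of_forall (hsqb _ _)) (fun i => integrable_const _)
    (fun i => by
      -- With `D = U (n + i) - U n` and `Δ` the next increment, `(D + Δ)² - D² = 2 D Δ + Δ²`. The
      -- first term has conditional mean zero and the second has conditional mean `a² v ≤ a² K²`.
      obtain ⟨hi, h0⟩ := condExp_mul_add_mul_eq_zero (P := P) (ℱ.le (n + i)) (c := max (4 * C) 1)
        (g := fun ω => 2 * (U (n + i) ω - U n ω)) (h := fun _ => 1)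
        ((hdm i).const_mul 2) stronglyMeasurable_const
        (fun ω => by
          rw [norm_mul, Real.norm_eq_abs, Real.norm_eq_abs, abs_two]
          exact le_max_of_le_left (by linarith [hdb (n + i) n ω]))
        (fun ω => by simp) (hUd (n + i))
        ((hsqi _ _).sub ((hvi (n + i)).const_mul (a (n + i) ^ 2))) (hmart _) (hvar _)
      refine (condExp_mono (((hsqi _ _).sub (hsqi _ _)).sub (integrable_const _)) hi
        (Eventually.of_forall fun ω => ?_)).trans h0.le
      have := mul_le_mul_of_nonneg_left (hvK (n + i) ω) (sq_nonneg (a (n + i)))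
      simp only [Pi.add_apply, Pi.mul_apply, Pi.sub_apply, ← add_assoc]
      nlinarith)
    (integrable_const _)
    (fun N => Eventually.of_forall fun ω => by
      rw [← Finset.sum_mul, mul_comm]
      exact mul_le_mul_of_nonneg_left (sum_le_hasSum _ (fun l _ => sq_nonneg _) ht) (sq_nonneg K))
    (by
      filter_upwards [hlim] with ω hω
      have h1 : Tendsto (fun i => U (n + i) ω) atTop (𝓝 (U' ω)) := by
        simpa [add_comm] using (tendsto_add_atTop_iff_nat n).2 hω
      exact (h1.sub_const _).pow 2)
  refine main.trans (Eventually.of_forall fun ω => le_of_eq ?_)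
  simp [condExp_const (ℱ.le n)]

/-! ### Almost sure limits of conditional characteristic functions. -/

/-- The oscillation of a bounded real sequence from the index `m` on. -/
noncomputable def oscFrom (v : ℕ → ℝ) (m : ℕ) : ℝ := ⨆ p : ℕ × ℕ, |v (m + p.1) - v (m + p.2)|

theorem abs_sub_le_of_mem_Icc {v : ℕ → ℝ} {c : ℝ} (h0 : ∀ j, 0 ≤ v j) (hc : ∀ j, v j ≤ c)
    (i j : ℕ) : |v i - v j| ≤ c := by
  rw [abs_le]; constructor <;> linarith [h0 i, h0 j, hc i, hc j]

/-- The starting index `m` may lie below `n`: later `m` stays fixed while `n` grows, so that a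
single random variable serves as error bound for all `n ≥ m`. -/
theorem abs_sub_le_oscFrom {v : ℕ → ℝ} {c : ℝ} (h0 : ∀ j, 0 ≤ v j) (hc : ∀ j, v j ≤ c)
    {m n : ℕ} (hmn : m ≤ n) (i : ℕ) : |v (n + i) - v n| ≤ oscFrom v m := by
  have hb : BddAbove (Set.range fun p : ℕ × ℕ => |v (m + p.1) - v (m + p.2)|) :=
    ⟨c, by rintro _ ⟨p, rfl⟩; exact abs_sub_le_of_mem_Icc h0 hc _ _⟩
  have := le_ciSup hb (n + i - m, n - m)
  simp only at this
  rwa [show m + (n + i - m) = n + i by omega, show m + (n - m) = n by omega] at this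

theorem oscFrom_mem_Icc {v : ℕ → ℝ} {c : ℝ} (h0 : ∀ j, 0 ≤ v j) (hc : ∀ j, v j ≤ c) (m : ℕ) :
    oscFrom v m ∈ Set.Icc 0 c :=
  ⟨Real.iSup_nonneg fun _ => abs_nonneg _, ciSup_le fun _ => abs_sub_le_of_mem_Icc h0 hc _ _⟩

theorem tendsto_oscFrom {v : ℕ → ℝ} {l : ℝ} (h : Tendsto v atTop (𝓝 l)) :
    Tendsto (oscFrom v) atTop (𝓝 0) := by
  rw [Metric.tendsto_atTop]
  intro ε hε
  obtain ⟨N, hN⟩ := Metric.tendsto_atTop.1 h (ε / 4) (by positivity)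
  refine ⟨N, fun m hm => ?_⟩
  have h1 : oscFrom v m ≤ ε / 2 := ciSup_le fun p => by
    have a1 := hN (m + p.1) (by omega)
    have a2 := hN (m + p.2) (by omega)
    rw [Real.dist_eq] at a1 a2
    have := abs_sub_le (v (m + p.1)) l (v (m + p.2))
    rw [abs_sub_comm l] at this
    linarith
  have h2 : 0 ≤ oscFrom v m := Real.iSup_nonneg fun _ => abs_nonneg _
  rw [Real.dist_eq, sub_zero, abs_of_nonneg h2]
  linarith

theorem measurable_oscFrom {Ω : Type*} {m : MeasurableSpace Ω} {v : ℕ → Ω → ℝ}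
    (hv : ∀ j, Measurable (v j)) (k : ℕ) : Measurable fun ω => oscFrom (fun j => v j ω) k :=
  Measurable.iSup fun _ => ((hv _).sub (hv _)).norm

/-- Almost sure conditional central limit theorem, in terms of characteristic functions, for the
tail of a bounded-increment martingale. -/
theorem tendsto_condExp_cos_tail {Ω : Type*} {m0 : MeasurableSpace Ω} {P : Measure Ω}
    [IsProbabilityMeasure P] (ℱ : Filtration ℕ m0) {U v : ℕ → Ω → ℝ} {U' v' : Ω → ℝ}
    {β r η : ℕ → ℝ} {K : ℝ} (φ : ℝ) (hK : 0 ≤ K) (hβ : ∀ j, 0 ≤ β j)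
    (hU : ∀ j, StronglyMeasurable[ℱ j] (U j)) (hv : ∀ j, StronglyMeasurable[ℱ j] (v j))
    (hv0 : ∀ j ω, 0 ≤ v j ω) (hvK : ∀ j ω, v j ω ≤ K ^ 2)
    (hd : ∀ j ω, |U (j + 1) ω - U j ω| ≤ K * β j)
    (hmart : ∀ j, P[fun ω => U (j + 1) ω - U j ω | ℱ j] =ᵐ[P] 0)
    (hvar : ∀ j, P[fun ω => (U (j + 1) ω - U j ω) ^ 2 - β j ^ 2 * v j ω | ℱ j] =ᵐ[P] 0)
    (hlim : ∀ᵐ ω ∂P, Tendsto (fun j => U j ω) atTop (𝓝 (U' ω)))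
    (hvlim : ∀ᵐ ω ∂P, Tendsto (fun j => v j ω) atTop (𝓝 (v' ω)))
    (hr : ∀ n, 1 ≤ n → 0 < r n) (hβs : Summable fun j => β j ^ 2)
    (ht : Tendsto (fun n => r n * ∑' i, β (n + i) ^ 2) atTop (𝓝 1))
    (hη : ∀ n i, √(r n) * β (n + i) ≤ η n) (hη0 : Tendsto η atTop (𝓝 0)) :
    ∀ᵐ ω ∂P, Tendsto (fun n => (P[fun ω => Real.cos (√(r n) * (U' ω - U n ω) + φ) | ℱ n]) ω) atTop
      (𝓝 (Real.cos φ * Real.exp (-(v' ω / 2)))) := by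
  set t : ℕ → ℝ := fun n => r n * ∑' i, β (n + i) ^ 2 with htdef
  set κ : ℕ → ℝ := fun n => 4 * K ^ 3 * η n + K ^ 4 * η n ^ 2 with hκ
  have bound : ∀ ψ m n, m ≤ n → 1 ≤ n →
      P[fun ω => Real.cos (√(r n) * (U' ω - U n ω) + ψ) | ℱ n] ≤ᵐ[P] fun ω =>
      Real.cos ψ * Real.exp (-(t n * v n ω / 2)) + Real.exp (t n * K ^ 2 / 2) * t n *
        ((P[fun ω => oscFrom (fun j => v j ω) m | ℱ n]) ω + κ n) := by
    intro ψ m n hmn hn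
    have hsq : √(r n) ^ 2 = r n := Real.sq_sqrt (hr n hn).le
    have := condExp_cos_tail_le (P := P) ℱ n (U := fun j ω => √(r n) * U j ω) (v := v)
      (U' := fun ω => √(r n) * U' ω) (W := fun ω => oscFrom (fun j => v j ω) m)
      (a := fun j => √(r n) * β j) (K := K) (η := η n) (t := t n) ψ hK
      (fun j => mul_nonneg (Real.sqrt_nonneg _) (hβ j)) (fun j => (hU j).const_mul _) hv hv0 hvK
      (fun j ω => by
        rw [← mul_sub, abs_mul, abs_of_nonneg (Real.sqrt_nonneg _), mul_left_comm]
        exact mul_le_mul_of_nonneg_left (hd j ω) (Real.sqrt_nonneg _))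
      (fun j => by
        have h1 : (fun ω => √(r n) * U (j + 1) ω - √(r n) * U j ω) =
            √(r n) • fun ω => U (j + 1) ω - U j ω := by
          ext ω; simp [mul_sub]
        rw [h1]
        filter_upwards [condExp_smul (μ := P) √(r n) (fun ω => U (j + 1) ω - U j ω) (ℱ j),
          hmart j] with ω h2 h3
        rw [h2, Pi.smul_apply, h3]; simp)
      (fun j => by
        have h1 : (fun ω => (√(r n) * U (j + 1) ω - √(r n) * U j ω) ^ 2 -
            (√(r n) * β j) ^ 2 * v j ω) =
            r n • fun ω => (U (j + 1) ω - U j ω) ^ 2 - β j ^ 2 * v j ω := by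
          ext ω
          rw [← mul_sub, mul_pow, mul_pow, hsq, Pi.smul_apply, smul_eq_mul]; ring
        rw [h1]
        filter_upwards [condExp_smul (μ := P) (r n)
          (fun ω => (U (j + 1) ω - U j ω) ^ 2 - β j ^ 2 * v j ω) (ℱ j), hvar j] with ω h2 h3
        rw [h2, Pi.smul_apply, h3]; simp)
      (by filter_upwards [hlim] with ω hω using hω.const_mul _)
      (by
        simp_rw [mul_pow, hsq]
        refine ((hβs.comp_injective (add_right_injective n)).hasSum).mul_left (r n))
      (hη n)
      (Integrable.of_bound (Measurable.aestronglyMeasurable 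
        (measurable_oscFrom (fun j => ((hv j).mono (ℱ.le _)).measurable) m))
        (K ^ 2) (Eventually.of_forall fun ω => by
          have := oscFrom_mem_Icc (fun j => hv0 j ω) (fun j => hvK j ω) m
          rw [Real.norm_eq_abs, abs_of_nonneg this.1]; exact this.2))
      (fun i ω => abs_sub_le_oscFrom (fun j => hv0 j ω) (fun j => hvK j ω) hmn i)
    simp only [← mul_sub] at this
    exact this
  -- A phase shift by `π` changes the sign of the cosine, so the one-sided bound applied to `φ + π`
  -- is the lower bound for `φ`.
  have hneg : ∀ n, P[fun ω => Real.cos (√(r n) * (U' ω - U n ω) + (φ + Real.pi)) | ℱ n] =ᵐ[P]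
      -P[fun ω => Real.cos (√(r n) * (U' ω - U n ω) + φ) | ℱ n] := fun n => by
    have : (fun ω => Real.cos (√(r n) * (U' ω - U n ω) + (φ + Real.pi))) =
        -fun ω => Real.cos (√(r n) * (U' ω - U n ω) + φ) := by
      ext ω; rw [← add_assoc, Real.cos_add_pi]; rfl
    rw [this]
    exact condExp_neg _ _
  -- For fixed `m` the oscillation is measurable for `⨆ n, ℱ n`, so by Lévy's upward theorem its
  -- conditional expectations converge to the oscillation itself.
  have levy : ∀ m, ∀ᵐ ω ∂P, Tendsto
      (fun n => (P[fun ω => oscFrom (fun j => v j ω) m | ℱ n]) ω) atTop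
      (𝓝 (oscFrom (fun j => v j ω) m)) := fun m => by
    have hm : StronglyMeasurable[⨆ n, ℱ n] (fun ω => oscFrom (fun j => v j ω) m) := by
      exact Measurable.stronglyMeasurable (measurable_oscFrom (fun j =>
        ((hv j).mono (le_iSup (fun n => (ℱ n : MeasurableSpace Ω)) j)).measurable) m)
    refine Integrable.tendsto_ae_condExp ?_ hm
    exact Integrable.of_bound (hm.mono (iSup_le fun n => ℱ.le n)).aestronglyMeasurable
        (K ^ 2) (Eventually.of_forall fun ω => by
          have := oscFrom_mem_Icc (fun j => hv0 j ω) (fun j => hvK j ω) m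
          rw [Real.norm_eq_abs, abs_of_nonneg this.1]; exact this.2)
  have b1 : ∀ᵐ ω ∂P, ∀ m n, m ≤ n → 1 ≤ n → _ :=
    ae_all_iff.2 fun m => ae_all_iff.2 fun n => eventually_imp_distrib_left.2 fun hmn =>
      eventually_imp_distrib_left.2 fun hn => bound φ m n hmn hn
  have b2 : ∀ᵐ ω ∂P, ∀ m n, m ≤ n → 1 ≤ n → _ :=
    ae_all_iff.2 fun m => ae_all_iff.2 fun n => eventually_imp_distrib_left.2 fun hmn =>
      eventually_imp_distrib_left.2 fun hn => bound (φ + Real.pi) m n hmn hn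
  filter_upwards [b1, b2, ae_all_iff.2 levy, ae_all_iff.2 hneg, hvlim] with ω c1 c2 c3 c4 c5
  have hκ0 : Tendsto κ atTop (𝓝 0) := by
    have := (hη0.const_mul (4 * K ^ 3)).add ((hη0.pow 2).const_mul (K ^ 4))
    simpa [hκ] using this
  have hmain : Tendsto (fun n => (P[fun ω => Real.cos (√(r n) * (U' ω - U n ω) + φ) | ℱ n]) ω -
      Real.cos φ * Real.exp (-(t n * v n ω / 2))) atTop (𝓝 0) := by
    rw [Metric.tendsto_atTop]
    intro ε hε
    have hosc := (tendsto_oscFrom c5).const_mul (Real.exp (1 * K ^ 2 / 2) * 1)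
    rw [mul_zero] at hosc
    -- The variances converge along this `ω`, so some `m`, depending on `ω`, makes the limiting
    -- error smaller than `ε`; only then does `n` tend to infinity.
    obtain ⟨m, hm⟩ := (hosc.eventually (gt_mem_nhds hε)).exists
    have hR : Tendsto (fun n => Real.exp (t n * K ^ 2 / 2) * t n *
        ((P[fun ω => oscFrom (fun j => v j ω) m | ℱ n]) ω + κ n)) atTop
        (𝓝 (Real.exp (1 * K ^ 2 / 2) * 1 * (oscFrom (fun j => v j ω) m + 0))) :=
      ((((Real.continuous_exp.tendsto _).comp ((ht.mul_const _).div_const 2))).mul ht).mul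
        ((c3 m).add hκ0)
    rw [add_zero] at hR
    obtain ⟨N, hN⟩ := eventually_atTop.1 (hR.eventually (gt_mem_nhds hm))
    refine ⟨max N (max m 1), fun n hn => ?_⟩
    have e1 := c1 m n (by omega) (by omega)
    have e2 := c2 m n (by omega) (by omega)
    have e3 := hN n (by omega)
    rw [c4 n, Pi.neg_apply, Real.cos_add_pi] at e2
    rw [Real.dist_eq, sub_zero, abs_lt]
    constructor <;> linarith
  have h2 : Tendsto (fun n => Real.cos φ * Real.exp (-(t n * v n ω / 2))) atTop
      (𝓝 (Real.cos φ * Real.exp (-(1 * v' ω / 2)))) :=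
    ((Real.continuous_exp.tendsto _).comp ((ht.mul c5).div_const 2).neg).const_mul _
  simpa using hmain.add h2

/-! ### Chi-square quantiles and Gaussian mass of ellipsoids. -/

/-- Right continuity of the distribution function carries the bound to the infimum of the levels
that satisfy it. -/
theorem le_real_Iic_quantile (ν : Measure ℝ) [IsProbabilityMeasure ν] {p : ℝ}
    (h1 : p < 1) : p ≤ ν.real (Set.Iic (quantile ν p)) := by
  set s := {x : ℝ | p ≤ ν.real (Set.Iic x)} with hs
  have hmem : ∀ x, x ∈ s ↔ p ≤ cdf ν x := fun x => by rw [cdf_eq_real]; rfl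
  have hne : s.Nonempty := by
    obtain ⟨x, hx⟩ := ((tendsto_cdf_atTop ν).eventually (lt_mem_nhds h1)).exists
    exact ⟨x, (hmem x).2 hx.le⟩
  rw [← cdf_eq_real]
  have hq : quantile ν p = sInf s := rfl
  rw [hq]
  have hcont : Tendsto (cdf ν) (𝓝[>] (sInf s)) (𝓝 (cdf ν (sInf s))) :=
    ((cdf ν).right_continuous (sInf s)).mono_left (nhdsWithin_mono _ Set.Ioi_subset_Ici_self)
  refine ge_of_tendsto hcont ?_
  filter_upwards [self_mem_nhdsWithin] with x hx
  obtain ⟨y, hy, hyx⟩ := exists_lt_of_csInf_lt hne hx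
  exact ((hmem y).1 hy).trans (monotone_cdf ν hyx.le)

instance (k : ℕ) : IsProbabilityMeasure (chiSquare k) :=
  Measure.isProbabilityMeasure_map
    (Measurable.aemeasurable (f := fun z : Fin k → ℝ => ∑ i, z i ^ 2) (by fun_prop))

/-- A vanishing sum of squares forces the first coordinate to be zero, an event of Gaussian measure
zero. Positivity places the centre in the open set used for the portmanteau inequality. -/
theorem quantile_chiSquare_pos {k : ℕ} (hk : 1 ≤ k) {p : ℝ} (h0 : 0 < p) (h1 : p < 1) :
    0 < quantile (chiSquare k) p := by
  by_contra! h
  have h2 := le_real_Iic_quantile (chiSquare k) h1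
  have h3 : (chiSquare k) (Set.Iic 0) = 0 := by
    rw [chiSquare, Measure.map_apply (by fun_prop) measurableSet_Iic]
    refine measure_mono_null (t := Function.eval (⟨0, hk⟩ : Fin k) ⁻¹' {0}) (fun z hz => ?_) ?_
    · have hz0 : ∑ i, z i ^ 2 = 0 :=
        le_antisymm hz (Finset.sum_nonneg fun i _ => sq_nonneg _)
      have := (Finset.sum_eq_zero_iff_of_nonneg (fun i _ => sq_nonneg (z i))).1 hz0 ⟨0, hk⟩
        (Finset.mem_univ _)
      simpa using this
    · rw [(measurePreserving_eval (fun _ : Fin k => gaussianReal 0 1) ⟨0, hk⟩).measure_preimage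
        (measurableSet_singleton _).nullMeasurableSet]
      have := nullSingletonClass_gaussianReal (μ := 0) (v := 1) one_ne_zero
      exact measure_singleton _
  have h4 : (chiSquare k).real (Set.Iic (quantile (chiSquare k) p)) = 0 := by
    rw [measureReal_def, measure_mono_null (Set.Iic_subset_Iic.2 h) h3]; rfl
  linarith

theorem stdGaussian_norm_sq_le (k : ℕ) (c : ℝ) :
    stdGaussian (EuclideanSpace ℝ (Fin k)) {z | ‖z‖ ^ 2 ≤ c} = chiSquare k (Set.Iic c) := by
  rw [← map_pi_eq_stdGaussian, chiSquare, Measure.map_apply (by fun_prop) measurableSet_Iic,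
    Measure.map_apply (by fun_prop) (measurableSet_le (by fun_prop) measurable_const)]
  congr 1
  ext z
  simp [EuclideanSpace.real_norm_sq_eq]

variable {k : ℕ}

open scoped MatrixOrder in
/-- For `y = C^{1/2} z`, `yᵀ (C + ε)⁻¹ y` is at most `ρ ‖z‖²` for some `ρ < 1`. -/
theorem exists_quadratic_bound {C : Matrix (Fin k) (Fin k) ℝ} (hC : C.PosSemidef) {ε : ℝ}
    (hε : 0 < ε) : ∃ δ > 0, ∃ ρ < 1, ∀ z : EuclideanSpace ℝ (Fin k),
      (Matrix.toEuclideanCLM (𝕜 := ℝ) (CFC.sqrt C) z).ofLp ⬝ᵥ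
        ((C + ε • (1 : Matrix (Fin k) (Fin k) ℝ))⁻¹ *ᵥ
          (Matrix.toEuclideanCLM (𝕜 := ℝ) (CFC.sqrt C) z).ofLp) +
        δ * ‖Matrix.toEuclideanCLM (𝕜 := ℝ) (CFC.sqrt C) z‖ ^ 2 ≤ ρ * ‖z‖ ^ 2 := by
  set L := Matrix.toEuclideanCLM (𝕜 := ℝ) (CFC.sqrt C) with hL
  set D := C + ε • (1 : Matrix (Fin k) (Fin k) ℝ) with hD
  have hDpos : D.PosDef := Matrix.PosDef.posSemidef_add hC (Matrix.PosDef.one.smul hε)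
  have hdet : IsUnit D.det := (Matrix.isUnit_iff_isUnit_det _).1 hDpos.isUnit
  -- The added one keeps `ℓ` positive when `C = 0`.
  set ℓ := ‖L‖ ^ 2 + 1 with hℓ
  have hℓ0 : 0 < ℓ := by positivity
  have hLz : ∀ z, ‖L z‖ ^ 2 ≤ ℓ * ‖z‖ ^ 2 := fun z => by
    have := pow_le_pow_left₀ (norm_nonneg _) (L.le_opNorm z) 2
    rw [mul_pow] at this
    nlinarith [sq_nonneg ‖z‖]
  have hsym : ∀ x y, inner ℝ (L x) y = inner ℝ x (L y) := by
    intro x y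
    have h : IsSelfAdjoint L := (CFC.sqrt_nonneg C).isSelfAdjoint.map _
    rw [← ContinuousLinearMap.adjoint_inner_left, h.adjoint_eq]
  have hLL : ∀ x, L (L x) = Matrix.toEuclideanCLM (𝕜 := ℝ) C x := fun x => by
    rw [← ContinuousLinearMap.comp_apply, ← ContinuousLinearMap.mul_def, hL, ← map_mul,
      CFC.sqrt_mul_sqrt_self _ hC.nonneg]
  set ρ := ℓ / (ℓ + ε) with hρ
  have hρ1 : ρ < 1 := (div_lt_one (by positivity)).2 (by linarith)
  -- The quadratic form alone is at most `ρ ‖z‖²`. Half of the gap `1 - ρ` is spent on `δ ‖L z‖²`,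
  -- with `‖L z‖² ≤ ℓ ‖z‖²`, and the other half keeps the final ratio below one.
  refine ⟨(1 - ρ) / (2 * ℓ), by have := sub_pos.2 hρ1; positivity, (1 + ρ) / 2, by linarith,
    fun z => ?_⟩
  set w : EuclideanSpace ℝ (Fin k) := WithLp.toLp 2 (D⁻¹ *ᵥ (L z).ofLp) with hw
  have hq : (L z).ofLp ⬝ᵥ (D⁻¹ *ᵥ (L z).ofLp) = inner ℝ w (L z) := by
    rw [EuclideanSpace.inner_eq_star_dotProduct]; simp [hw]
  have hDw : L z = L (L w) + ε • w := by
    rw [hLL]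
    have : D *ᵥ w.ofLp = (L z).ofLp := by
      rw [hw, Matrix.mulVec_mulVec, Matrix.mul_nonsing_inv _ hdet, Matrix.one_mulVec]
    rw [hD, Matrix.add_mulVec, Matrix.smul_mulVec, Matrix.one_mulVec] at this
    ext i
    simpa [Matrix.ofLp_toEuclideanCLM] using (congrFun this i).symm
  have hq1 : inner ℝ w (L z) = ‖L w‖ ^ 2 + ε * ‖w‖ ^ 2 := by
    rw [hDw, inner_add_right, inner_smul_right, ← hsym, real_inner_self_eq_norm_sq,
      real_inner_self_eq_norm_sq]
  have hq2 : inner ℝ w (L z) ≤ ‖L w‖ * ‖z‖ := by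
    rw [← hsym]; exact real_inner_le_norm _ _
  rw [hq]
  set q := inner ℝ w (L z) with hqdef
  have h1 := hLz w
  have h2 := hLz z
  have hq0 : 0 ≤ q := by rw [hq1]; positivity
  -- Since `‖w‖² ≥ ‖L w‖² / ℓ`, the identity `q = ‖L w‖² + ε ‖w‖²` gains a factor over `q ≥ ‖L w‖²`.
  -- Combined with the Cauchy–Schwarz bound `q ≤ ‖L w‖ ‖z‖` this yields `q ≤ ℓ / (ℓ + ε) ‖z‖²`.
  have ha : (ℓ + ε) * ‖L w‖ ^ 2 ≤ ℓ * q := by rw [hq1]; nlinarith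
  have hq3 : q ^ 2 ≤ ‖L w‖ ^ 2 * ‖z‖ ^ 2 := by
    rw [← mul_pow]; exact pow_le_pow_left₀ hq0 hq2 2
  have hq4 : q ≤ ρ * ‖z‖ ^ 2 := by
    rw [hρ, div_mul_eq_mul_div, le_div_iff₀ (by positivity)]
    rcases hq0.eq_or_lt with h | h
    · rw [← h, zero_mul]; positivity
    · have : q * (q * (ℓ + ε)) ≤ q * (ℓ * ‖z‖ ^ 2) := by
        nlinarith [mul_le_mul_of_nonneg_right ha (sq_nonneg ‖z‖)]
      exact le_of_mul_le_mul_left this h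
  have h3 : (1 - ρ) / (2 * ℓ) * ‖L z‖ ^ 2 ≤ (1 - ρ) / 2 * ‖z‖ ^ 2 := by
    calc (1 - ρ) / (2 * ℓ) * ‖L z‖ ^ 2 ≤ (1 - ρ) / (2 * ℓ) * (ℓ * ‖z‖ ^ 2) := by
          have := sub_pos.2 hρ1
          gcongr
      _ = _ := by field_simp
  linarith

theorem abs_dotProduct_mulVec_le (B : Matrix (Fin k) (Fin k) ℝ) (y : EuclideanSpace ℝ (Fin k)) :
    |y.ofLp ⬝ᵥ (B *ᵥ y.ofLp)| ≤ (∑ i, ∑ j, |B i j|) * ‖y‖ ^ 2 := by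
  have hy : ∀ i, |y i| ≤ ‖y‖ := fun i => PiLp.norm_apply_le y i
  simp only [dotProduct, Matrix.mulVec, Finset.sum_mul, Finset.mul_sum]
  refine (Finset.abs_sum_le_sum_abs _ _).trans (Finset.sum_le_sum fun i _ =>
    (Finset.abs_sum_le_sum_abs _ _).trans (Finset.sum_le_sum fun j _ => ?_))
  rw [abs_mul, abs_mul]
  have := mul_le_mul (hy i) (hy j) (abs_nonneg _) (norm_nonneg y)
  nlinarith [abs_nonneg (B i j)]

open scoped MatrixOrder in
/-- Asymptotic coverage of the regularized ellipsoids along a weakly convergent sequence. -/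
theorem le_liminf_measure_ellipsoid (hk : 1 ≤ k) {ν : ℕ → ProbabilityMeasure (EuclideanSpace ℝ (Fin k))}
    {C : Matrix (Fin k) (Fin k) ℝ} (hC : C.PosSemidef) {Cn : ℕ → Matrix (Fin k) (Fin k) ℝ}
    (hCn : Tendsto Cn atTop (𝓝 C))
    (hν : Tendsto ν atTop (𝓝 ⟨multivariateGaussian 0 C, inferInstance⟩)) {ε p : ℝ} (hε : 0 < ε)
    (hp0 : 0 < p) (hp1 : p < 1) :
    p ≤ liminf (fun n => (ν n : Measure (EuclideanSpace ℝ (Fin k))).real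
      {y | y.ofLp ⬝ᵥ ((Cn n + ε • (1 : Matrix (Fin k) (Fin k) ℝ))⁻¹ *ᵥ y.ofLp) ≤
        quantile (chiSquare k) p}) atTop := by
  set χ := quantile (chiSquare k) p with hχ
  obtain ⟨δ, hδ, ρ, hρ, hbound⟩ := exists_quadratic_bound hC hε
  set B : Matrix (Fin k) (Fin k) ℝ := (C + ε • (1 : Matrix (Fin k) (Fin k) ℝ))⁻¹ with hB
  -- The strict inequality makes the set open, as the portmanteau inequality requires; the cushion
  -- `δ ‖y‖²` absorbs the difference between the inverses of `Cn n + ε I` and `C + ε I`.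
  set O : Set (EuclideanSpace ℝ (Fin k)) :=
    {y | y.ofLp ⬝ᵥ (B *ᵥ y.ofLp) + δ * ‖y‖ ^ 2 < χ} with hO
  have hcont : Continuous fun y : EuclideanSpace ℝ (Fin k) =>
      y.ofLp ⬝ᵥ (B *ᵥ y.ofLp) + δ * ‖y‖ ^ 2 := by
    have h0 : Continuous fun y : EuclideanSpace ℝ (Fin k) => y.ofLp := PiLp.continuous_ofLp 2 _
    exact (h0.dotProduct (continuous_const.matrix_mulVec h0)).add
      (continuous_const.mul (continuous_norm.pow 2))
  have hOo : IsOpen O := isOpen_lt hcont continuous_const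
  have hχ0 : 0 < χ := quantile_chiSquare_pos hk hp0 hp1
  -- The Gaussian is the image of a standard one under `C^{1/2}`, and the preimage of `O` contains
  -- the ball `‖z‖² ≤ χ`, whose mass is at least `p`.
  have hpO : ENNReal.ofReal p ≤ multivariateGaussian 0 C O := by
    have h1 : ENNReal.ofReal p ≤ stdGaussian (EuclideanSpace ℝ (Fin k)) {z | ‖z‖ ^ 2 ≤ χ} := by
      rw [stdGaussian_norm_sq_le]
      exact (ENNReal.ofReal_le_iff_le_toReal (measure_ne_top _ _)).2
        (le_real_Iic_quantile (chiSquare k) hp1)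
    refine h1.trans ?_
    rw [multivariateGaussian, Measure.map_apply (by fun_prop) hOo.measurableSet]
    refine measure_mono fun z hz => ?_
    have hz' : ‖z‖ ^ 2 ≤ χ := hz
    rw [Set.mem_preimage, zero_add]
    refine (hbound z).trans_lt ?_
    by_cases h0 : ‖z‖ ^ 2 = 0
    · rw [h0, mul_zero]; exact hχ0
    · have : 0 < ‖z‖ ^ 2 := lt_of_le_of_ne (sq_nonneg _) (Ne.symm h0)
      nlinarith
  have hlim := ProbabilityMeasure.le_liminf_measure_open_of_tendsto hν hOo
  have hinv : Tendsto (fun n => (Cn n + ε • (1 : Matrix (Fin k) (Fin k) ℝ))⁻¹) atTop (𝓝 B) := by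
    have hpd : (C + ε • (1 : Matrix (Fin k) (Fin k) ℝ)).PosDef :=
      Matrix.PosDef.posSemidef_add hC (Matrix.PosDef.one.smul hε)
    have hdet : (C + ε • (1 : Matrix (Fin k) (Fin k) ℝ)).det ≠ 0 := hpd.det_pos.ne'
    have h1 : Tendsto (fun n => Cn n + ε • (1 : Matrix (Fin k) (Fin k) ℝ)) atTop
      (𝓝 (C + ε • (1 : Matrix (Fin k) (Fin k) ℝ))) := hCn.add_const _
    simp only [hB, Matrix.inv_def, Ring.inverse_eq_inv']
    exact (((continuous_id.matrix_det.tendsto _).comp h1).inv₀ hdet).smul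
      ((continuous_id.matrix_adjugate.tendsto _).comp h1)
  have hev : ∀ᶠ n in atTop, O ⊆
      {y | y.ofLp ⬝ᵥ ((Cn n + ε • (1 : Matrix (Fin k) (Fin k) ℝ))⁻¹ *ᵥ y.ofLp) ≤ χ} := by
    have hs : Tendsto (fun n => ∑ i, ∑ j,
        |((Cn n + ε • (1 : Matrix (Fin k) (Fin k) ℝ))⁻¹ - B) i j|) atTop (𝓝 0) := by
      have h0 : Tendsto (fun n => (Cn n + ε • (1 : Matrix (Fin k) (Fin k) ℝ))⁻¹ - B) atTop
          (𝓝 0) := by simpa using hinv.sub_const B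
      have : Tendsto (fun n => ∑ i, ∑ j,
        |((Cn n + ε • (1 : Matrix (Fin k) (Fin k) ℝ))⁻¹ - B) i j|) atTop
          (𝓝 (∑ i : Fin k, ∑ j : Fin k, |(0 : Matrix (Fin k) (Fin k) ℝ) i j|)) :=
        tendsto_finsetSum _ fun i _ => tendsto_finsetSum _ fun j _ =>
          ((tendsto_pi_nhds.1 ((tendsto_pi_nhds.1 h0) i)) j).abs
      simpa using this
    filter_upwards [hs.eventually (gt_mem_nhds hδ)] with n hn y hy
    have h1 := (abs_le.1 (abs_dotProduct_mulVec_le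
      ((Cn n + ε • (1 : Matrix (Fin k) (Fin k) ℝ))⁻¹ - B) y)).2
    rw [Matrix.sub_mulVec, dotProduct_sub] at h1
    have h2 := mul_le_mul_of_nonneg_right hn.le (sq_nonneg ‖y‖)
    have h3 : y.ofLp ⬝ᵥ (B *ᵥ y.ofLp) + δ * ‖y‖ ^ 2 < χ := hy
    change y.ofLp ⬝ᵥ ((Cn n + ε • (1 : Matrix (Fin k) (Fin k) ℝ))⁻¹ *ᵥ y.ofLp) ≤ χ
    linarith
  -- The liminf in `ℝ≥0∞` yields eventual lower bounds only for levels `b` below `p`. Negative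
  -- levels are separated because `ENNReal.ofReal` collapses them.
  refine le_of_forall_lt_imp_le_of_dense fun b hb => ?_
  refine le_liminf_of_le (IsBoundedUnder.isCoboundedUnder_ge
    ⟨1, by simp⟩) ?_
  rcases lt_or_ge b 0 with hb0 | hb0
  · exact Eventually.of_forall fun n => hb0.le.trans measureReal_nonneg
  have hb' : ENNReal.ofReal b < liminf (fun n => (ν n : Measure _) O) atTop :=
    ((ENNReal.ofReal_lt_ofReal_iff hp0).2 hb).trans_le (hpO.trans hlim)
  filter_upwards [eventually_lt_of_lt_liminf hb', hev] with n h1 h2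
  exact (ENNReal.ofReal_le_iff_le_toReal (measure_ne_top _ _)).1 (h1.le.trans (measure_mono h2))

/-! ### Regular conditional laws and pointwise convergence of characteristic functions. -/

theorem exists_condLaw_comap {Ω β E : Type*} {mΩ : MeasurableSpace Ω} [mβ : MeasurableSpace β]
    [MeasurableSpace E] [StandardBorelSpace E] [Nonempty E] {P : Measure Ω} [IsFiniteMeasure P]
    {X : Ω → β} (hX : Measurable X) {Y : Ω → E} (hY : Measurable Y) :
    ∃ κ : Ω → Measure E, (∀ ω, IsProbabilityMeasure (κ ω)) ∧
      ∀ g : β × E → ℝ, Measurable g → Integrable (fun ω => g (X ω, Y ω)) P →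
        (∀ᵐ ω ∂P, Integrable (fun y => g (X ω, y)) (κ ω)) ∧
        P[fun ω => g (X ω, Y ω) | mβ.comap X] =ᵐ[P] fun ω => ∫ y, g (X ω, y) ∂κ ω := by
  refine ⟨fun ω => condDistrib Y X P (X ω), fun ω => inferInstance, fun g hg hgi => ⟨?_, ?_⟩⟩
  · refine Integrable.condDistrib_ae hX.aemeasurable hY.aemeasurable ?_
    rwa [integrable_map_measure hg.aestronglyMeasurable (hX.prodMk hY).aemeasurable]
  · exact condExp_prod_ae_eq_integral_condDistrib hX hY.aemeasurable hg.stronglyMeasurable hgi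

/-- Existence of a regular conditional law of `Y` given a sub-sigma-field. -/
theorem exists_condLaw {Ω E : Type*} {m m0 : MeasurableSpace Ω} (hm : m ≤ m0)
    [mE : MeasurableSpace E] [StandardBorelSpace E] [Nonempty E] {P : Measure[m0] Ω}
    [IsFiniteMeasure P] {Y : Ω → E} (hY : Measurable Y) :
    ∃ κ : Ω → Measure E, (∀ ω, IsProbabilityMeasure (κ ω)) ∧
      ∀ g : Ω × E → ℝ, Measurable[m.prod mE] g → Integrable (fun ω => g (ω, Y ω)) P →
        (∀ᵐ ω ∂P, Integrable (fun y => g (ω, y)) (κ ω)) ∧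
        P[fun ω => g (ω, Y ω) | m] =ᵐ[P] fun ω => ∫ y, g (ω, y) ∂κ ω := by
  -- Conditioning on `m` is conditioning on the identity map from `(Ω, m0)` to `(Ω, m)`.
  obtain ⟨κ, h1, h2⟩ := @exists_condLaw_comap Ω Ω E m0 m mE _ _ P _ id
    (fun s hs => hm s hs) Y hY
  refine ⟨κ, h1, fun g hg hgi => ?_⟩
  have h3 := h2 g hg hgi
  rw [MeasurableSpace.comap_id] at h3
  exact h3

variable {k : ℕ}

/-- The sine is the cosine with phase `-π/2`, so cosine limits at two phases determine the limit of
the characteristic function. -/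
theorem charFun_eq_integral_cos {E : Type*} [NormedAddCommGroup E] [InnerProductSpace ℝ E]
    [MeasurableSpace E] [BorelSpace E] [SecondCountableTopology E] (ν : Measure E)
    [IsProbabilityMeasure ν] (t : E) :
    charFun ν t = ((∫ y, Real.cos (inner ℝ y t + 0) ∂ν : ℝ) : ℂ) +
      ((∫ y, Real.cos (inner ℝ y t + -(Real.pi / 2)) ∂ν : ℝ) : ℂ) * Complex.I := by
  have hi : ∀ φ : ℝ, Integrable (fun y => Real.cos (inner ℝ y t + φ)) ν := fun φ =>
    Integrable.of_bound (Continuous.aestronglyMeasurable (by fun_prop)) 1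
      (Eventually.of_forall fun y => Real.abs_cos_le_one _)
  rw [charFun_apply, ← integral_complex_ofReal, ← integral_complex_ofReal, ← integral_mul_const,
    ← integral_add (hi 0).ofReal ((hi _).ofReal.mul_const _)]
  congr 1
  ext y
  rw [Complex.exp_mul_I, add_zero, ← sub_eq_add_neg, Real.cos_sub_pi_div_two]
  simp

/-- Follows from `|exp (i a) - 1| ≤ |a|`, Cauchy–Schwarz and `‖y‖ ≤ 1 + ‖y‖²`; the second moment is
what the martingale tail controls. -/
theorem norm_charFun_sub_le {E : Type*} [NormedAddCommGroup E] [InnerProductSpace ℝ E]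
    [MeasurableSpace E] [BorelSpace E] [SecondCountableTopology E] (ν : Measure E)
    [IsProbabilityMeasure ν] (hν : Integrable (fun y => ‖y‖ ^ 2) ν) (s t : E) :
    ‖charFun ν s - charFun ν t‖ ≤ ‖s - t‖ * (1 + ∫ y, ‖y‖ ^ 2 ∂ν) := by
  have hi : ∀ t : E, Integrable (fun y => Complex.exp (inner ℝ y t * Complex.I)) ν := fun t =>
    Integrable.of_bound (Continuous.aestronglyMeasurable (by fun_prop)) 1
      (Eventually.of_forall fun y => by rw [Complex.norm_exp_ofReal_mul_I])
  rw [charFun_apply, charFun_apply, ← integral_sub (hi s) (hi t)]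
  refine (norm_integral_le_integral_norm _).trans ?_
  have h1 : ∫ y, ‖s - t‖ * (1 + ‖y‖ ^ 2) ∂ν = ‖s - t‖ * (1 + ∫ y, ‖y‖ ^ 2 ∂ν) := by
    rw [integral_const_mul, integral_add (integrable_const _) hν]; simp
  rw [← h1]
  refine integral_mono ((hi s).sub (hi t)).norm (((integrable_const _).add hν).const_mul _)
    fun y => ?_
  have h2 : Complex.exp (inner ℝ y s * Complex.I) - Complex.exp (inner ℝ y t * Complex.I) =
      Complex.exp (inner ℝ y t * Complex.I) *
        (Complex.exp (Complex.I * (inner ℝ y (s - t) : ℝ)) - 1) := by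
    rw [mul_sub, ← Complex.exp_add, mul_one, inner_sub_right]
    congr 2
    push_cast; ring
  simp only [h2, norm_mul, Complex.norm_exp_ofReal_mul_I, one_mul]
  refine (Real.norm_exp_I_mul_ofReal_sub_one_le).trans ?_
  refine (norm_inner_le_norm _ _).trans ?_
  rw [mul_comm]
  refine mul_le_mul_of_nonneg_left ?_ (norm_nonneg _)
  nlinarith [sq_nonneg (‖y‖ - 1), norm_nonneg y]

/-- Almost sure statements can be combined over countably many frequencies only. A bound on second
moments makes the characteristic functions eventually uniformly Lipschitz, which fills in the
remaining frequencies. -/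
theorem tendsto_charFun_of_dense {E : Type*} [NormedAddCommGroup E] [InnerProductSpace ℝ E]
    [MeasurableSpace E] [BorelSpace E] [SecondCountableTopology E] {ν : ℕ → Measure E}
    [∀ n, IsProbabilityMeasure (ν n)] {B : ℝ} (hν : ∀ n, Integrable (fun y => ‖y‖ ^ 2) (ν n))
    (hB : ∀ᶠ n in atTop, ∫ y, ‖y‖ ^ 2 ∂ν n ≤ B) {f : E → ℂ} (hf : Continuous f) {D : Set E}
    (hD : Dense D) (h : ∀ t ∈ D, Tendsto (fun n => charFun (ν n) t) atTop (𝓝 (f t))) (t : E) :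
    Tendsto (fun n => charFun (ν n) t) atTop (𝓝 (f t)) := by
  have hB0 : 0 ≤ B := by
    obtain ⟨n, hn⟩ := hB.exists
    exact (integral_nonneg fun y => sq_nonneg _).trans hn
  rw [Metric.tendsto_nhds]
  intro ε hε
  have h1 : ∀ᶠ s in 𝓝 t, ‖t - s‖ * (1 + B) < ε / 3 ∧ dist (f s) (f t) < ε / 3 := by
    refine Eventually.and ?_ (Metric.tendsto_nhds.1 (hf.tendsto t) _ (by positivity))
    have : Tendsto (fun s => ‖t - s‖ * (1 + B)) (𝓝 t) (𝓝 (‖t - t‖ * (1 + B))) :=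
      (Continuous.tendsto (by fun_prop) t)
    rw [sub_self, norm_zero, zero_mul] at this
    exact this.eventually (gt_mem_nhds (by positivity))
  obtain ⟨s, hsD, hs1, hs2⟩ := (hD.inter_nhds_nonempty h1)
  filter_upwards [hB, Metric.tendsto_nhds.1 (h s hsD) (ε / 3) (by positivity)] with n hn1 hn2
  have h2 : dist (charFun (ν n) t) (charFun (ν n) s) < ε / 3 := by
    rw [dist_eq_norm]
    refine (norm_charFun_sub_le (ν n) (hν n) t s).trans_lt (lt_of_le_of_lt ?_ hs1)
    gcongr
  have := dist_triangle4 (charFun (ν n) t) (charFun (ν n) s) (f s) (f t)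
  linarith

theorem condExp_sum_mul_eq_zero {Ω ι : Type*} {m m0 : MeasurableSpace Ω} {P : Measure Ω}
    (s : Finset ι) (c : ι → ℝ) {f : ι → Ω → ℝ} (hf : ∀ i, Integrable (f i) P)
    (h0 : ∀ i, P[f i | m] =ᵐ[P] 0) : P[fun ω => ∑ i ∈ s, c i * f i ω | m] =ᵐ[P] 0 := by
  have h1 : (fun ω => ∑ i ∈ s, c i * f i ω) = ∑ i ∈ s, c i • f i := by
    ext ω; simp
  rw [h1]
  refine (condExp_finsetSum (fun i _ => (hf i).smul (c i)) m).trans ?_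
  have h2 : ∀ᵐ ω ∂P, ∀ i ∈ s, (P[c i • f i | m]) ω = 0 := by
    rw [Finset.eventually_all]
    intro i _
    filter_upwards [condExp_smul (μ := P) (c i) (f i) m, h0 i] with ω e1 e2
    rw [e1, Pi.smul_apply, e2]; simp
  filter_upwards [h2] with ω hω
  simp only [Finset.sum_apply, Pi.zero_apply]
  exact Finset.sum_eq_zero hω

/-! ### Conditional coverage for limits of vector martingales. -/

variable {k : ℕ}

theorem dotProduct_mulVec_le_sq {C : Matrix (Fin k) (Fin k) ℝ} (hC : ∀ i l, |C i l| ≤ 1)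
    (u : Fin k → ℝ) : u ⬝ᵥ (C *ᵥ u) ≤ (∑ i, |u i|) ^ 2 := by
  simp only [dotProduct, Matrix.mulVec]
  rw [sq, Finset.sum_mul]
  refine Finset.sum_le_sum fun i _ => ?_
  refine (le_abs_self _).trans ?_
  rw [abs_mul]
  refine mul_le_mul_of_nonneg_left ?_ (abs_nonneg _)
  refine (Finset.abs_sum_le_sum_abs _ _).trans (Finset.sum_le_sum fun l _ => ?_)
  rw [abs_mul]
  exact mul_le_of_le_one_left (abs_nonneg _) (hC i l)

theorem measurable_dotProduct_inv_mulVec {X : Type*} [MeasurableSpace X]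
    {B : X → Matrix (Fin k) (Fin k) ℝ} {y : X → Fin k → ℝ}
    (hB : ∀ i j, Measurable fun x => B x i j) (hy : ∀ i, Measurable fun x => y x i) :
    Measurable fun x => y x ⬝ᵥ ((B x)⁻¹ *ᵥ y x) := by
  have hcont : ∀ i j, Measurable fun b : Fin k → Fin k → ℝ => ((Matrix.of b)⁻¹) i j := by
    intro i j
    have h0 : Continuous fun b : Fin k → Fin k → ℝ => Matrix.of b := continuous_id
    -- The cofactor formula holds for singular matrices as well, where both sides vanish, so
    -- measurability needs no invertibility.
    have h1 : (fun b : Fin k → Fin k → ℝ => ((Matrix.of b)⁻¹) i j) =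
        fun b => (Matrix.of b).det⁻¹ * (Matrix.of b).adjugate i j := by
      ext b; rw [Matrix.inv_def, Ring.inverse_eq_inv']; rfl
    rw [h1]
    exact (h0.matrix_det.measurable.inv).mul
      ((h0.matrix_adjugate.matrix_elem i j).measurable)
  have hB' : Measurable fun x => (fun i j => B x i j : Fin k → Fin k → ℝ) :=
    measurable_pi_lambda _ fun i => measurable_pi_lambda _ fun j => hB i j
  simp only [dotProduct, Matrix.mulVec]
  refine Finset.measurable_sum _ fun i _ => (hy i).mul (Finset.measurable_sum _ fun j _ => ?_)
  exact ((hcont i j).comp hB').mul (hy j)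

/-- Asymptotic conditional coverage of the credible ellipsoids for the limit of a bounded
vector-valued martingale with bounded increments. -/
theorem le_liminf_condProb_ellipsoid {Ω : Type*} {m0 : MeasurableSpace Ω} {P : Measure Ω}
    [IsProbabilityMeasure P] (ℱ : Filtration ℕ m0) (hk : 1 ≤ k) {M : ℕ → Ω → Fin k → ℝ}
    {M' : Ω → Fin k → ℝ} {C : ℕ → Ω → Matrix (Fin k) (Fin k) ℝ}
    {C' : Ω → Matrix (Fin k) (Fin k) ℝ} {β r η : ℕ → ℝ} (hβ : ∀ j, 0 ≤ β j)
    (hMm : ∀ j i, Measurable[ℱ j] fun ω => M j ω i) (hM'm : ∀ i, Measurable fun ω => M' ω i)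
    (hM1 : ∀ j ω i, |M j ω i| ≤ 1) (hM'1 : ∀ ω i, |M' ω i| ≤ 1)
    (hCm : ∀ j i l, Measurable[ℱ j] fun ω => C j ω i l) (hCpsd : ∀ j ω, (C j ω).PosSemidef)
    (hC1 : ∀ j ω i l, |C j ω i l| ≤ 1) (hd : ∀ j ω i, |M (j + 1) ω i - M j ω i| ≤ β j)
    (hmart : ∀ j i, P[fun ω => M (j + 1) ω i - M j ω i | ℱ j] =ᵐ[P] 0)
    (hcov : ∀ j i l, P[fun ω => (M (j + 1) ω i - M j ω i) * (M (j + 1) ω l - M j ω l) -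
      β j ^ 2 * C j ω i l | ℱ j] =ᵐ[P] 0)
    (hlim : ∀ᵐ ω ∂P, ∀ i, Tendsto (fun j => M j ω i) atTop (𝓝 (M' ω i)))
    (hClim : ∀ᵐ ω ∂P, Tendsto (fun j => C j ω) atTop (𝓝 (C' ω)))
    (hr : ∀ n, 1 ≤ n → 0 < r n) (hβs : Summable fun j => β j ^ 2)
    (ht : Tendsto (fun n => r n * ∑' i, β (n + i) ^ 2) atTop (𝓝 1))
    (hη : ∀ n i, √(r n) * β (n + i) ≤ η n) (hη0 : Tendsto η atTop (𝓝 0))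
    {ε p : ℝ} (hε : 0 < ε) (hp0 : 0 < p) (hp1 : p < 1) :
    ∀ᵐ ω ∂P, p ≤ liminf (fun n => (P⟦{ω' | M' ω' ∈ ellipsoid (M n ω') (C n ω') ε
      (quantile (chiSquare k) p / r n)} | ℱ n⟧) ω) atTop := by
  set χ := quantile (chiSquare k) p with hχ
  set Y : ℕ → Ω → EuclideanSpace ℝ (Fin k) := fun n ω =>
    WithLp.toLp 2 fun i => √(r n) * (M' ω i - M n ω i) with hY
  have hMm' : ∀ j i, Measurable fun ω => M j ω i := fun j i => (hMm j i).mono (ℱ.le j) le_rfl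
  have hCm' : ∀ j i l, Measurable fun ω => C j ω i l := fun j i l => (hCm j i l).mono (ℱ.le j) le_rfl
  have hYm : ∀ n, Measurable (Y n) := fun n =>
    (WithLp.measurable_toLp 2 _).comp (measurable_pi_lambda _ fun i =>
      ((hM'm i).sub (hMm' n i)).const_mul _)
  -- Conditional probabilities become integrals against the measures `κ n ω`, so weak convergence
  -- can be argued for one `ω` at a time.
  choose κ hκ1 hκ2 using fun n => exists_condLaw (P := P) (ℱ.le n) (hYm n)
  have hΔb : ∀ j ω i l, |(M (j + 1) ω i - M j ω i) * (M (j + 1) ω l - M j ω l)| ≤ β j ^ 2 := by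
    intro j ω i l
    rw [abs_mul, sq]
    exact mul_le_mul (hd j ω i) (hd j ω l) (abs_nonneg _) (hβ j)
  have hΔi : ∀ j i, Integrable (fun ω => M (j + 1) ω i - M j ω i) P := fun j i =>
    Integrable.of_bound ((hMm' _ i).sub (hMm' _ i)).aestronglyMeasurable (β j)
      (Eventually.of_forall fun ω => hd j ω i)
  have hcovi : ∀ j i l, Integrable (fun ω => (M (j + 1) ω i - M j ω i) *
      (M (j + 1) ω l - M j ω l) - β j ^ 2 * C j ω i l) P := fun j i l =>
    (Integrable.of_bound (((hMm' _ i).sub (hMm' _ i)).mul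
      ((hMm' _ l).sub (hMm' _ l))).aestronglyMeasurable (β j ^ 2)
      (Eventually.of_forall fun ω => hΔb j ω i l)).sub
    ((Integrable.of_bound (hCm' j i l).aestronglyMeasurable 1
      (Eventually.of_forall fun ω => hC1 j ω i l)).const_mul _)
  have hcos : ∀ (u : EuclideanSpace ℝ (Fin k)) (φ : ℝ), ∀ᵐ ω ∂P, Tendsto
      (fun n => ∫ y, Real.cos (inner ℝ y u + φ) ∂κ n ω) atTop
      (𝓝 (Real.cos φ * Real.exp (-((u.ofLp ⬝ᵥ (C' ω *ᵥ u.ofLp)) / 2)))) := by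
    intro u φ
    have hsub : ∀ j ω, ∑ i, u i * M (j + 1) ω i - ∑ i, u i * M j ω i =
        ∑ i, u i * (M (j + 1) ω i - M j ω i) := fun j ω => by
      rw [← Finset.sum_sub_distrib]; simp only [mul_sub]
    -- Cramér–Wold: the projection on `u` is a scalar martingale with conditional variances `β j ^ 2
    -- * uᵀ C j u`, and `K = ∑ |u i|` bounds both its increments and its variances.
    have hmain := tendsto_condExp_cos_tail (P := P) ℱ (U := fun j ω => ∑ i, u i * M j ω i)
      (v := fun j ω => u.ofLp ⬝ᵥ (C j ω *ᵥ u.ofLp)) (U' := fun ω => ∑ i, u i * M' ω i)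
      (v' := fun ω => u.ofLp ⬝ᵥ (C' ω *ᵥ u.ofLp)) (β := β) (r := r) (η := η)
      (K := ∑ i, |u i|) φ (Finset.sum_nonneg fun i _ => abs_nonneg _) hβ
      (fun j => (Finset.measurable_fun_sum _ fun i _ => (hMm j i).const_mul _).stronglyMeasurable)
      (fun j => by
        simp only [dotProduct, Matrix.mulVec]
        exact (Finset.measurable_fun_sum _ fun i _ => (Finset.measurable_fun_sum _ fun l _ =>
          (hCm j i l).mul_const _).const_mul _).stronglyMeasurable)
      (fun j ω => by simpa using (hCpsd j ω).dotProduct_mulVec_nonneg u.ofLp)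
      (fun j ω => dotProduct_mulVec_le_sq (hC1 j ω) _)
      (fun j ω => by
        rw [hsub, Finset.sum_mul]
        refine (Finset.abs_sum_le_sum_abs _ _).trans (Finset.sum_le_sum fun i _ => ?_)
        rw [abs_mul]
        exact mul_le_mul_of_nonneg_left (hd j ω i) (abs_nonneg _))
      (fun j => by
        simp only [hsub]
        exact condExp_sum_mul_eq_zero Finset.univ (fun i => u i) (hΔi j) (hmart j))
      (fun j => by
        have := condExp_sum_mul_eq_zero (P := P) (m := ℱ j) Finset.univ
          (fun q : Fin k × Fin k => u q.1 * u q.2) (fun q => hcovi j q.1 q.2)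
          (fun q => hcov j q.1 q.2)
        convert this using 3 with ω
        rw [hsub, sq, Finset.sum_mul_sum, Fintype.sum_prod_type]
        simp only [dotProduct, Matrix.mulVec, Finset.mul_sum]
        rw [← Finset.sum_sub_distrib]
        refine Finset.sum_congr rfl fun i _ => ?_
        rw [← Finset.sum_sub_distrib]
        refine Finset.sum_congr rfl fun l _ => ?_
        ring)
      (by
        filter_upwards [hlim] with ω hω
        exact tendsto_finsetSum _ fun i _ => (hω i).const_mul _)
      (by
        filter_upwards [hClim] with ω hω
        have h1 : Continuous fun A : Matrix (Fin k) (Fin k) ℝ => u.ofLp ⬝ᵥ (A *ᵥ u.ofLp) :=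
          continuous_const.dotProduct (continuous_id.matrix_mulVec continuous_const)
        exact (h1.tendsto _).comp hω)
      hr hβs ht hη hη0
    have hlaw : ∀ n, P[fun ω => Real.cos (√(r n) * (∑ i, u i * M' ω i - ∑ i, u i * M n ω i) + φ) |
        ℱ n] =ᵐ[P] fun ω => ∫ y, Real.cos (inner ℝ y u + φ) ∂κ n ω := by
      intro n
      have h1 := (hκ2 n (fun q => Real.cos (inner ℝ q.2 u + φ))
        ((Real.continuous_cos.measurable.comp (Measurable.add_const
          ((continuous_id.inner continuous_const).measurable) φ)).comp measurable_snd)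
        (Integrable.of_bound (Measurable.aestronglyMeasurable
          ((Real.continuous_cos.measurable.comp (Measurable.add_const
          ((continuous_id.inner continuous_const).measurable) φ)).comp (hYm n))) 1
          (Eventually.of_forall fun ω => Real.abs_cos_le_one _))).2
      convert h1 using 4 with ω
      congr 2
      rw [EuclideanSpace.inner_eq_star_dotProduct, ← Finset.sum_sub_distrib, Finset.mul_sum]
      simp only [hY, dotProduct, star_trivial]
      refine Finset.sum_congr rfl fun i _ => ?_
      ring
    filter_upwards [hmain, ae_all_iff.2 hlaw] with ω h1 h2
    exact h1.congr h2
  have hsec : ∀ n, 1 ≤ n → ∀ᵐ ω ∂P, Integrable (fun y => ‖y‖ ^ 2) (κ n ω) ∧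
      ∫ y, ‖y‖ ^ 2 ∂κ n ω ≤ k * (r n * ∑' i, β (n + i) ^ 2) := by
    intro n hn
    have hsq : √(r n) ^ 2 = r n := Real.sq_sqrt (hr n hn).le
    have hYn : ∀ ω, ‖Y n ω‖ ^ 2 = ∑ i, r n * (M' ω i - M n ω i) ^ 2 := fun ω => by
      rw [EuclideanSpace.real_norm_sq_eq]
      simp only [hY, mul_pow, hsq]
    have hdb : ∀ ω i, ‖(M' ω i - M n ω i) ^ 2‖ ≤ 2 ^ 2 := fun ω i => by
      rw [norm_pow]
      refine pow_le_pow_left₀ (norm_nonneg _) ?_ 2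
      have := abs_sub (M' ω i) (M n ω i)
      rw [Real.norm_eq_abs]
      linarith [hM'1 ω i, hM1 n ω i]
    have hii : ∀ i, Integrable (fun ω => (M' ω i - M n ω i) ^ 2) P := fun i =>
      Integrable.of_bound (((hM'm i).sub (hMm' n i)).pow_const 2).aestronglyMeasurable _
        (Eventually.of_forall fun ω => hdb ω i)
    have h1 := hκ2 n (fun q => ‖q.2‖ ^ 2) ((measurable_norm.pow_const 2).comp measurable_snd) (by
      simp only [hYn]
      exact integrable_finsetSum _ fun i _ => (hii i).const_mul _)
    have h2 : ∀ i, P[fun ω => (M' ω i - M n ω i) ^ 2 | ℱ n] ≤ᵐ[P]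
        fun _ => 1 ^ 2 * ∑' i, β (n + i) ^ 2 := fun i =>
      condExp_sq_tail_le (P := P) ℱ n (U := fun j ω => M j ω i) (v := fun j ω => C j ω i i)
        (a := β) (C := 1) (fun j => (hMm j i).stronglyMeasurable)
        (fun j => (hCm j i i).stronglyMeasurable) (fun j ω => (hCpsd j ω).diag_nonneg)
        (fun j ω => by rw [one_pow]; exact (abs_le.1 (hC1 j ω i i)).2) (fun j ω => hM1 j ω i)
        (fun j => hmart j i) (fun j => by simpa only [sq] using hcov j i i)
        (by filter_upwards [hlim] with ω hω using hω i)
        ((hβs.comp_injective (add_right_injective n)).hasSum)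
    have h3 : P[fun ω => ‖Y n ω‖ ^ 2 | ℱ n] =ᵐ[P]
        fun ω => ∑ i, r n * (P[fun ω => (M' ω i - M n ω i) ^ 2 | ℱ n]) ω := by
      have e1 : (fun ω => ‖Y n ω‖ ^ 2) = ∑ i, r n • fun ω => (M' ω i - M n ω i) ^ 2 := by
        ext ω; simp [hYn]
      rw [e1]
      refine (condExp_finsetSum (fun i _ => (hii i).smul (r n)) (ℱ n)).trans ?_
      have : ∀ᵐ ω ∂P, ∀ i, (P[r n • fun ω => (M' ω i - M n ω i) ^ 2 | ℱ n]) ω =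
          r n * (P[fun ω => (M' ω i - M n ω i) ^ 2 | ℱ n]) ω :=
        ae_all_iff.2 fun i => condExp_smul (r n) _ (ℱ n)
      filter_upwards [this] with ω hω
      simp [hω]
    filter_upwards [h1.1, h1.2, h3, ae_all_iff.2 h2] with ω e1 e2 e3 e4
    refine ⟨e1, ?_⟩
    have e2' : (P[fun ω => ‖Y n ω‖ ^ 2 | ℱ n]) ω = ∫ y, ‖y‖ ^ 2 ∂κ n ω := e2
    rw [← e2', e3]
    calc ∑ i, r n * (P[fun ω => (M' ω i - M n ω i) ^ 2 | ℱ n]) ω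
        ≤ ∑ i : Fin k, r n * ∑' i, β (n + i) ^ 2 := by
          refine Finset.sum_le_sum fun i _ => mul_le_mul_of_nonneg_left ?_ (hr n hn).le
          have := e4 i
          rwa [one_pow, one_mul] at this
      _ = _ := by simp
  -- Scaling by `√(r n)` turns the bound `χ / r n` into `χ`. Centre and matrix are `ℱ n`-measurable,
  -- hence constants under the conditional law.
  have hset : ∀ n, 1 ≤ n → P⟦{ω' | M' ω' ∈ ellipsoid (M n ω') (C n ω') ε (χ / r n)} | ℱ n⟧
      =ᵐ[P] fun ω => (κ n ω).real {y | y.ofLp ⬝ᵥ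
        ((C n ω + ε • (1 : Matrix (Fin k) (Fin k) ℝ))⁻¹ *ᵥ y.ofLp) ≤ χ} := by
    intro n hn
    have hsq : √(r n) ^ 2 = r n := Real.sq_sqrt (hr n hn).le
    set D : Set (Ω × EuclideanSpace ℝ (Fin k)) := {q | q.2.ofLp ⬝ᵥ
        ((C n q.1 + ε • (1 : Matrix (Fin k) (Fin k) ℝ))⁻¹ *ᵥ q.2.ofLp) ≤ χ} with hD
    have hfm : Measurable[(ℱ n).prod inferInstance] fun q : Ω × EuclideanSpace ℝ (Fin k) =>
        q.2.ofLp ⬝ᵥ ((C n q.1 + ε • (1 : Matrix (Fin k) (Fin k) ℝ))⁻¹ *ᵥ q.2.ofLp) := by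
      refine @measurable_dotProduct_inv_mulVec k _ ((ℱ n).prod inferInstance)
        (fun q => C n q.1 + ε • (1 : Matrix (Fin k) (Fin k) ℝ)) (fun q : Ω × EuclideanSpace ℝ (Fin k) => q.2.ofLp)
        (fun i j => ?_) fun i => ?_
      · exact ((hCm n i j).comp measurable_fst).add_const _
      · exact (measurable_pi_apply i).comp ((WithLp.measurable_ofLp 2 _).comp measurable_snd)
    have hDm : MeasurableSet[(ℱ n).prod inferInstance] D := hfm measurableSet_Iic
    have hfm0 : MeasurableSet {ω | (ω, Y n ω) ∈ D} := by
      refine measurableSet_le (measurable_dotProduct_inv_mulVec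
        (B := fun ω => C n ω + ε • (1 : Matrix (Fin k) (Fin k) ℝ)) (y := fun ω => (Y n ω).ofLp)
        (fun i j => ?_) fun i => ?_) measurable_const
      · exact (hCm' n i j).add_const _
      · exact (measurable_pi_apply i).comp ((WithLp.measurable_ofLp 2 _).comp (hYm n))
    have hseteq : {ω' | M' ω' ∈ ellipsoid (M n ω') (C n ω') ε (χ / r n)} =
        {ω | (ω, Y n ω) ∈ D} := by
      ext ω
      simp only [ellipsoid, hD, Set.mem_ofPred_eq]
      have : (Y n ω).ofLp = √(r n) • (M' ω - M n ω) := by ext i; simp [hY]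
      rw [this, Matrix.mulVec_smul, smul_dotProduct, dotProduct_smul, smul_smul, ← sq, hsq,
        smul_eq_mul, le_div_iff₀ (hr n hn), mul_comm]
    have h1 := (hκ2 n (D.indicator fun _ => 1) (measurable_const.indicator hDm)
      (Integrable.of_bound (C := 1) (Measurable.aestronglyMeasurable
        (measurable_const.indicator (s := {ω | (ω, Y n ω) ∈ D}) hfm0))
        (Eventually.of_forall fun ω => by
          by_cases h : (ω, Y n ω) ∈ D <;> simp [h]))).2
    rw [hseteq]
    refine EventuallyEq.trans ?_ (h1.trans (Eventually.of_forall fun ω => ?_))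
    · exact Eventually.of_forall fun ω => rfl
    · have hDω : MeasurableSet {y | (ω, y) ∈ D} :=
        (@measurable_prodMk_left _ _ (ℱ n) _ ω) hDm
      exact integral_indicator_one hDω
  have hdense := TopologicalSpace.exists_countable_dense (EuclideanSpace ℝ (Fin k))
  obtain ⟨s, hsc, hsd⟩ := hdense
  have hs : ∀ φ : ℝ, ∀ᵐ ω ∂P, ∀ u ∈ s, Tendsto
      (fun n => ∫ y, Real.cos (inner ℝ y u + φ) ∂κ n ω) atTop
      (𝓝 (Real.cos φ * Real.exp (-((u.ofLp ⬝ᵥ (C' ω *ᵥ u.ofLp)) / 2)))) := fun φ => (ae_ball_iff hsc).2 fun u _ => hcos u φ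
  have hsec' : ∀ᵐ ω ∂P, ∀ n, 1 ≤ n → _ := ae_all_iff.2 fun n =>
    eventually_imp_distrib_left.2 fun hn => hsec n hn
  have hset' : ∀ᵐ ω ∂P, ∀ n, 1 ≤ n → _ := ae_all_iff.2 fun n =>
    eventually_imp_distrib_left.2 fun hn => hset n hn
  filter_upwards [hs 0, hs (-(Real.pi / 2)), hsec', hset', hClim] with ω c1 c2 c3 c4 c5
  -- Positive semidefiniteness is a closed condition, inherited from the `C n ω`.
  have hpsd : (C' ω).PosSemidef := by
    refine Matrix.PosSemidef.of_dotProduct_mulVec_nonneg ?_ fun x => ?_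
    · ext i j
      have e1 := (tendsto_pi_nhds.1 ((tendsto_pi_nhds.1 c5) j)) i
      have e2 := (tendsto_pi_nhds.1 ((tendsto_pi_nhds.1 c5) i)) j
      refine tendsto_nhds_unique (e1.congr fun n => ?_) e2
      have := (hCpsd n ω).isHermitian.apply i j
      simpa using this
    · have h1 : Continuous fun A : Matrix (Fin k) (Fin k) ℝ => star x ⬝ᵥ (A *ᵥ x) :=
        continuous_const.dotProduct (continuous_id.matrix_mulVec continuous_const)
      exact ge_of_tendsto ((h1.tendsto _).comp c5)
        (Eventually.of_forall fun n => (hCpsd n ω).dotProduct_mulVec_nonneg x)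
  have hchar : ∀ u : EuclideanSpace ℝ (Fin k), Tendsto (fun n => charFun (κ (n + 1) ω) u) atTop
      (𝓝 (charFun (multivariateGaussian 0 (C' ω)) u)) := by
    -- The index is shifted since `r 0` need not be positive. The constant 2 exceeds the limit 1 of
    -- `r n * ∑' i, β (n + i) ^ 2`.
    refine tendsto_charFun_of_dense (ν := fun n => κ (n + 1) ω) (B := k * 2)
      (fun n => (c3 (n + 1) (by omega)).1) ?_ (by fun_prop) hsd fun u hu => ?_
    · have h1 : ∀ᶠ n in atTop, r n * ∑' i, β (n + i) ^ 2 < 2 := ht.eventually (gt_mem_nhds (by norm_num))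
      filter_upwards [(tendsto_add_atTop_nat 1).eventually h1] with n hn
      exact (c3 (n + 1) (by omega)).2.trans (mul_le_mul_of_nonneg_left hn.le (Nat.cast_nonneg k))
    · simp only [charFun_eq_integral_cos (κ _ ω)]
      rw [charFun_multivariateGaussian hpsd]
      have e1 := (tendsto_add_atTop_iff_nat 1).2 (c1 u hu)
      have e2 := (tendsto_add_atTop_iff_nat 1).2 (c2 u hu)
      have e3 := ((Complex.continuous_ofReal.tendsto _).comp e1).add
        (((Complex.continuous_ofReal.tendsto _).comp e2).mul_const Complex.I)
      convert e3 using 2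
      · rfl
      rw [inner_zero_right, Real.cos_zero, Real.cos_neg, Real.cos_pi_div_two]
      push_cast
      ring_nf
  have hν := ProbabilityMeasure.tendsto_of_tendsto_charFun
    (μ := fun n => ⟨κ (n + 1) ω, inferInstance⟩)
    (μ₀ := ⟨multivariateGaussian 0 (C' ω), inferInstance⟩) hchar
  have hfinal := le_liminf_measure_ellipsoid hk hpsd ((tendsto_add_atTop_iff_nat 1).2 c5) hν hε
    hp0 hp1
  refine hfinal.trans (le_of_eq ?_)
  rw [← liminf_nat_add (fun n => (P⟦{ω' | M' ω' ∈ ellipsoid (M n ω') (C n ω') ε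
      (χ / r n)} | ℱ n⟧) ω) 1]
  refine liminf_congr (Eventually.of_forall fun n => ?_)
  exact (c4 (n + 1) (by omega)).symm

/-! ### Measurability of mixtures and posteriors, and Bayes' formula. -/

section Posterior

variable {Ω S T : Type*} [MeasurableSpace Ω] [MeasurableSpace S] [MeasurableSpace T]

theorem measurable_lintegral_of_measure {α β : Type*} [MeasurableSpace α] [MeasurableSpace β]
    {ν : α → Measure β} (hν : Measurable ν) {c : ℝ≥0∞} (hc : c ≠ ∞)
    (hνc : ∀ a, ν a Set.univ ≤ c) {g : α → β → ℝ≥0∞} (hg : Measurable (Function.uncurry g)) :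
    Measurable fun a => ∫⁻ b, g a b ∂ν a := by
  have : IsFiniteKernel (⟨ν, hν⟩ : Kernel α β) := ⟨c, hc.lt_top, hνc⟩
  exact hg.lintegral_kernel_prod_right (κ := ⟨ν, hν⟩)

theorem measurable_integral_of_measure {α β : Type*} [MeasurableSpace α] [MeasurableSpace β]
    {ν : α → Measure β} (hν : Measurable ν) {c : ℝ≥0∞} (hc : c ≠ ∞)
    (hνc : ∀ a, ν a Set.univ ≤ c) {g : α → β → ℝ} (hg : Measurable (Function.uncurry g)) :
    Measurable fun a => ∫ b, g a b ∂ν a := by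
  have : IsFiniteKernel (⟨ν, hν⟩ : Kernel α β) := ⟨c, hc.lt_top, hνc⟩
  exact (hg.stronglyMeasurable.integral_kernel_prod_right (κ := ⟨ν, hν⟩)).measurable

variable {μ : Measure S} {f : S → T → ℝ≥0} {G : Ω → Measure T}

theorem measurable_mixDensity (hf : Measurable (Function.uncurry f)) (hG : Measurable G)
    (hG1 : ∀ ω, G ω Set.univ ≤ 1) : Measurable fun q : Ω × S => mixDensity f (G q.1) q.2 := by
  refine measurable_lintegral_of_measure (hG.comp measurable_fst) ENNReal.one_ne_top
    (fun q => hG1 q.1) (g := fun q t => (f q.2 t : ℝ≥0∞)) ?_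
  exact (hf.comp ((measurable_snd.comp measurable_fst).prodMk measurable_snd)).coe_nnreal_ennreal

theorem measurable_mixDensity_right (hf : Measurable (Function.uncurry f)) (H : Measure T)
    (hH : H Set.univ ≤ 1) : Measurable (mixDensity f H) :=
  (measurable_mixDensity hf (G := fun _ : Unit => H) measurable_const fun _ => hH).comp
    (measurable_const (a := ()) |>.prodMk measurable_id)

theorem measurable_mixPosterior (hf : Measurable (Function.uncurry f)) (hG : Measurable G)
    (hG1 : ∀ ω, G ω Set.univ ≤ 1) : Measurable fun q : Ω × S => mixPosterior f (G q.1) q.2 := by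
  refine Measure.measurable_of_measurable_coe _ fun A hA => ?_
  simp only [mixPosterior, Measure.smul_apply, smul_eq_mul, withDensity_apply _ hA,
    ← lintegral_indicator hA]
  refine (measurable_mixDensity hf hG hG1).inv.mul ?_
  refine measurable_lintegral_of_measure (hG.comp measurable_fst) ENNReal.one_ne_top
    (fun q => hG1 q.1) (g := fun q => A.indicator fun t => (f q.2 t : ℝ≥0∞)) ?_
  have h1 : Measurable fun z : (Ω × S) × T => (f z.1.2 z.2 : ℝ≥0∞) :=
    (hf.comp ((measurable_snd.comp measurable_fst).prodMk measurable_snd)).coe_nnreal_ennreal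
  exact h1.indicator (measurable_snd hA)

theorem measurable_mixPosterior_right (hf : Measurable (Function.uncurry f)) (H : Measure T)
    (hH : H Set.univ ≤ 1) : Measurable (mixPosterior f H) := by
  have h2 : Measurable fun x : S => ((), x) := measurable_prodMk_left
  have h : Measurable ((fun q : Unit × S => mixPosterior f H q.2) ∘ fun x : S => ((), x)) :=
    (measurable_mixPosterior hf (G := fun _ : Unit => H) measurable_const fun _ => hH).comp h2
  change Measurable fun x => mixPosterior f H x
  exact h

-- The bound also covers points where the mixture density is `0` or `∞`. Mass at most one therefore
-- holds for every `ω`, and finite-kernel measurability applies without discarding null sets.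
omit [MeasurableSpace S] in
theorem mixPosterior_univ_le (f : S → T → ℝ≥0) (H : Measure T) (x : S) :
    mixPosterior f H x Set.univ ≤ 1 := by
  rw [mixPosterior, Measure.smul_apply, withDensity_apply _ MeasurableSet.univ,
    Measure.restrict_univ, smul_eq_mul]
  exact ENNReal.inv_mul_le_one _

instance (f : S → T → ℝ≥0) (H : Measure T) (x : S) : IsFiniteMeasure (mixPosterior f H x) :=
  ⟨(mixPosterior_univ_le f H x).trans_lt ENNReal.one_lt_top⟩

theorem measurable_mixMeasure [SFinite μ] (hf : Measurable (Function.uncurry f))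
    (hG : Measurable G) (hG1 : ∀ ω, G ω Set.univ ≤ 1) :
    Measurable fun ω => mixMeasure μ f (G ω) := by
  refine Measure.measurable_of_measurable_coe _ fun B hB => ?_
  simp only [mixMeasure, withDensity_apply _ hB]
  exact (measurable_mixDensity hf hG hG1).lintegral_prod_right'

/-- The observation kernel `t ↦ f(· ∣ t) dμ`. -/
noncomputable def obsKernel (μ : Measure S) [SFinite μ] (f : S → T → ℝ≥0)
    (hf : Measurable (Function.uncurry f)) : Kernel T S where
  toFun t := μ.withDensity fun x => (f x t : ℝ≥0∞)
  measurable' := by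
    refine Measure.measurable_of_measurable_coe _ fun B hB => ?_
    simp only [withDensity_apply _ hB]
    exact Measurable.lintegral_prod_right' (f := fun q : T × S => (f q.2 q.1 : ℝ≥0∞))
      (hf.comp measurable_swap).coe_nnreal_ennreal

theorem obsKernel_apply [SFinite μ] (hf : Measurable (Function.uncurry f)) (t : T) :
    obsKernel μ f hf t = μ.withDensity fun x => (f x t : ℝ≥0∞) := rfl

theorem isMarkovKernel_obsKernel [SFinite μ] (hf : Measurable (Function.uncurry f))
    (hf_one : ∀ t, ∫⁻ x, (f x t : ℝ≥0∞) ∂μ = 1) : IsMarkovKernel (obsKernel μ f hf) :=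
  ⟨fun t => ⟨by rw [obsKernel_apply, withDensity_apply _ MeasurableSet.univ, Measure.restrict_univ,
    hf_one]⟩⟩

variable {H : Measure T}

/-- The factor `f_H(x)` of the mixture cancels the normalization of the posterior, and Tonelli
exchanges the integrals. Where `f_H(x) = 0`, the function `f(x ∣ ·)` vanishes `H`-almost everywhere,
so nothing is lost. -/
theorem lintegral_mixPosterior [SFinite μ] (hf : Measurable (Function.uncurry f))
    (hf_one : ∀ t, ∫⁻ x, (f x t : ℝ≥0∞) ∂μ = 1) (hH : H Set.univ ≤ 1) {w : S → T → ℝ≥0∞}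
    (hw : Measurable (Function.uncurry w)) :
    ∫⁻ x, ∫⁻ t, w x t ∂mixPosterior f H x ∂mixMeasure μ f H =
      ∫⁻ t, ∫⁻ x, w x t ∂obsKernel μ f hf t ∂H := by
  have hfin : IsFiniteMeasure H := ⟨hH.trans_lt ENNReal.one_lt_top⟩
  have hfm : Measurable fun q : S × T => (f q.1 q.2 : ℝ≥0∞) := hf.coe_nnreal_ennreal
  have hd := measurable_mixDensity_right hf H hH
  have htot : ∫⁻ x, mixDensity f H x ∂μ = H Set.univ := by
    simp only [mixDensity]
    rw [lintegral_lintegral_swap hfm.aemeasurable]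
    simp [hf_one]
  have hpost : Measurable fun x => ∫⁻ t, w x t ∂mixPosterior f H x :=
    measurable_lintegral_of_measure (measurable_mixPosterior_right hf H hH) ENNReal.one_ne_top
      (fun x => mixPosterior_univ_le f H x) hw
  have hlt : ∀ᵐ x ∂μ, mixDensity f H x < ∞ :=
    ae_lt_top hd (htot.trans_le hH |>.trans_lt ENNReal.one_lt_top).ne
  have h1 : ∀ᵐ x ∂μ, mixDensity f H x * ∫⁻ t, w x t ∂mixPosterior f H x =
      ∫⁻ t, f x t * w x t ∂H := by
    filter_upwards [hlt] with x hx
    have hfx : Measurable fun t => (f x t : ℝ≥0∞) := hfm.comp measurable_prodMk_left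
    have hwx : Measurable fun t => w x t := hw.comp measurable_prodMk_left
    rw [mixPosterior, lintegral_smul_measure, lintegral_withDensity_eq_lintegral_mul _ hfx hwx,
      smul_eq_mul, ← mul_assoc]
    by_cases h0 : mixDensity f H x = 0
    · have : ∀ᵐ t ∂H, (f x t : ℝ≥0∞) = 0 := (lintegral_eq_zero_iff hfx).1 h0
      rw [h0, zero_mul, zero_mul]
      symm
      refine (lintegral_eq_zero_iff (hfx.mul hwx)).2 ?_
      filter_upwards [this] with t ht
      simp [ht]
    · rw [ENNReal.mul_inv_cancel h0 hx.ne, one_mul]; rfl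
  rw [mixMeasure, lintegral_withDensity_eq_lintegral_mul _ hd hpost]
  simp only [Pi.mul_apply]
  rw [lintegral_congr_ae h1, lintegral_lintegral_swap (hfm.mul hw).aemeasurable]
  refine lintegral_congr fun t => ?_
  have hft : Measurable fun x => (f x t : ℝ≥0∞) := hfm.comp measurable_prodMk_right
  have hwt : Measurable fun x => w x t := hw.comp measurable_prodMk_right
  rw [obsKernel_apply, lintegral_withDensity_eq_lintegral_mul _ hft hwt]
  rfl

theorem mixMeasure_univ [SFinite μ] (hf : Measurable (Function.uncurry f))
    (hf_one : ∀ t, ∫⁻ x, (f x t : ℝ≥0∞) ∂μ = 1) (hH : H Set.univ ≤ 1) :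
    mixMeasure μ f H Set.univ = H Set.univ := by
  have hfin : IsFiniteMeasure H := ⟨hH.trans_lt ENNReal.one_lt_top⟩
  rw [mixMeasure, withDensity_apply _ MeasurableSet.univ, Measure.restrict_univ]
  simp only [mixDensity]
  rw [lintegral_lintegral_swap hf.coe_nnreal_ennreal.aemeasurable]
  simp [hf_one]

theorem mixMeasure_apply [SFinite μ] (hf : Measurable (Function.uncurry f))
    (hH : H Set.univ ≤ 1) {B : Set S} (hB : MeasurableSet B) :
    mixMeasure μ f H B = ∫⁻ t, obsKernel μ f hf t B ∂H := by
  have hfin : IsFiniteMeasure H := ⟨hH.trans_lt ENNReal.one_lt_top⟩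
  rw [mixMeasure, withDensity_apply _ hB]
  simp only [mixDensity, obsKernel_apply, withDensity_apply _ hB]
  rw [lintegral_lintegral_swap hf.coe_nnreal_ennreal.aemeasurable]

/-- Disintegration of the joint law of parameter and observation. -/
theorem compProd_mixPosterior [SFinite μ] (hf : Measurable (Function.uncurry f))
    (hf_one : ∀ t, ∫⁻ x, (f x t : ℝ≥0∞) ∂μ = 1) (hH : H Set.univ ≤ 1) {w : S → T → ℝ}
    (hw : Measurable (Function.uncurry w)) {c : ℝ} (hwc : ∀ x t, |w x t| ≤ c) :
    ∫ x, ∫ t, w x t ∂mixPosterior f H x ∂mixMeasure μ f H =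
      ∫ t, ∫ x, w x t ∂obsKernel μ f hf t ∂H := by
  have hfin : IsFiniteMeasure H := ⟨hH.trans_lt ENNReal.one_lt_top⟩
  have hfin' : IsFiniteMeasure (mixMeasure μ f H) :=
    ⟨(mixMeasure_univ hf hf_one hH).trans_le hH |>.trans_lt ENNReal.one_lt_top⟩
  have := isMarkovKernel_obsKernel hf hf_one
  have hpm := measurable_mixPosterior_right hf H hH
  let κ : Kernel S T := ⟨mixPosterior f H, hpm⟩
  have hκ : IsFiniteKernel κ := ⟨1, ENNReal.one_lt_top, fun x => mixPosterior_univ_le f H x⟩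
  -- The nonnegative case on indicators identifies the two joint laws; signed bounded integrands
  -- then follow from Fubini on each side.
  have heq : (mixMeasure μ f H).compProd κ = (H.compProd (obsKernel μ f hf)).map Prod.swap := by
    ext s hs
    rw [Measure.map_apply measurable_swap hs, Measure.compProd_apply hs,
      Measure.compProd_apply (measurable_swap hs)]
    have hsm : Measurable (s.indicator (1 : S × T → ℝ≥0∞)) := measurable_one.indicator hs
    have h1 := lintegral_mixPosterior (μ := μ) hf hf_one hH
      (w := fun x t => s.indicator (1 : S × T → ℝ≥0∞) (x, t)) hsm
    have e1 : ∀ x, ∫⁻ t, s.indicator 1 (x, t) ∂mixPosterior f H x =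
        mixPosterior f H x (Prod.mk x ⁻¹' s) := fun x =>
      lintegral_indicator_one (μ := mixPosterior f H x) (measurable_prodMk_left hs)
    have e2 : ∀ t, ∫⁻ x, s.indicator 1 (x, t) ∂obsKernel μ f hf t =
        obsKernel μ f hf t (Prod.mk t ⁻¹' (Prod.swap ⁻¹' s)) := fun t =>
      lintegral_indicator_one (μ := obsKernel μ f hf t)
        (measurable_prodMk_left (measurable_swap hs))
    simp only [e1, e2] at h1
    exact h1
  have hi : Integrable (Function.uncurry w) ((mixMeasure μ f H).compProd κ) :=
    Integrable.of_bound hw.aestronglyMeasurable c (Eventually.of_forall fun q => hwc q.1 q.2)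
  have hi2 : Integrable (fun q : T × S => w q.2 q.1) (H.compProd (obsKernel μ f hf)) :=
    Integrable.of_bound (hw.comp measurable_swap).aestronglyMeasurable c
      (Eventually.of_forall fun q => hwc q.2 q.1)
  have h1 := Measure.integral_compProd hi
  have h2 := Measure.integral_compProd hi2
  rw [heq, integral_map measurable_swap.aemeasurable hw.aestronglyMeasurable] at h1
  exact h1.symm.trans h2

end Posterior

/-! ### Newton sequences and their martingale property. -/

/-- The exceptional null set depends on `A`. A countable generating algebra leaves a single null
set, and a π-system argument extends the equality. -/
theorem ae_eq_measure_of_forall {Ω E : Type*} {m0 : MeasurableSpace Ω} [mE : MeasurableSpace E]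
    [MeasurableSpace.CountablyGenerated E] {P : Measure Ω} {κ κ' : Ω → Measure E}
    [∀ ω, IsFiniteMeasure (κ ω)]
    (h : ∀ A, MeasurableSet A → ∀ᵐ ω ∂P, κ ω A = κ' ω A) : ∀ᵐ ω ∂P, κ ω = κ' ω := by
  set 𝒜 := generateSetAlgebra (MeasurableSpace.countableGeneratingSet E) with h𝒜
  have hgen : MeasurableSpace.generateFrom 𝒜 = mE := by
    rw [generateFrom_generateSetAlgebra_eq, MeasurableSpace.generateFrom_countableGeneratingSet]
  have hc : 𝒜.Countable :=
    countable_generateSetAlgebra MeasurableSpace.countable_countableGeneratingSet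
  have hm : ∀ A ∈ 𝒜, MeasurableSet A := fun A hA =>
    hgen.le A (MeasurableSpace.measurableSet_generateFrom hA)
  have h1 : ∀ᵐ ω ∂P, ∀ A ∈ 𝒜, κ ω A = κ' ω A := (ae_ball_iff hc).2 fun A hA => h A (hm A hA)
  filter_upwards [h1, h Set.univ MeasurableSet.univ] with ω h2 h3
  exact ext_of_generate_finite 𝒜 hgen.symm
    (IsSetAlgebra.isSetRing isSetAlgebra_generateSetAlgebra).isSetSemiring.isPiSystem h2 h3

/-- If `κ` is a version of the conditional law of `Y` given `m`, conditional expectations of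
functions of `(ω, Y ω)` are integrals against `κ`. -/
theorem condExp_eq_integral_of_condLaw {Ω E : Type*} {m m0 : MeasurableSpace Ω} (hm : m ≤ m0)
    [mE : MeasurableSpace E] [StandardBorelSpace E] {P : Measure[m0] Ω}
    [IsProbabilityMeasure P] {Y : Ω → E} (hY : Measurable Y) {κ : Ω → Measure E}
    [∀ ω, IsFiniteMeasure (κ ω)]
    (hκ : ∀ A, MeasurableSet A → P⟦Y ⁻¹' A | m⟧ =ᵐ[P] fun ω => (κ ω).real A)
    {g : Ω × E → ℝ} (hg : Measurable[m.prod mE] g) (hgi : Integrable (fun ω => g (ω, Y ω)) P) :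
    P[fun ω => g (ω, Y ω) | m] =ᵐ[P] fun ω => ∫ y, g (ω, y) ∂κ ω := by
  have : Nonempty Ω := nonempty_of_isProbabilityMeasure P
  have : Nonempty E := this.map Y
  obtain ⟨κ', h1, h2⟩ := exists_condLaw hm (P := P) hY
  -- Both families are versions of the same conditional probabilities, so they almost surely
  -- coincide as measures and the formula for the regular version `κ'` transfers to `κ`.
  have h3 : ∀ A, MeasurableSet A → ∀ᵐ ω ∂P, κ ω A = κ' ω A := fun A hA => by
    have h4 := (h2 (fun q => A.indicator (fun _ => 1) q.2)
      ((measurable_const.indicator hA).comp measurable_snd)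
      ((integrable_const (1 : ℝ)).indicator (hY hA))).2
    filter_upwards [hκ A hA, h4] with ω h5 h6
    have h7 : (P⟦Y ⁻¹' A | m⟧) ω = ∫ y, A.indicator (fun _ => (1 : ℝ)) y ∂κ' ω := h6
    rw [h5] at h7
    have h8 : ∫ y, A.indicator (fun _ => (1 : ℝ)) y ∂κ' ω = (κ' ω).real A :=
      integral_indicator_one hA
    rw [h8] at h7
    exact (measureReal_eq_measureReal_iff).1 h7
  filter_upwards [ae_eq_measure_of_forall h3, (h2 g hg hgi).2] with ω h4 h5
  rw [h5, h4]

section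

variable {Ω S T : Type*} [MeasurableSpace S] [MeasurableSpace T]

theorem measurable_integral_mixPosterior [MeasurableSpace Ω] {f : S → T → ℝ≥0} {G : Ω → Measure T}
    (hf : Measurable (Function.uncurry f)) (hG : Measurable G)
    (hG1 : ∀ ω, G ω Set.univ ≤ 1) {w : Ω → T → ℝ} (hw : Measurable (Function.uncurry w)) :
    Measurable fun q : Ω × S => ∫ t, w q.1 t ∂mixPosterior f (G q.1) q.2 :=
  measurable_integral_of_measure (measurable_mixPosterior hf hG hG1) ENNReal.one_ne_top
    (fun _ => mixPosterior_univ_le f _ _) (g := fun q t => w q.1 t)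
    (hw.comp ((measurable_fst.comp measurable_fst).prodMk measurable_snd))

theorem measurable_real_mixPosterior [MeasurableSpace Ω] {f : S → T → ℝ≥0} {G : Ω → Measure T}
    (hf : Measurable (Function.uncurry f)) (hG : Measurable G)
    (hG1 : ∀ ω, G ω Set.univ ≤ 1) {A : Set T} (hA : MeasurableSet A) :
    Measurable fun q : Ω × S => (mixPosterior f (G q.1) q.2).real A :=
  ((Measure.measurable_coe hA).comp (measurable_mixPosterior hf hG hG1)).ennreal_toReal

theorem measurable_real_of_measure [MeasurableSpace Ω] {G : Ω → Measure T} (hG : Measurable G)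
    {A : Set T} (hA : MeasurableSet A) : Measurable fun ω => (G ω).real A :=
  ((Measure.measurable_coe hA).comp hG).ennreal_toReal

theorem measureReal_le_one_of_univ_le {H : Measure T} (hH : H Set.univ ≤ 1) (A : Set T) :
    H.real A ≤ 1 :=
  ENNReal.toReal_le_of_le_ofReal zero_le_one
    (by rw [ENNReal.ofReal_one]; exact (measure_mono (Set.subset_univ A)).trans hH)

theorem abs_integral_le_of_univ_le {H : Measure T} (hH : H Set.univ ≤ 1) {g : T → ℝ} {c : ℝ}
    (hg : ∀ t, |g t| ≤ c) (hc : 0 ≤ c) : |∫ t, g t ∂H| ≤ c := by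
  have hfin : IsFiniteMeasure H := ⟨hH.trans_lt ENNReal.one_lt_top⟩
  have := norm_integral_le_of_norm_le_const (μ := H) (f := g) (Eventually.of_forall hg)
  exact this.trans (mul_le_of_le_one_right hc (measureReal_le_one_of_univ_le hH _))

/-- A sequence of random measures updated by Newton's rule with weights `β n`, where the `n`-th
observation `Z n` has conditional law `mixMeasure μ f (G n)` given the past `ℱ n`. -/
structure IsNewtonSequence {m0 : MeasurableSpace Ω} (P : Measure Ω) (μ : Measure S)
    (f : S → T → ℝ≥0) (β : ℕ → ℝ) (ℱ : Filtration ℕ m0) (G : ℕ → Ω → Measure T)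
    (Z : ℕ → Ω → S) : Prop where
  measurable_density : Measurable (Function.uncurry f)
  density_one : ∀ t, ∫⁻ x, (f x t : ℝ≥0∞) ∂μ = 1
  weight_mem : ∀ n, β n ∈ Set.Ioo (0 : ℝ) 1
  measurable_measure : ∀ n, Measurable[ℱ n] (G n)
  univ_le : ∀ n ω, G n ω Set.univ ≤ 1
  measurable_obs : ∀ n, Measurable (Z n)
  step : ∀ n ω, G (n + 1) ω =
    ENNReal.ofReal (1 - β n) • G n ω + ENNReal.ofReal (β n) • mixPosterior f (G n ω) (Z n ω)
  univ_eq : ∀ n, ∀ᵐ ω ∂P, G n ω Set.univ = 1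
  obs_law : ∀ n B, MeasurableSet B →
    P⟦Z n ⁻¹' B | ℱ n⟧ =ᵐ[P] fun ω => (mixMeasure μ f (G n ω)).real B

namespace IsNewtonSequence

variable {m0 : MeasurableSpace Ω} {P : Measure Ω} [IsProbabilityMeasure P] {μ : Measure S}
  [SFinite μ] [StandardBorelSpace S] {f : S → T → ℝ≥0} {β : ℕ → ℝ} {ℱ : Filtration ℕ m0}
  {G : ℕ → Ω → Measure T} {Z : ℕ → Ω → S}

theorem condExp_obs (h : IsNewtonSequence P μ f β ℱ G Z) (n : ℕ) {g : Ω × S → ℝ}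
    (hg : Measurable[(ℱ n).prod inferInstance] g) {c : ℝ} (hgc : ∀ q, |g q| ≤ c) :
    P[fun ω => g (ω, Z n ω) | ℱ n] =ᵐ[P] fun ω => ∫ x, g (ω, x) ∂mixMeasure μ f (G n ω) := by
  have hfin : ∀ ω, IsFiniteMeasure (mixMeasure μ f (G n ω)) := fun ω =>
    ⟨(mixMeasure_univ h.measurable_density h.density_one (h.univ_le n ω)).trans_le
      (h.univ_le n ω) |>.trans_lt ENNReal.one_lt_top⟩
  have hg0 : Measurable g := hg.mono (sup_le_sup (MeasurableSpace.comap_mono (ℱ.le n)) le_rfl) le_rfl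
  exact condExp_eq_integral_of_condLaw (ℱ.le n) (h.measurable_obs n) (h.obs_law n) hg
    (Integrable.of_bound (hg0.comp (measurable_id.prodMk (h.measurable_obs n))).aestronglyMeasurable
      c (Eventually.of_forall fun ω => hgc _))

omit [IsProbabilityMeasure P] [StandardBorelSpace S] in
theorem ae_isProbabilityMeasure_mixMeasure (h : IsNewtonSequence P μ f β ℱ G Z) (n : ℕ) :
    ∀ᵐ ω ∂P, IsProbabilityMeasure (mixMeasure μ f (G n ω)) := by
  filter_upwards [h.univ_eq n] with ω hω
  exact ⟨(mixMeasure_univ h.measurable_density h.density_one (h.univ_le n ω)).trans hω⟩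

omit [IsProbabilityMeasure P] [SFinite μ] [StandardBorelSpace S] in
theorem integral_step (h : IsNewtonSequence P μ f β ℱ G Z) (n : ℕ) (ω : Ω) {w : T → ℝ}
    (hw : Measurable w) {c : ℝ} (hwc : ∀ t, |w t| ≤ c) :
    ∫ t, w t ∂G (n + 1) ω =
      (1 - β n) * ∫ t, w t ∂G n ω + β n * ∫ t, w t ∂mixPosterior f (G n ω) (Z n ω) := by
  have hfin : IsFiniteMeasure (G n ω) := ⟨(h.univ_le n ω).trans_lt ENNReal.one_lt_top⟩
  have hi : ∀ (ν : Measure T) [IsFiniteMeasure ν], Integrable w ν := fun ν _ =>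
    Integrable.of_bound hw.aestronglyMeasurable c (Eventually.of_forall hwc)
  rw [h.step, integral_add_measure ((hi _).smul_measure ENNReal.ofReal_ne_top)
    ((hi _).smul_measure ENNReal.ofReal_ne_top), integral_smul_measure, integral_smul_measure,
    ENNReal.toReal_ofReal (sub_nonneg.2 (h.weight_mem n).2.le),
    ENNReal.toReal_ofReal (h.weight_mem n).1.le]
  rfl

omit [IsProbabilityMeasure P] [SFinite μ] [StandardBorelSpace S] in
theorem real_step (h : IsNewtonSequence P μ f β ℱ G Z) (n : ℕ) (ω : Ω) (A : Set T) :
    (G (n + 1) ω).real A =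
      (1 - β n) * (G n ω).real A + β n * (mixPosterior f (G n ω) (Z n ω)).real A := by
  have hfin : IsFiniteMeasure (G n ω) := ⟨(h.univ_le n ω).trans_lt ENNReal.one_lt_top⟩
  rw [h.step, measureReal_def, Measure.add_apply, Measure.smul_apply, Measure.smul_apply,
    smul_eq_mul, smul_eq_mul, ENNReal.toReal_add (ENNReal.mul_ne_top ENNReal.ofReal_ne_top
    (measure_ne_top _ _)) (ENNReal.mul_ne_top ENNReal.ofReal_ne_top (measure_ne_top _ _)),
    ENNReal.toReal_mul, ENNReal.toReal_mul,
    ENNReal.toReal_ofReal (sub_nonneg.2 (h.weight_mem n).2.le),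
    ENNReal.toReal_ofReal (h.weight_mem n).1.le]
  rfl

/-- The integrals of predictable bounded functions have the martingale property. -/
theorem condExp_integral_succ (h : IsNewtonSequence P μ f β ℱ G Z) (n : ℕ) {w : Ω → T → ℝ}
    (hw : Measurable[(ℱ n).prod inferInstance] (Function.uncurry w)) {c : ℝ}
    (hwc : ∀ ω t, |w ω t| ≤ c) :
    P[fun ω => ∫ t, w ω t ∂G (n + 1) ω | ℱ n] =ᵐ[P] fun ω => ∫ t, w ω t ∂G n ω := by
  have hwω : ∀ ω, Measurable (w ω) := fun ω => hw.comp (@measurable_prodMk_left _ _ (ℱ n) _ ω)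
  have hne : Nonempty Ω := nonempty_of_isProbabilityMeasure P
  have hc : 0 ≤ c := by
    by_cases hT : Nonempty T
    · obtain ⟨ω⟩ := hne; obtain ⟨t⟩ := hT
      exact (abs_nonneg _).trans (hwc ω t)
    · exfalso
      obtain ⟨ω, hω⟩ := (h.univ_eq n).exists
      have : IsEmpty T := not_nonempty_iff.1 hT
      rw [Set.univ_eq_empty_iff.2 this, measure_empty] at hω
      exact zero_ne_one hω
  have m1 : Measurable[ℱ n] fun ω => ∫ t, w ω t ∂G n ω :=
    @measurable_integral_of_measure Ω T (ℱ n) _ (G n) (h.measurable_measure n) 1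
      ENNReal.one_ne_top (h.univ_le n) w hw
  have m2 : Measurable[(ℱ n).prod inferInstance]
      fun q : Ω × S => ∫ t, w q.1 t ∂mixPosterior f (G n q.1) q.2 :=
    @measurable_integral_mixPosterior Ω S T _ _ (ℱ n) f (G n) h.measurable_density
      (h.measurable_measure n) (h.univ_le n) w hw
  have hg := h.condExp_obs n (g := fun q => (1 - β n) * ∫ t, w q.1 t ∂G n q.1 +
    β n * ∫ t, w q.1 t ∂mixPosterior f (G n q.1) q.2) (c := c)
    (((m1.comp measurable_fst).const_mul _).add (m2.const_mul _)) (fun q => by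
      have b1 := abs_integral_le_of_univ_le (h.univ_le n q.1) (hwc q.1) hc
      have b2 := abs_integral_le_of_univ_le (mixPosterior_univ_le f (G n q.1) q.2) (hwc q.1) hc
      refine (abs_add_le _ _).trans ?_
      rw [abs_mul, abs_mul, abs_of_pos (sub_pos.2 (h.weight_mem n).2),
        abs_of_pos (h.weight_mem n).1]
      have e1 := mul_le_mul_of_nonneg_left b1 (sub_pos.2 (h.weight_mem n).2).le
      have e2 := mul_le_mul_of_nonneg_left b2 (h.weight_mem n).1.le
      linarith)
  have hstep : ∀ ω, ∫ t, w ω t ∂G (n + 1) ω = (1 - β n) * ∫ t, w ω t ∂G n ω +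
      β n * ∫ t, w ω t ∂mixPosterior f (G n ω) (Z n ω) := fun ω =>
    h.integral_step n ω (hwω ω) (hwc ω)
  simp only [hstep]
  filter_upwards [hg, h.ae_isProbabilityMeasure_mixMeasure n] with ω h1 h2
  rw [h1]
  have hmk := isMarkovKernel_obsKernel (μ := μ) h.measurable_density h.density_one
  -- The integrand does not depend on the observation, so averaging the posterior over the mixture
  -- gives back the prior `G n ω`.
  have e1 := compProd_mixPosterior h.measurable_density h.density_one (h.univ_le n ω)
    (w := fun _ t => w ω t) ((hwω ω).comp measurable_snd) (fun _ t => hwc ω t)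
  simp only [integral_const, probReal_univ, one_smul] at e1
  have m3 : Measurable fun x => ∫ t, w ω t ∂mixPosterior f (G n ω) x :=
    m2.comp (@measurable_prodMk_left _ _ (ℱ n) _ ω)
  rw [integral_add (integrable_const _) (Integrable.const_mul (Integrable.of_bound
    m3.aestronglyMeasurable c (Eventually.of_forall fun x =>
      abs_integral_le_of_univ_le (mixPosterior_univ_le f (G n ω) x) (hwc ω) hc)) _),
    integral_const_mul (β n), e1]
  simp only [integral_const, probReal_univ, one_smul]
  ring

end IsNewtonSequence

end

/-! ### Conditional covariance of the increments. -/

section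

variable {Ω S T : Type*} [MeasurableSpace S] [MeasurableSpace T]

section CovMatrix

variable {μ : Measure S} [SFinite μ] {f : S → T → ℝ≥0} {H : Measure T}

theorem integral_real_mixPosterior (hf : Measurable (Function.uncurry f))
    (hf_one : ∀ t, ∫⁻ x, (f x t : ℝ≥0∞) ∂μ = 1) (hH : H Set.univ ≤ 1) {A : Set T}
    (hA : MeasurableSet A) :
    ∫ x, (mixPosterior f H x).real A ∂mixMeasure μ f H = H.real A := by
  have hmk := isMarkovKernel_obsKernel (μ := μ) hf hf_one
  have e1 := compProd_mixPosterior (μ := μ) hf hf_one hH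
    (w := fun _ t => A.indicator (fun _ => (1 : ℝ)) t)
    ((measurable_const.indicator hA).comp measurable_snd) (c := 1) (fun _ t => by
      by_cases ht : t ∈ A <;> simp [ht])
  simp only [integral_const, probReal_univ, one_smul] at e1
  simpa [integral_indicator hA] using e1

theorem isFiniteMeasure_mixMeasure (hf : Measurable (Function.uncurry f))
    (hf_one : ∀ t, ∫⁻ x, (f x t : ℝ≥0∞) ∂μ = 1) (hH : H Set.univ ≤ 1) :
    IsFiniteMeasure (mixMeasure μ f H) :=
  ⟨(mixMeasure_univ hf hf_one hH).trans_le hH |>.trans_lt ENNReal.one_lt_top⟩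

variable {k : ℕ} {A : Fin k → Set T}

theorem measurable_real_mixPosterior_right (hf : Measurable (Function.uncurry f))
    (hH : H Set.univ ≤ 1) {A : Set T} (hA : MeasurableSet A) :
    Measurable fun x => (mixPosterior f H x).real A :=
  measurable_real_of_measure (measurable_mixPosterior_right hf H hH) hA

theorem abs_covMatrix_le (hf : Measurable (Function.uncurry f))
    (hf_one : ∀ t, ∫⁻ x, (f x t : ℝ≥0∞) ∂μ = 1) (hH : H Set.univ ≤ 1) (i j : Fin k) :
    |covMatrix μ f H A i j| ≤ 1 := by
  have hp : ∀ x i, (mixPosterior f H x).real (A i) ≤ 1 := fun x i =>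
    measureReal_le_one_of_univ_le (mixPosterior_univ_le f H x) _
  have h1 : |∫ x, (mixPosterior f H x).real (A i) * (mixPosterior f H x).real (A j)
      ∂mixMeasure μ f H| ≤ 1 :=
    abs_integral_le_of_univ_le ((mixMeasure_univ hf hf_one hH).trans_le hH) (fun x => by
      rw [abs_of_nonneg (by positivity)]
      exact mul_le_one₀ (hp x i) measureReal_nonneg (hp x j)) zero_le_one
  have h2 : 0 ≤ ∫ x, (mixPosterior f H x).real (A i) * (mixPosterior f H x).real (A j)
      ∂mixMeasure μ f H := integral_nonneg fun x => by positivity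
  have h3 : H.real (A i) * H.real (A j) ≤ 1 :=
    mul_le_one₀ (measureReal_le_one_of_univ_le hH _) measureReal_nonneg
      (measureReal_le_one_of_univ_le hH _)
  have h4 : 0 ≤ H.real (A i) * H.real (A j) := by positivity
  rw [abs_of_nonneg h2] at h1
  rw [covMatrix, Matrix.of_apply, abs_le]
  constructor <;> linarith

/-- With `g = ∑ y i * p i`, the form at `y` is `∫ g² - (∫ g)²`. It is nonnegative even when the
mixture has mass below one, so the property holds for every `ω`. -/
theorem posSemidef_covMatrix (hf : Measurable (Function.uncurry f))
    (hf_one : ∀ t, ∫⁻ x, (f x t : ℝ≥0∞) ∂μ = 1) (hH : H Set.univ ≤ 1)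
    (hA : ∀ i, MeasurableSet (A i)) : (covMatrix μ f H A).PosSemidef := by
  have hfin := isFiniteMeasure_mixMeasure hf hf_one hH
  set F := mixMeasure μ f H with hF
  set p : Fin k → S → ℝ := fun i x => (mixPosterior f H x).real (A i) with hp
  have hp1 : ∀ i x, |p i x| ≤ 1 := fun i x => by
    rw [abs_of_nonneg measureReal_nonneg]
    exact measureReal_le_one_of_univ_le (mixPosterior_univ_le f H x) _
  have hpm : ∀ i, Measurable (p i) := fun i => measurable_real_mixPosterior_right hf hH (hA i)
  have hpi : ∀ i, Integrable (p i) F := fun i =>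
    Integrable.of_bound (hpm i).aestronglyMeasurable 1 (Eventually.of_forall (hp1 i))
  have hppi : ∀ i j, Integrable (fun x => p i x * p j x) F := fun i j =>
    Integrable.of_bound ((hpm i).mul (hpm j)).aestronglyMeasurable 1 (Eventually.of_forall fun x => by
      rw [Real.norm_eq_abs, abs_mul]; exact mul_le_one₀ (hp1 i x) (abs_nonneg _) (hp1 j x))
  have hmean : ∀ i, ∫ x, p i x ∂F = H.real (A i) := fun i =>
    integral_real_mixPosterior hf hf_one hH (hA i)
  have hF1 : F.real Set.univ ≤ 1 :=
    measureReal_le_one_of_univ_le ((mixMeasure_univ hf hf_one hH).trans_le hH) _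
  refine Matrix.PosSemidef.of_dotProduct_mulVec_nonneg ?_ fun y => ?_
  · ext i j
    simp [covMatrix, mul_comm]
  set g : S → ℝ := fun x => ∑ i, y i * p i x with hg
  have hgg : ∀ x, g x * g x = ∑ i, ∑ j, y i * y j * (p i x * p j x) := fun x => by
    rw [hg, Finset.sum_mul_sum]
    exact Finset.sum_congr rfl fun i _ => Finset.sum_congr rfl fun j _ => by ring
  have hgi : Integrable g F := integrable_finsetSum _ fun i _ => (hpi i).const_mul _
  have hggi : Integrable (fun x => g x * g x) F := by
    simp only [hgg]
    exact integrable_finsetSum _ fun i _ => integrable_finsetSum _ fun j _ =>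
      (hppi i j).const_mul _
  have hgint : ∫ x, g x ∂F = ∑ i, y i * H.real (A i) := by
    rw [hg, integral_finsetSum _ fun i _ => (hpi i).const_mul _]
    simp only [integral_const_mul, hmean]
  have hggint : ∫ x, g x * g x ∂F = ∑ i, ∑ j, y i * y j * ∫ x, p i x * p j x ∂F := by
    simp only [hgg]
    rw [integral_finsetSum _ fun i _ => integrable_finsetSum _ fun j _ =>
      (hppi i j).const_mul _]
    refine Finset.sum_congr rfl fun i _ => ?_
    rw [integral_finsetSum _ fun j _ => (hppi i j).const_mul _]
    simp only [integral_const_mul]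
  have hq : star y ⬝ᵥ (covMatrix μ f H A *ᵥ y) = ∫ x, g x * g x ∂F - (∫ x, g x ∂F) ^ 2 := by
    rw [hgint, hggint, sq, Finset.sum_mul_sum, ← Finset.sum_sub_distrib]
    simp only [dotProduct, Matrix.mulVec, covMatrix, Matrix.of_apply, Finset.mul_sum, star_trivial]
    refine Finset.sum_congr rfl fun i _ => ?_
    rw [← Finset.sum_sub_distrib]
    refine Finset.sum_congr rfl fun j _ => ?_
    simp only [hp, hF]
    ring
  rw [hq]
  set c := ∫ x, g x ∂F with hc
  have h0 : 0 ≤ ∫ x, (g x - c) ^ 2 ∂F := integral_nonneg fun x => sq_nonneg _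
  have h1 : ∫ x, (g x - c) ^ 2 ∂F = ∫ x, g x * g x ∂F - 2 * c * c + F.real Set.univ * c ^ 2 := by
    have : ∀ x, (g x - c) ^ 2 = (g x * g x - 2 * c * g x) + c ^ 2 := fun x => by ring
    simp only [this]
    have i1 : Integrable (fun x => g x * g x - 2 * c * g x) F := hggi.sub (hgi.const_mul _)
    rw [integral_add i1 (integrable_const _),
      integral_sub hggi (hgi.const_mul _), integral_const_mul, integral_const, smul_eq_mul]
  nlinarith [mul_le_mul_of_nonneg_right hF1 (sq_nonneg c)]

theorem measurable_covMatrix [MeasurableSpace Ω] {G : Ω → Measure T}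
    (hf : Measurable (Function.uncurry f)) (hf_one : ∀ t, ∫⁻ x, (f x t : ℝ≥0∞) ∂μ = 1)
    (hG : Measurable G) (hG1 : ∀ ω, G ω Set.univ ≤ 1) (hA : ∀ i, MeasurableSet (A i))
    (i j : Fin k) : Measurable fun ω => covMatrix μ f (G ω) A i j := by
  simp only [covMatrix, Matrix.of_apply]
  refine Measurable.sub ?_ ((measurable_real_of_measure hG (hA i)).mul
    (measurable_real_of_measure hG (hA j)))
  exact measurable_integral_of_measure (measurable_mixMeasure hf hG hG1) ENNReal.one_ne_top
    (fun ω => (mixMeasure_univ hf hf_one (hG1 ω)).trans_le (hG1 ω))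
    (g := fun ω x => (mixPosterior f (G ω) x).real (A i) * (mixPosterior f (G ω) x).real (A j))
    ((measurable_real_mixPosterior hf hG hG1 (hA i)).mul
      (measurable_real_mixPosterior hf hG hG1 (hA j)))

end CovMatrix

namespace IsNewtonSequence

variable {m0 : MeasurableSpace Ω} {P : Measure Ω} [IsProbabilityMeasure P] {μ : Measure S}
  [SFinite μ] [StandardBorelSpace S] {f : S → T → ℝ≥0} {β : ℕ → ℝ} {ℱ : Filtration ℕ m0}
  {G : ℕ → Ω → Measure T} {Z : ℕ → Ω → S}

omit [IsProbabilityMeasure P] [SFinite μ] [StandardBorelSpace S] in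
theorem real_succ_sub (h : IsNewtonSequence P μ f β ℱ G Z) (n : ℕ) (ω : Ω) (A : Set T) :
    (G (n + 1) ω).real A - (G n ω).real A =
      β n * ((mixPosterior f (G n ω) (Z n ω)).real A - (G n ω).real A) := by
  rw [h.real_step]; ring

omit [IsProbabilityMeasure P] [SFinite μ] [StandardBorelSpace S] in
theorem abs_real_sub_le (h : IsNewtonSequence P μ f β ℱ G Z) (n : ℕ) (ω : Ω) (x : S) (A : Set T) :
    |(mixPosterior f (G n ω) x).real A - (G n ω).real A| ≤ 1 := by
  have h1 := measureReal_le_one_of_univ_le (mixPosterior_univ_le f (G n ω) x) A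
  have h2 := measureReal_le_one_of_univ_le (h.univ_le n ω) A
  have h3 : 0 ≤ (mixPosterior f (G n ω) x).real A := measureReal_nonneg
  have h4 : 0 ≤ (G n ω).real A := measureReal_nonneg
  rw [abs_le]; constructor <;> linarith

omit [IsProbabilityMeasure P] [SFinite μ] [StandardBorelSpace S] in
theorem abs_real_succ_sub_le (h : IsNewtonSequence P μ f β ℱ G Z) (n : ℕ) (ω : Ω) (A : Set T) :
    |(G (n + 1) ω).real A - (G n ω).real A| ≤ β n := by
  rw [h.real_succ_sub, abs_mul, abs_of_pos (h.weight_mem n).1]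
  exact mul_le_of_le_one_right (h.weight_mem n).1.le (h.abs_real_sub_le n ω _ A)

theorem condExp_real_succ_sub (h : IsNewtonSequence P μ f β ℱ G Z) (n : ℕ) {A : Set T}
    (hA : MeasurableSet A) :
    P[fun ω => (G (n + 1) ω).real A - (G n ω).real A | ℱ n] =ᵐ[P] 0 := by
  simp only [h.real_succ_sub]
  have mG : Measurable[ℱ n] fun ω => (G n ω).real A :=
    @measurable_real_of_measure Ω T _ (ℱ n) (G n) (h.measurable_measure n) A hA
  have mp : Measurable[(ℱ n).prod inferInstance]
      fun q : Ω × S => (mixPosterior f (G n q.1) q.2).real A :=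
    @measurable_real_mixPosterior Ω S T _ _ (ℱ n) f (G n) h.measurable_density
      (h.measurable_measure n) (h.univ_le n) A hA
  have hg := h.condExp_obs n (g := fun q => β n * ((mixPosterior f (G n q.1) q.2).real A -
    (G n q.1).real A)) (c := β n) ((mp.sub (mG.comp measurable_fst)).const_mul _) fun q => by
      rw [abs_mul, abs_of_pos (h.weight_mem n).1]
      exact mul_le_of_le_one_right (h.weight_mem n).1.le (h.abs_real_sub_le n _ _ A)
  filter_upwards [hg, h.ae_isProbabilityMeasure_mixMeasure n] with ω h1 h2
  have hH := h.univ_le n ω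
  rw [h1, integral_const_mul, integral_sub (Integrable.of_bound
    (measurable_real_mixPosterior_right h.measurable_density hH hA).aestronglyMeasurable 1
      (Eventually.of_forall fun x => by
        rw [Real.norm_of_nonneg measureReal_nonneg]
        exact measureReal_le_one_of_univ_le (mixPosterior_univ_le f _ x) _)) (integrable_const _),
    integral_real_mixPosterior h.measurable_density h.density_one hH hA]
  simp

/-- Given the past, the increment is `β n` times the posterior vector at a draw from the mixture,
centred at its mean; `covMatrix` is the covariance of that vector. -/
theorem condExp_real_succ_sub_mul (h : IsNewtonSequence P μ f β ℱ G Z) (n : ℕ) {k : ℕ}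
    {A : Fin k → Set T} (hA : ∀ i, MeasurableSet (A i)) (i l : Fin k) :
    P[fun ω => ((G (n + 1) ω).real (A i) - (G n ω).real (A i)) *
      ((G (n + 1) ω).real (A l) - (G n ω).real (A l)) -
        β n ^ 2 * covMatrix μ f (G n ω) A i l | ℱ n] =ᵐ[P] 0 := by
  simp only [h.real_succ_sub]
  have mG : ∀ i, Measurable[ℱ n] fun ω => (G n ω).real (A i) := fun i =>
    @measurable_real_of_measure Ω T _ (ℱ n) (G n) (h.measurable_measure n) (A i) (hA i)
  have mp : ∀ i, Measurable[(ℱ n).prod inferInstance]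
      fun q : Ω × S => (mixPosterior f (G n q.1) q.2).real (A i) := fun i =>
    @measurable_real_mixPosterior Ω S T _ _ (ℱ n) f (G n) h.measurable_density
      (h.measurable_measure n) (h.univ_le n) (A i) (hA i)
  have mC : Measurable[ℱ n] fun ω => covMatrix μ f (G n ω) A i l :=
    @measurable_covMatrix Ω S T _ _ μ _ f k A (ℱ n) (G n) h.measurable_density h.density_one
      (h.measurable_measure n) (h.univ_le n) hA i l
  have mq : ∀ i, Measurable[(ℱ n).prod inferInstance] fun q : Ω × S => β n *
      ((mixPosterior f (G n q.1) q.2).real (A i) - (G n q.1).real (A i)) := fun i =>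
    ((mp i).sub ((mG i).comp measurable_fst)).const_mul _
  have bq : ∀ i (q : Ω × S), |β n *
      ((mixPosterior f (G n q.1) q.2).real (A i) - (G n q.1).real (A i))| ≤ 1 := fun i q => by
    rw [abs_mul, abs_of_pos (h.weight_mem n).1]
    exact mul_le_one₀ (h.weight_mem n).2.le (abs_nonneg _) (h.abs_real_sub_le n _ _ _)
  have hg := h.condExp_obs n (g := fun q =>
    (β n * ((mixPosterior f (G n q.1) q.2).real (A i) - (G n q.1).real (A i))) *
    (β n * ((mixPosterior f (G n q.1) q.2).real (A l) - (G n q.1).real (A l))) -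
      β n ^ 2 * covMatrix μ f (G n q.1) A i l) (c := 2)
    (((mq i).mul (mq l)).sub ((mC.comp measurable_fst).const_mul _)) fun q => by
      refine (abs_sub _ _).trans ?_
      rw [abs_mul, abs_mul (β n ^ 2)]
      have e1 := mul_le_one₀ (bq i q) (abs_nonneg _) (bq l q)
      have e2 : |β n ^ 2| ≤ 1 := by
        rw [abs_of_nonneg (sq_nonneg _)]
        exact pow_le_one₀ (h.weight_mem n).1.le (h.weight_mem n).2.le
      have e3 := mul_le_one₀ e2 (abs_nonneg _)
        (abs_covMatrix_le (A := A) h.measurable_density h.density_one (h.univ_le n q.1) i l)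
      linarith
  filter_upwards [hg, h.ae_isProbabilityMeasure_mixMeasure n] with ω h1 h2
  have hH := h.univ_le n ω
  rw [h1]
  set p : Fin k → S → ℝ := fun i x => (mixPosterior f (G n ω) x).real (A i) with hp
  have hp1 : ∀ i x, |p i x| ≤ 1 := fun i x => by
    rw [abs_of_nonneg measureReal_nonneg]
    exact measureReal_le_one_of_univ_le (mixPosterior_univ_le f _ x) _
  have hpm : ∀ i, Measurable (p i) := fun i =>
    measurable_real_mixPosterior_right h.measurable_density hH (hA i)
  have hpi : ∀ i, Integrable (p i) (mixMeasure μ f (G n ω)) := fun i =>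
    Integrable.of_bound (hpm i).aestronglyMeasurable 1 (Eventually.of_forall (hp1 i))
  have hppi : Integrable (fun x => p i x * p l x) (mixMeasure μ f (G n ω)) :=
    Integrable.of_bound ((hpm i).mul (hpm l)).aestronglyMeasurable 1 (Eventually.of_forall fun x => by
      rw [Real.norm_eq_abs, abs_mul]; exact mul_le_one₀ (hp1 i x) (abs_nonneg _) (hp1 l x))
  have hmean : ∀ i, ∫ x, p i x ∂mixMeasure μ f (G n ω) = (G n ω).real (A i) := fun i =>
    integral_real_mixPosterior h.measurable_density h.density_one hH (hA i)
  have e : ∀ x, β n * (p i x - (G n ω).real (A i)) * (β n * (p l x - (G n ω).real (A l))) -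
      β n ^ 2 * covMatrix μ f (G n ω) A i l =
      β n ^ 2 * (p i x * p l x - (G n ω).real (A i) * p l x - (G n ω).real (A l) * p i x +
        ((G n ω).real (A i) * (G n ω).real (A l) - covMatrix μ f (G n ω) A i l)) := fun x => by ring
  change ∫ x, (β n * (p i x - (G n ω).real (A i)) * (β n * (p l x - (G n ω).real (A l))) -
      β n ^ 2 * covMatrix μ f (G n ω) A i l) ∂_ = 0
  simp only [e]
  have i1 : Integrable (fun x => p i x * p l x - (G n ω).real (A i) * p l x)
      (mixMeasure μ f (G n ω)) := hppi.sub ((hpi l).const_mul _)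
  have i2 : Integrable (fun x => p i x * p l x - (G n ω).real (A i) * p l x -
      (G n ω).real (A l) * p i x) (mixMeasure μ f (G n ω)) := i1.sub ((hpi i).const_mul _)
  rw [integral_const_mul, integral_add i2 (integrable_const _), integral_sub i1 ((hpi i).const_mul _),
    integral_sub hppi ((hpi l).const_mul _), integral_const_mul, integral_const_mul, hmean, hmean,
    integral_const, probReal_univ, one_smul]
  have hC : covMatrix μ f (G n ω) A i l = ∫ x, p i x * p l x ∂mixMeasure μ f (G n ω) -
      (G n ω).real (A i) * (G n ω).real (A l) := rfl
  rw [hC]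
  ring

end IsNewtonSequence

end

/-! ### Almost sure convergence of `G_n(A)` and of the covariance matrices. -/

theorem ae_exists_tendsto_of_bounded_submartingale {Ω : Type*} {m0 : MeasurableSpace Ω}
    {P : Measure Ω} [IsProbabilityMeasure P] {ℱ : Filtration ℕ m0} {M : ℕ → Ω → ℝ}
    (hM : ∀ n, Measurable[ℱ n] (M n)) {c : ℝ} (hc : ∀ n ω, |M n ω| ≤ c)
    (h : ∀ n, M n ≤ᵐ[P] P[M (n + 1) | ℱ n]) :
    ∀ᵐ ω ∂P, ∃ l, Tendsto (fun n => M n ω) atTop (𝓝 l) := by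
  have hs : Submartingale M ℱ P := submartingale_nat
    (fun n => (hM n).stronglyMeasurable)
    (fun n => Integrable.of_bound ((hM n).mono (ℱ.le n) le_rfl).aestronglyMeasurable c
      (Eventually.of_forall (hc n))) h
  refine hs.exists_ae_tendsto_of_bdd (R := c.toNNReal) fun n => ?_
  refine (eLpNorm_le_of_ae_bound (Eventually.of_forall (hc n))).trans ?_
  simp [ENNReal.ofReal]

theorem ae_exists_tendsto_of_bounded_martingale {Ω : Type*} {m0 : MeasurableSpace Ω}
    {P : Measure Ω} [IsProbabilityMeasure P] {ℱ : Filtration ℕ m0} {M : ℕ → Ω → ℝ}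
    (hM : ∀ n, Measurable[ℱ n] (M n)) {c : ℝ} (hc : ∀ n ω, |M n ω| ≤ c)
    (h : ∀ n, P[fun ω => M (n + 1) ω - M n ω | ℱ n] =ᵐ[P] 0) :
    ∀ᵐ ω ∂P, ∃ l, Tendsto (fun n => M n ω) atTop (𝓝 l) := by
  have hi : ∀ n, Integrable (M n) P := fun n =>
    Integrable.of_bound ((hM n).mono (ℱ.le n) le_rfl).aestronglyMeasurable c
      (Eventually.of_forall (hc n))
  have hm : Martingale M ℱ P := martingale_of_condExp_sub_eq_zero_nat
    (fun n => (hM n).stronglyMeasurable) hi h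
  exact ae_exists_tendsto_of_bounded_submartingale hM hc fun n =>
    hm.submartingale.2.1 n (n + 1) n.le_succ

section

variable {Ω S T : Type*} [MeasurableSpace S] [MeasurableSpace T]

omit [MeasurableSpace S] in
theorem mixPosterior_univ_eq_zero_or_one (f : S → T → ℝ≥0) (H : Measure T) (x : S) :
    mixPosterior f H x Set.univ = 0 ∨ mixPosterior f H x Set.univ = 1 := by
  rw [mixPosterior, Measure.smul_apply, withDensity_apply _ MeasurableSet.univ,
    Measure.restrict_univ, smul_eq_mul]
  change (mixDensity f H x)⁻¹ * mixDensity f H x = 0 ∨ (mixDensity f H x)⁻¹ * mixDensity f H x = 1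
  by_cases h0 : mixDensity f H x = 0
  · simp [h0]
  by_cases h1 : mixDensity f H x = ∞
  · simp [h1]
  · exact Or.inr (ENNReal.inv_mul_cancel h0 h1)

/-- Writes the square of a mean `m` as the maximum over `a` of `2 a m - a²`, which is linear in the
measure for fixed `a`. The null measure is allowed because degenerate posteriors are null. -/
theorem integral_two_mul_sub_sq_le {ν : Measure T} (hν : ν Set.univ = 0 ∨ ν Set.univ = 1)
    {φ : T → ℝ} (hφ : Integrable φ ν) (a : ℝ) :
    ∫ t, (2 * a * φ t - a ^ 2) ∂ν ≤ (∫ t, φ t ∂ν) ^ 2 := by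
  rcases hν with h | h
  · rw [Measure.measure_univ_eq_zero.1 h]
    simp
  · have : IsProbabilityMeasure ν := ⟨h⟩
    rw [integral_sub (hφ.const_mul _) (integrable_const _), integral_const_mul, integral_const,
      probReal_univ, one_smul]
    nlinarith [sq_nonneg (∫ t, φ t ∂ν - a)]

theorem integral_two_mul_sub_sq_self {ν : Measure T} (hν : ν Set.univ = 0 ∨ ν Set.univ = 1)
    {φ : T → ℝ} (hφ : Integrable φ ν) :
    ∫ t, (2 * (∫ s, φ s ∂ν) * φ t - (∫ s, φ s ∂ν) ^ 2) ∂ν = (∫ t, φ t ∂ν) ^ 2 := by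
  rcases hν with h | h
  · rw [Measure.measure_univ_eq_zero.1 h]
    simp
  · have : IsProbabilityMeasure ν := ⟨h⟩
    rw [integral_sub (hφ.const_mul _) (integrable_const _), integral_const_mul, integral_const,
      probReal_univ, one_smul]
    ring

/-- The second moment of the posterior mean of `φ`. -/
noncomputable def posteriorSq (μ : Measure S) (f : S → T → ℝ≥0) (φ : T → ℝ) (H : Measure T) : ℝ :=
  ∫ x, (∫ t, φ t ∂mixPosterior f H x) ^ 2 ∂mixMeasure μ f H

namespace IsNewtonSequence

variable {m0 : MeasurableSpace Ω} {P : Measure Ω} [IsProbabilityMeasure P] {μ : Measure S}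
  [SFinite μ] [StandardBorelSpace S] {f : S → T → ℝ≥0} {β : ℕ → ℝ} {ℱ : Filtration ℕ m0}
  {G : ℕ → Ω → Measure T} {Z : ℕ → Ω → S}

omit [IsProbabilityMeasure P] [StandardBorelSpace S] in
theorem measurable_posteriorSq (h : IsNewtonSequence P μ f β ℱ G Z) (n : ℕ) {φ : T → ℝ}
    (hφ : Measurable φ) : Measurable[ℱ n] fun ω => posteriorSq μ f φ (G n ω) := by
  have mq : Measurable[(ℱ n).prod inferInstance]
      fun q : Ω × S => ∫ t, φ t ∂mixPosterior f (G n q.1) q.2 :=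
    @measurable_integral_mixPosterior Ω S T _ _ (ℱ n) f (G n) h.measurable_density
      (h.measurable_measure n) (h.univ_le n) (fun _ t => φ t) (hφ.comp measurable_snd)
  have mF : Measurable[ℱ n] fun ω => mixMeasure μ f (G n ω) :=
    @measurable_mixMeasure Ω S T (ℱ n) _ _ μ f (G n) _ h.measurable_density
      (h.measurable_measure n) (h.univ_le n)
  exact @measurable_integral_of_measure Ω S (ℱ n) _ _ mF 1 ENNReal.one_ne_top
    (fun ω => (mixMeasure_univ h.measurable_density h.density_one (h.univ_le n ω)).trans_le
      (h.univ_le n ω)) (fun ω x => (∫ t, φ t ∂mixPosterior f (G n ω) x) ^ 2) (mq.pow_const 2)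

omit [IsProbabilityMeasure P] [StandardBorelSpace S] in
theorem abs_posteriorSq_le (h : IsNewtonSequence P μ f β ℱ G Z) (n : ℕ) (ω : Ω) {φ : T → ℝ}
    {c : ℝ} (hc : 0 ≤ c) (hφc : ∀ t, |φ t| ≤ c) : |posteriorSq μ f φ (G n ω)| ≤ c ^ 2 :=
  abs_integral_le_of_univ_le ((mixMeasure_univ h.measurable_density h.density_one
    (h.univ_le n ω)).trans_le (h.univ_le n ω)) (fun x => by
      rw [abs_pow]
      exact pow_le_pow_left₀ (abs_nonneg _)
        (abs_integral_le_of_univ_le (mixPosterior_univ_le f _ x) hφc hc) 2) (by positivity)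

/-- For a function `q` of the observation, `∫∫ (2 q(x) φ(t) - q(x)²) f(x ∣ t) dμ dH` is linear in
`H` and at most `posteriorSq` at `H`, with equality when `q` is the posterior mean under `H`. Fixing
the optimal `q` for `G n` gives a predictable linear functional: its conditional mean at `G (n + 1)`
is its value at `G n`, and at `G (n + 1)` it is no longer optimal. -/
theorem posteriorSq_le_condExp (h : IsNewtonSequence P μ f β ℱ G Z) (n : ℕ) {φ : T → ℝ}
    (hφ : Measurable φ) {c : ℝ} (hc : 0 ≤ c) (hφc : ∀ t, |φ t| ≤ c) :
    (fun ω => posteriorSq μ f φ (G n ω)) ≤ᵐ[P]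
      P[fun ω => posteriorSq μ f φ (G (n + 1) ω) | ℱ n] := by
  have hmk := isMarkovKernel_obsKernel (μ := μ) h.measurable_density h.density_one
  set q : Ω → S → ℝ := fun ω x => ∫ t, φ t ∂mixPosterior f (G n ω) x with hq
  have mq : Measurable[(ℱ n).prod inferInstance] (Function.uncurry q) :=
    @measurable_integral_mixPosterior Ω S T _ _ (ℱ n) f (G n) h.measurable_density
      (h.measurable_measure n) (h.univ_le n) (fun _ t => φ t) (hφ.comp measurable_snd)
  have hqc : ∀ ω x, |q ω x| ≤ c := fun ω x =>
    abs_integral_le_of_univ_le (mixPosterior_univ_le f _ x) hφc hc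
  have mqω : ∀ ω, Measurable (q ω) := fun ω => mq.comp (@measurable_prodMk_left _ _ (ℱ n) _ ω)
  set v : Ω → S → T → ℝ := fun ω x t => 2 * q ω x * φ t - q ω x ^ 2 with hv
  have hvc : ∀ ω x t, |v ω x t| ≤ 3 * c ^ 2 := fun ω x t => by
    refine (abs_sub _ _).trans ?_
    rw [abs_mul, abs_mul, abs_pow, abs_two]
    have e1 := mul_le_mul (hqc ω x) (hφc t) (abs_nonneg _) hc
    have e2 := pow_le_pow_left₀ (abs_nonneg _) (hqc ω x) 2
    nlinarith
  have hφi : ∀ (ν : Measure T) [IsFiniteMeasure ν], Integrable φ ν := fun ν _ =>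
    Integrable.of_bound hφ.aestronglyMeasurable c (Eventually.of_forall hφc)
  have mvω : ∀ ω, Measurable (Function.uncurry (v ω)) := fun ω => by
    have m1 : Measurable fun z : S × T => q ω z.1 := (mqω ω).comp measurable_fst
    have m2 : Measurable fun z : S × T => φ z.2 := hφ.comp measurable_snd
    exact ((m1.const_mul 2).mul m2).sub (m1.pow_const 2)
  -- Integrating out the observation turns the functional into the integral of one predictable
  -- function of the parameter.
  set w : Ω → T → ℝ := fun ω t => ∫ x, v ω x t ∂obsKernel μ f h.measurable_density t with hw
  have mw : Measurable[(ℱ n).prod inferInstance] (Function.uncurry w) := by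
    have mv : Measurable[((ℱ n).prod inferInstance).prod inferInstance]
        fun z : (Ω × T) × S => v z.1.1 z.2 z.1.2 := by
      have m1 : Measurable[((ℱ n).prod inferInstance).prod inferInstance]
          fun z : (Ω × T) × S => q z.1.1 z.2 :=
        @Measurable.comp _ _ _ ((@Prod.instMeasurableSpace _ _ (@Prod.instMeasurableSpace _ _ (ℱ n) _) _))
          (@Prod.instMeasurableSpace _ _ (ℱ n) _) _ (Function.uncurry q)
          (fun z : (Ω × T) × S => (z.1.1, z.2)) mq
          ((measurable_fst.comp measurable_fst).prodMk measurable_snd)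
      have m2 : Measurable[((ℱ n).prod inferInstance).prod inferInstance]
          fun z : (Ω × T) × S => φ z.1.2 := hφ.comp (measurable_snd.comp measurable_fst)
      exact ((m1.const_mul 2).mul m2).sub (m1.pow_const 2)
    exact @measurable_integral_of_measure (Ω × T) S ((ℱ n).prod inferInstance) _
      (fun z => obsKernel μ f h.measurable_density z.2)
      ((Kernel.measurable _).comp measurable_snd) 1 ENNReal.one_ne_top
      (fun z => prob_le_one) (fun z x => v z.1 x z.2) mv
  have hwc : ∀ ω t, |w ω t| ≤ 3 * c ^ 2 := fun ω t =>
    abs_integral_le_of_univ_le prob_le_one (fun x => hvc ω x t) (by positivity)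
  have hmix : ∀ j ω, ∫ t, w ω t ∂G j ω =
      ∫ x, ∫ t, v ω x t ∂mixPosterior f (G j ω) x ∂mixMeasure μ f (G j ω) := fun j ω =>
    (compProd_mixPosterior h.measurable_density h.density_one (h.univ_le j ω)
      (mvω ω) (hvc ω)).symm
  have heq : ∀ ω, ∫ t, w ω t ∂G n ω = posteriorSq μ f φ (G n ω) := fun ω => by
    rw [hmix]
    exact integral_congr_ae (Eventually.of_forall fun x =>
      integral_two_mul_sub_sq_self (mixPosterior_univ_eq_zero_or_one f _ x) (hφi _))
  have hle : ∀ ω, ∫ t, w ω t ∂G (n + 1) ω ≤ posteriorSq μ f φ (G (n + 1) ω) := fun ω => by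
    rw [hmix]
    have hH := h.univ_le (n + 1) ω
    have hfin := isFiniteMeasure_mixMeasure (μ := μ) h.measurable_density h.density_one hH
    have hpm := measurable_mixPosterior_right h.measurable_density _ hH
    have m1 : Measurable fun x => ∫ t, v ω x t ∂mixPosterior f (G (n + 1) ω) x :=
      measurable_integral_of_measure hpm ENNReal.one_ne_top
        (fun x => mixPosterior_univ_le f _ x) (mvω ω)
    have m2 : Measurable fun x => ∫ t, φ t ∂mixPosterior f (G (n + 1) ω) x :=
      measurable_integral_of_measure hpm ENNReal.one_ne_top
        (fun x => mixPosterior_univ_le f _ x) (g := fun _ t => φ t) (hφ.comp measurable_snd)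
    refine integral_mono (Integrable.of_bound m1.aestronglyMeasurable (3 * c ^ 2)
      (Eventually.of_forall fun x => abs_integral_le_of_univ_le (mixPosterior_univ_le f _ x)
        (hvc ω x) (by positivity)))
      (Integrable.of_bound (m2.pow_const 2).aestronglyMeasurable (c ^ 2)
      (Eventually.of_forall fun x => by
        rw [Real.norm_eq_abs, abs_pow]
        exact pow_le_pow_left₀ (abs_nonneg _) (abs_integral_le_of_univ_le
          (mixPosterior_univ_le f _ x) hφc hc) 2)) fun x =>
        integral_two_mul_sub_sq_le (mixPosterior_univ_eq_zero_or_one f _ x) (hφi _) _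
  have m3 : Measurable fun ω => ∫ t, w ω t ∂G (n + 1) ω :=
    measurable_integral_of_measure ((h.measurable_measure (n + 1)).mono (ℱ.le _) le_rfl)
      ENNReal.one_ne_top (h.univ_le (n + 1)) (g := w)
      (mw.mono (sup_le_sup (MeasurableSpace.comap_mono (ℱ.le n)) le_rfl) le_rfl)
  have hmono := condExp_mono (m := ℱ n) (μ := P) (Integrable.of_bound m3.aestronglyMeasurable
    (3 * c ^ 2) (Eventually.of_forall fun ω => abs_integral_le_of_univ_le (h.univ_le (n + 1) ω)
      (hwc ω) (by positivity)))
    (Integrable.of_bound (((h.measurable_posteriorSq (n + 1) hφ).mono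
      (ℱ.le _) le_rfl).aestronglyMeasurable) (c ^ 2) (Eventually.of_forall fun ω =>
        h.abs_posteriorSq_le (n + 1) ω hc hφc)) (Eventually.of_forall hle)
  filter_upwards [hmono, h.condExp_integral_succ n mw hwc] with ω h1 h2
  rw [← heq ω, ← h2]
  exact h1

theorem ae_exists_tendsto_posteriorSq (h : IsNewtonSequence P μ f β ℱ G Z) {φ : T → ℝ}
    (hφ : Measurable φ) {c : ℝ} (hc : 0 ≤ c) (hφc : ∀ t, |φ t| ≤ c) :
    ∀ᵐ ω ∂P, ∃ l, Tendsto (fun n => posteriorSq μ f φ (G n ω)) atTop (𝓝 l) :=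
  ae_exists_tendsto_of_bounded_submartingale (fun n => h.measurable_posteriorSq n hφ)
    (fun n ω => h.abs_posteriorSq_le n ω hc hφc) fun n => h.posteriorSq_le_condExp n hφ hc hφc

omit [IsProbabilityMeasure P] [SFinite μ] [StandardBorelSpace S] in
theorem measurable_real (h : IsNewtonSequence P μ f β ℱ G Z) (n : ℕ) {A : Set T}
    (hA : MeasurableSet A) : Measurable[ℱ n] fun ω => (G n ω).real A :=
  @measurable_real_of_measure Ω T _ (ℱ n) (G n) (h.measurable_measure n) A hA

omit [IsProbabilityMeasure P] [SFinite μ] [StandardBorelSpace S] in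
theorem abs_real_le (h : IsNewtonSequence P μ f β ℱ G Z) (n : ℕ) (ω : Ω) (A : Set T) :
    |(G n ω).real A| ≤ 1 := by
  rw [abs_of_nonneg measureReal_nonneg]
  exact measureReal_le_one_of_univ_le (h.univ_le n ω) A

theorem ae_exists_tendsto_real (h : IsNewtonSequence P μ f β ℱ G Z) {A : Set T}
    (hA : MeasurableSet A) : ∀ᵐ ω ∂P, ∃ l, Tendsto (fun n => (G n ω).real A) atTop (𝓝 l) :=
  ae_exists_tendsto_of_bounded_martingale (fun n => h.measurable_real n hA)
    (fun n ω => h.abs_real_le n ω A) fun n => h.condExp_real_succ_sub n hA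

/-- Polarization: `2 p_i p_j = (p_i + p_j)² - p_i² - p_j²`, and each integrated square on the right
is a `posteriorSq` of indicators or their sums. -/
theorem ae_exists_tendsto_covMatrix (h : IsNewtonSequence P μ f β ℱ G Z) {k : ℕ}
    {A : Fin k → Set T} (hA : ∀ i, MeasurableSet (A i)) :
    ∀ᵐ ω ∂P, ∃ C, Tendsto (fun n => covMatrix μ f (G n ω) A) atTop (𝓝 C) := by
  set φ : Fin k → T → ℝ := fun i => (A i).indicator fun _ => 1 with hφ
  have mφ : ∀ i, Measurable (φ i) := fun i => measurable_const.indicator (hA i)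
  have bφ : ∀ i t, |φ i t| ≤ 1 := fun i t => by
    by_cases ht : t ∈ A i <;> simp [hφ, ht]
  have h1 : ∀ᵐ ω ∂P, ∀ i j, ∃ l, Tendsto
      (fun n => posteriorSq μ f (fun t => φ i t + φ j t) (G n ω)) atTop (𝓝 l) :=
    ae_all_iff.2 fun i => ae_all_iff.2 fun j => h.ae_exists_tendsto_posteriorSq
      ((mφ i).add (mφ j)) zero_le_two fun t => (abs_add_le _ _).trans
        ((add_le_add (bφ i t) (bφ j t)).trans_eq one_add_one_eq_two)
  have h2 : ∀ᵐ ω ∂P, ∀ i, ∃ l, Tendsto (fun n => posteriorSq μ f (φ i) (G n ω)) atTop (𝓝 l) :=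
    ae_all_iff.2 fun i => h.ae_exists_tendsto_posteriorSq (mφ i) zero_le_one (bφ i)
  have h3 : ∀ᵐ ω ∂P, ∀ i, ∃ l, Tendsto (fun n => (G n ω).real (A i)) atTop (𝓝 l) :=
    ae_all_iff.2 fun i => h.ae_exists_tendsto_real (hA i)
  filter_upwards [h1, h2, h3] with ω h1 h2 h3
  choose a ha using h1
  choose b hb using h2
  choose g hg using h3
  refine ⟨Matrix.of fun i j => (a i j - b i - b j) / 2 - g i * g j,
    tendsto_pi_nhds.2 fun i => tendsto_pi_nhds.2 fun j => ?_⟩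
  refine ((((ha i j).sub (hb i)).sub (hb j)).div_const 2 |>.sub ((hg i).mul (hg j))).congr
    fun n => ?_
  have hH := h.univ_le n ω
  have hfin := isFiniteMeasure_mixMeasure (μ := μ) h.measurable_density h.density_one hH
  have hpi : ∀ i x, ∫ t, φ i t ∂mixPosterior f (G n ω) x = (mixPosterior f (G n ω) x).real (A i) :=
    fun i x => integral_indicator_one (hA i)
  have hφi : ∀ i x, Integrable (φ i) (mixPosterior f (G n ω) x) := fun i x =>
    Integrable.of_bound (mφ i).aestronglyMeasurable 1 (Eventually.of_forall (bφ i))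
  set p : Fin k → S → ℝ := fun i x => (mixPosterior f (G n ω) x).real (A i) with hp
  have hp1 : ∀ i x, |p i x| ≤ 1 := fun i x => by
    rw [abs_of_nonneg measureReal_nonneg]
    exact measureReal_le_one_of_univ_le (mixPosterior_univ_le f _ x) _
  have hpm : ∀ i, Measurable (p i) := fun i =>
    measurable_real_mixPosterior_right h.measurable_density hH (hA i)
  have hppi : ∀ i j, Integrable (fun x => p i x * p j x) (mixMeasure μ f (G n ω)) := fun i j =>
    Integrable.of_bound ((hpm i).mul (hpm j)).aestronglyMeasurable 1 (Eventually.of_forall fun x => by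
      rw [Real.norm_eq_abs, abs_mul]; exact mul_le_one₀ (hp1 i x) (abs_nonneg _) (hp1 j x))
  have e1 : posteriorSq μ f (fun t => φ i t + φ j t) (G n ω) = ∫ x, (p i x * p i x +
      2 * (p i x * p j x)) + p j x * p j x ∂mixMeasure μ f (G n ω) :=
    integral_congr_ae (Eventually.of_forall fun x => by
      change (∫ t, (φ i t + φ j t) ∂mixPosterior f (G n ω) x) ^ 2 = _
      rw [integral_add (hφi i x) (hφi j x), hpi, hpi]
      ring)
  have e2 : ∀ i, posteriorSq μ f (φ i) (G n ω) = ∫ x, p i x * p i x ∂mixMeasure μ f (G n ω) :=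
    fun i => integral_congr_ae (Eventually.of_forall fun x => by
      change (∫ t, φ i t ∂mixPosterior f (G n ω) x) ^ 2 = _
      rw [hpi]
      ring)
  have i1 : Integrable (fun x => p i x * p i x + 2 * (p i x * p j x)) (mixMeasure μ f (G n ω)) :=
    (hppi i i).add ((hppi i j).const_mul 2)
  have hC : covMatrix μ f (G n ω) A i j = ∫ x, p i x * p j x ∂mixMeasure μ f (G n ω) -
      (G n ω).real (A i) * (G n ω).real (A j) := rfl
  rw [e1, e2, e2, integral_add i1 (hppi j j), integral_add (hppi i i) ((hppi i j).const_mul 2),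
    integral_const_mul, hC]
  ring

end IsNewtonSequence

end

/-! ### From limits on single sets to a random probability measure. -/

section SetwiseLimit

variable {Ω T : Type*} {m0 : MeasurableSpace Ω} [MeasurableSpace T] {P : Measure Ω}
  [IsProbabilityMeasure P]

/-- A setwise limit of random probability measures with a fixed mean measure is almost surely
continuous along each monotone sequence of sets. -/
theorem ae_tendsto_setwiseLimit_iUnion {L : Set T → Ω → ℝ} {ν₀ : Measure T} [IsFiniteMeasure ν₀]
    (hLm : ∀ A, MeasurableSet A → Measurable (L A)) (hL1 : ∀ A ω, |L A ω| ≤ 1)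
    (hmono : ∀ A B, MeasurableSet A → MeasurableSet B → A ⊆ B → ∀ᵐ ω ∂P, L A ω ≤ L B ω)
    (hmean : ∀ A, MeasurableSet A → ∫ ω, L A ω ∂P = ν₀.real A) {A : ℕ → Set T}
    (hA : ∀ n, MeasurableSet (A n)) (hAm : Monotone A) :
    ∀ᵐ ω ∂P, Tendsto (fun n => L (A n) ω) atTop (𝓝 (L (⋃ n, A n) ω)) := by
  have hU := MeasurableSet.iUnion hA
  have hi : ∀ B, MeasurableSet B → Integrable (L B) P := fun B hB =>
    Integrable.of_bound (hLm B hB).aestronglyMeasurable 1 (Eventually.of_forall (hL1 B))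
  -- The sequence increases below its candidate limit and the means converge because `ν₀` is
  -- countably additive, which forces almost sure convergence.
  refine tendsto_of_integral_tendsto_of_monotone (fun n => hi _ (hA n)) (hi _ hU) ?_ ?_ ?_
  · simp only [hmean _ (hA _), hmean _ hU]
    exact (ENNReal.tendsto_toReal (measure_ne_top _ _)).comp (tendsto_measure_iUnion_atTop hAm)
  · have : ∀ᵐ ω ∂P, ∀ n, L (A n) ω ≤ L (A (n + 1)) ω :=
      ae_all_iff.2 fun n => hmono _ _ (hA n) (hA _) (hAm n.le_succ)
    filter_upwards [this] with ω hω
    exact monotone_nat_of_le_succ hω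
  · exact ae_all_iff.2 fun n => hmono _ _ (hA n) hU (Set.subset_iUnion A n)

theorem ae_tendsto_setwiseLimit_iInter {L : Set T → Ω → ℝ} {ν₀ : Measure T} [IsFiniteMeasure ν₀]
    (hLm : ∀ A, MeasurableSet A → Measurable (L A)) (hL1 : ∀ A ω, |L A ω| ≤ 1)
    (hmono : ∀ A B, MeasurableSet A → MeasurableSet B → A ⊆ B → ∀ᵐ ω ∂P, L A ω ≤ L B ω)
    (hmean : ∀ A, MeasurableSet A → ∫ ω, L A ω ∂P = ν₀.real A) {A : ℕ → Set T}
    (hA : ∀ n, MeasurableSet (A n)) (hAm : Antitone A) :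
    ∀ᵐ ω ∂P, Tendsto (fun n => L (A n) ω) atTop (𝓝 (L (⋂ n, A n) ω)) := by
  have hU := MeasurableSet.iInter hA
  have hi : ∀ B, MeasurableSet B → Integrable (L B) P := fun B hB =>
    Integrable.of_bound (hLm B hB).aestronglyMeasurable 1 (Eventually.of_forall (hL1 B))
  refine tendsto_of_integral_tendsto_of_antitone (fun n => hi _ (hA n)) (hi _ hU) ?_ ?_ ?_
  · simp only [hmean _ (hA _), hmean _ hU]
    exact (ENNReal.tendsto_toReal (measure_ne_top _ _)).comp
      (tendsto_measure_iInter_atTop (fun n => (hA n).nullMeasurableSet) hAm ⟨0, measure_ne_top _ _⟩)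
  · have : ∀ᵐ ω ∂P, ∀ n, L (A (n + 1)) ω ≤ L (A n) ω :=
      ae_all_iff.2 fun n => hmono _ _ (hA _) (hA n) (hAm n.le_succ)
    filter_upwards [this] with ω hω
    exact antitone_nat_of_succ_le hω
  · exact ae_all_iff.2 fun n => hmono _ _ hU (hA n) (Set.iInter_subset A n)

/-- Limits at `±∞` and right continuity at rationals each need continuity along one monotone
sequence of half-lines, so countably many null sets suffice. -/
theorem ae_isRatStieltjesPoint_setwiseLimit {L : Set T → Ω → ℝ} {ν₀ : Measure T}
    [IsFiniteMeasure ν₀]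
    (hLm : ∀ A, MeasurableSet A → Measurable (L A)) (hL1 : ∀ A ω, |L A ω| ≤ 1)
    (hmono : ∀ A B, MeasurableSet A → MeasurableSet B → A ⊆ B → ∀ᵐ ω ∂P, L A ω ≤ L B ω)
    (hmean : ∀ A, MeasurableSet A → ∫ ω, L A ω ∂P = ν₀.real A)
    (huniv : ∀ᵐ ω ∂P, L Set.univ ω = 1) (hempty : ∀ᵐ ω ∂P, L ∅ ω = 0)
    {e : T → ℝ} (he : Measurable e) :
    ∀ᵐ ω ∂P, IsRatStieltjesPoint (fun ω (q : ℚ) => L (e ⁻¹' Set.Iic (q : ℝ)) ω) ω := by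
  have hm : ∀ x : ℝ, MeasurableSet (e ⁻¹' Set.Iic x) := fun x => he measurableSet_Iic
  have h1 : ∀ᵐ ω ∂P, ∀ q q' : ℚ, q ≤ q' →
      L (e ⁻¹' Set.Iic (q : ℝ)) ω ≤ L (e ⁻¹' Set.Iic (q' : ℝ)) ω :=
    ae_all_iff.2 fun q => ae_all_iff.2 fun q' => by
      by_cases hq : q ≤ q'
      · filter_upwards [hmono _ _ (hm q) (hm q')
          (Set.preimage_mono (Set.Iic_subset_Iic.2 (Rat.cast_le.2 hq)))] with ω hω _
        exact hω
      · exact Eventually.of_forall fun ω hq' => absurd hq' hq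
  have h2 := ae_tendsto_setwiseLimit_iUnion hLm hL1 hmono hmean
    (A := fun n : ℕ => e ⁻¹' Set.Iic ((n : ℚ) : ℝ)) (fun n => hm _) fun n m hnm =>
      Set.preimage_mono (Set.Iic_subset_Iic.2 (by exact_mod_cast hnm))
  have h3 := ae_tendsto_setwiseLimit_iInter hLm hL1 hmono hmean
    (A := fun n : ℕ => e ⁻¹' Set.Iic ((-(n : ℚ) : ℚ) : ℝ)) (fun n => hm _) fun n m hnm =>
      Set.preimage_mono (Set.Iic_subset_Iic.2 (by
        push_cast; exact neg_le_neg (by exact_mod_cast hnm)))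
  have h4 : ∀ᵐ ω ∂P, ∀ q : ℚ, Tendsto
      (fun n : ℕ => L (e ⁻¹' Set.Iic ((q + 1 / ((n : ℚ) + 1) : ℚ) : ℝ)) ω) atTop
      (𝓝 (L (e ⁻¹' Set.Iic (q : ℝ)) ω)) := ae_all_iff.2 fun q => by
    have hlim : Tendsto (fun n : ℕ => ((q + 1 / ((n : ℚ) + 1) : ℚ) : ℝ)) atTop (𝓝 (q : ℝ)) := by
      have := (tendsto_const_nhds (x := (q : ℝ))).add (tendsto_one_div_add_atTop_nhds_zero_nat (𝕜 := ℝ))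
      rw [add_zero] at this
      refine this.congr fun n => ?_
      push_cast
      rfl
    have h := ae_tendsto_setwiseLimit_iInter hLm hL1 hmono hmean
      (A := fun n : ℕ => e ⁻¹' Set.Iic ((q + 1 / ((n : ℚ) + 1) : ℚ) : ℝ)) (fun n => hm _)
      fun n m hnm => Set.preimage_mono (Set.Iic_subset_Iic.2 (Rat.cast_le.2
        (add_le_add_right (one_div_le_one_div_of_le (by positivity) (by
          exact_mod_cast Nat.succ_le_succ hnm)) q)))
    have hset : ⋂ n : ℕ, e ⁻¹' Set.Iic ((q + 1 / ((n : ℚ) + 1) : ℚ) : ℝ) =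
        e ⁻¹' Set.Iic (q : ℝ) := by
      ext t
      simp only [Set.mem_iInter, Set.mem_preimage, Set.mem_Iic]
      refine ⟨fun h => ge_of_tendsto' hlim h, fun h n => h.trans (Rat.cast_le.2 ?_)⟩
      exact le_add_of_nonneg_right (by positivity)
    rwa [hset] at h
  have e2 : ⋃ n : ℕ, e ⁻¹' Set.Iic ((n : ℚ) : ℝ) = Set.univ := by
    refine Set.eq_univ_of_forall fun t => Set.mem_iUnion.2 ?_
    obtain ⟨n, hn⟩ := exists_nat_ge (e t)
    exact ⟨n, by simpa using hn⟩
  have e3 : ⋂ n : ℕ, e ⁻¹' Set.Iic ((-(n : ℚ) : ℚ) : ℝ) = ∅ := by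
    refine Set.eq_empty_of_forall_notMem fun t ht => ?_
    obtain ⟨n, hn⟩ := exists_nat_gt (-e t)
    have := Set.mem_iInter.1 ht n
    simp only [Set.mem_preimage, Set.mem_Iic] at this
    push_cast at this
    linarith
  rw [e2] at h2
  rw [e3] at h3
  filter_upwards [h1, h2, h3, h4, huniv, hempty] with ω h1 h2 h3 h4 h5 h6
  rw [h5] at h2
  rw [h6] at h3
  have hmonoω : Monotone fun q : ℚ => L (e ⁻¹' Set.Iic (q : ℝ)) ω := fun q q' h => h1 q q' h
  refine ⟨hmonoω, ?_, ?_, fun q => ?_⟩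
  · exact (tendsto_iff_tendsto_subseq_of_monotone hmonoω tendsto_natCast_atTop_atTop).2 h2
  · refine tendsto_order.2 ⟨fun a ha => ?_, fun a ha => ?_⟩
    · have hge : ∀ q : ℚ, 0 ≤ L (e ⁻¹' Set.Iic (q : ℝ)) ω := fun q => by
        obtain ⟨N, hN⟩ := exists_nat_ge (-q)
        refine le_of_tendsto h3 ?_
        filter_upwards [eventually_ge_atTop N] with n hn
        refine h1 _ _ ?_
        have : (N : ℚ) ≤ n := by exact_mod_cast hn
        linarith
      exact Eventually.of_forall fun q => ha.trans_le (hge q)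
    · obtain ⟨N, hN⟩ := (h3.eventually (gt_mem_nhds ha)).exists
      filter_upwards [eventually_le_atBot (-(N : ℚ))] with q hq
      exact (h1 _ _ hq).trans_lt hN
  · have hb : BddBelow (Set.range fun r : Set.Ioi q => L (e ⁻¹' Set.Iic ((r : ℚ) : ℝ)) ω) :=
      ⟨L (e ⁻¹' Set.Iic (q : ℝ)) ω, by rintro _ ⟨r, rfl⟩; exact h1 _ _ (le_of_lt r.2)⟩
    refine le_antisymm (ge_of_tendsto' (h4 q) fun n => ?_) (le_ciInf fun r => h1 _ _ (le_of_lt r.2))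
    exact ciInf_le hb ⟨q + 1 / ((n : ℚ) + 1), lt_add_of_pos_right q (by positivity)⟩

/-- The limits exist off null sets depending on `A`. After embedding `T` in `ℝ`, their values on
rational half-lines determine a random measure, and a π-λ induction shows that it agrees almost
surely with the limit on each Borel set. The fixed mean `ν₀` supplies countable additivity. -/
theorem exists_kernel_tendsto_real [StandardBorelSpace T] {G : ℕ → Ω → Measure T}
    {ν₀ : Measure T} [IsProbabilityMeasure ν₀] (hGm : ∀ n, Measurable (G n))
    (hG1 : ∀ n ω, G n ω Set.univ ≤ 1) (hu : ∀ n, ∀ᵐ ω ∂P, G n ω Set.univ = 1)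
    (hlim : ∀ A, MeasurableSet A → ∀ᵐ ω ∂P, ∃ l, Tendsto (fun n => (G n ω).real A) atTop (𝓝 l))
    (hmean : ∀ n A, MeasurableSet A → ∫ ω, (G n ω).real A ∂P = ν₀.real A) :
    ∃ κ : Kernel Ω T, IsMarkovKernel κ ∧ ∀ A, MeasurableSet A →
      ∀ᵐ ω ∂P, Tendsto (fun n => (G n ω).real A) atTop (𝓝 ((κ ω).real A)) := by
  have hfin : ∀ n ω, IsFiniteMeasure (G n ω) := fun n ω => ⟨(hG1 n ω).trans_lt ENNReal.one_lt_top⟩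
  -- The limsup is defined and measurable everywhere and equals the limit almost surely.
  set L : Set T → Ω → ℝ := fun A ω => limsup (fun n => (G n ω).real A) atTop with hLdef
  have hb0 : ∀ n ω A, 0 ≤ (G n ω).real A := fun n ω A => measureReal_nonneg
  have hb1 : ∀ n ω A, (G n ω).real A ≤ 1 := fun n ω A => measureReal_le_one_of_univ_le (hG1 n ω) A
  have hLm : ∀ A, MeasurableSet A → Measurable (L A) := fun A hA =>
    Measurable.limsup fun n => measurable_real_of_measure (hGm n) hA
  have hL1 : ∀ A ω, |L A ω| ≤ 1 := fun A ω => by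
    have hbd : IsBoundedUnder (· ≤ ·) atTop fun n => (G n ω).real A :=
      isBoundedUnder_of ⟨1, fun n => hb1 n ω A⟩
    have hcb : IsCoboundedUnder (· ≤ ·) atTop fun n => (G n ω).real A :=
      (isBoundedUnder_of ⟨0, fun n => hb0 n ω A⟩ :
        IsBoundedUnder (· ≥ ·) atTop fun n => (G n ω).real A).isCoboundedUnder_le
    rw [abs_le]
    constructor
    · have : (0 : ℝ) ≤ L A ω :=
        le_limsup_of_frequently_le (Frequently.of_forall fun n => hb0 n ω A) hbd
      linarith
    · exact limsup_le_of_le hcb (Eventually.of_forall fun n => hb1 n ω A)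
  have hL : ∀ A, MeasurableSet A →
      ∀ᵐ ω ∂P, Tendsto (fun n => (G n ω).real A) atTop (𝓝 (L A ω)) := fun A hA => by
    filter_upwards [hlim A hA] with ω ⟨l, hl⟩
    rw [hLdef]
    simp only [hl.limsup_eq]
    exact hl
  have hmono : ∀ A B, MeasurableSet A → MeasurableSet B → A ⊆ B → ∀ᵐ ω ∂P, L A ω ≤ L B ω :=
    fun A B hA hB hAB => by
      filter_upwards [hL A hA, hL B hB] with ω h1 h2
      exact le_of_tendsto_of_tendsto' h1 h2 fun n => measureReal_mono hAB
  have hLmean : ∀ A, MeasurableSet A → ∫ ω, L A ω ∂P = ν₀.real A := fun A hA => by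
    have := tendsto_integral_of_dominated_convergence (μ := P) (fun _ => (1 : ℝ))
      (F := fun n ω => (G n ω).real A) (f := L A)
      (fun n => (measurable_real_of_measure (hGm n) hA).aestronglyMeasurable) (integrable_const _)
      (fun n => Eventually.of_forall fun ω => by
        rw [Real.norm_of_nonneg (hb0 n ω A)]; exact hb1 n ω A) (hL A hA)
    simp only [hmean _ A hA] at this
    exact tendsto_nhds_unique this tendsto_const_nhds
  have huniv : ∀ᵐ ω ∂P, L Set.univ ω = 1 := by
    filter_upwards [ae_all_iff.2 hu, hL _ MeasurableSet.univ] with ω h1 h2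
    refine tendsto_nhds_unique h2 (tendsto_const_nhds.congr fun n => ?_)
    rw [measureReal_def, h1 n, ENNReal.toReal_one]
  have hempty : ∀ᵐ ω ∂P, L ∅ ω = 0 := Eventually.of_forall fun ω => by simp [hLdef]
  have hne : Nonempty T := by
    have := nonempty_of_isProbabilityMeasure ν₀
    exact this
  have he := measurableEmbedding_embeddingReal T
  set e := embeddingReal T with hedef
  have hm : ∀ x : ℝ, MeasurableSet (e ⁻¹' Set.Iic x) := fun x => he.measurable measurableSet_Iic
  set F : Ω → ℚ → ℝ := fun ω q => L (e ⁻¹' Set.Iic (q : ℝ)) ω with hF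
  have hFm : Measurable F := measurable_pi_iff.2 fun q => hLm _ (hm _)
  have hst : ∀ᵐ ω ∂P, IsRatStieltjesPoint F ω :=
    ae_isRatStieltjesPoint_setwiseLimit hLm hL1 hmono hLmean huniv hempty he.measurable
  set ν : Ω → Measure ℝ := fun ω => (stieltjesOfMeasurableRat F hFm ω).measure with hν
  have hνp : ∀ ω, IsProbabilityMeasure (ν ω) := fun ω => by rw [hν]; infer_instance
  have key : ∀ B, MeasurableSet B → ∀ᵐ ω ∂P, (ν ω).real B = L (e ⁻¹' B) ω := by
    refine MeasurableSpace.induction_on_inter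
      (BorelSpace.measurable_eq.trans Real.borel_eq_generateFrom_Iic_rat)
      Real.isPiSystem_Iic_rat ?_ ?_ ?_ ?_
    · filter_upwards [hempty] with ω hω
      simp [hω]
    · intro B hB
      obtain ⟨q, rfl⟩ : ∃ q : ℚ, B = Set.Iic (q : ℝ) := by simpa [eq_comm] using hB
      filter_upwards [hst] with ω hω
      rw [measureReal_def, hν]
      simp only
      rw [measure_stieltjesOfMeasurableRat_Iic, ENNReal.toReal_ofReal
        (stieltjesOfMeasurableRat_nonneg hFm ω _), stieltjesOfMeasurableRat_eq,
        toRatCDF_of_isRatStieltjesPoint hω]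
    · intro B hB h
      have hpB := he.measurable hB
      filter_upwards [h, hL _ hpB, hL _ hpB.compl, ae_all_iff.2 hu] with ω h1 h2 h3 h4
      rw [probReal_compl_eq_one_sub hB, h1]
      refine tendsto_nhds_unique (tendsto_const_nhds.sub h2) (h3.congr fun n => ?_)
      have hp : IsProbabilityMeasure (G n ω) := ⟨h4 n⟩
      rw [probReal_compl_eq_one_sub hpB]
    · intro B hdisj hB h
      have hacc : ∀ n, MeasurableSet (Set.accumulate B n) := fun n =>
        MeasurableSet.biUnion (Set.to_countable _) fun i _ => hB i
      have hfinU : ∀ n, ∀ᵐ ω ∂P, (ν ω).real (Set.accumulate B n) =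
          L (e ⁻¹' Set.accumulate B n) ω := fun n => by
        induction n with
        | zero => simpa [Set.accumulate_zero_nat] using h 0
        | succ n ih =>
          have hd : Disjoint (Set.accumulate B n) (B (n + 1)) :=
            Set.disjoint_accumulate hdisj n.lt_succ_self
          have hU : MeasurableSet (e ⁻¹' Set.accumulate B n) := he.measurable (hacc n)
          have hV : MeasurableSet (e ⁻¹' B (n + 1)) := he.measurable (hB (n + 1))
          filter_upwards [ih, h (n + 1), hL _ hU, hL _ hV, hL _ (hU.union hV)] with ω a1 a2 a3 a4 a5
          rw [Set.accumulate_succ, measureReal_union hd (hB _), a1, a2, Set.preimage_union]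
          refine tendsto_nhds_unique (a3.add a4) (a5.congr fun n => ?_)
          rw [measureReal_union (hd.preimage e) hV]
      have hcont := ae_tendsto_setwiseLimit_iUnion hLm hL1 hmono hLmean
        (A := fun n => e ⁻¹' Set.accumulate B n) (fun n => he.measurable (hacc n))
        fun n m hnm => Set.preimage_mono (Set.monotone_accumulate hnm)
      rw [← Set.preimage_iUnion, Set.iUnion_accumulate] at hcont
      filter_upwards [ae_all_iff.2 hfinU, hcont] with ω a1 a2
      have a3 : Tendsto (fun n => (ν ω).real (Set.accumulate B n)) atTop
          (𝓝 ((ν ω).real (⋃ n, B n))) := by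
        rw [← Set.iUnion_accumulate]
        exact (ENNReal.tendsto_toReal (measure_ne_top _ _)).comp
          (tendsto_measure_iUnion_atTop Set.monotone_accumulate)
      exact tendsto_nhds_unique a3 (a2.congr fun n => (a1 n).symm)
  -- A measurable left inverse of the embedding carries the measure on `ℝ` back to `T`.
  obtain ⟨g, hgm, hge⟩ := he.exists_measurable_extend (g := id) measurable_id fun _ => hne
  refine ⟨⟨fun ω => (ν ω).map g, (Measure.measurable_map g hgm).comp
    (measurable_measure_stieltjesOfMeasurableRat hFm)⟩,
    ⟨fun ω => Measure.isProbabilityMeasure_map hgm.aemeasurable⟩, fun A hA => ?_⟩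
  filter_upwards [key _ (hgm hA), hL A hA] with ω h1 h2
  rw [← Set.preimage_comp, hge, Set.preimage_id] at h1
  change Tendsto _ _ (𝓝 (((ν ω).map g).real A))
  rw [map_measureReal_apply hgm hA, h1]
  exact h2

-- The algebra generated by a countable base is a countable π-system containing small neighbourhoods
-- of every point; setwise convergence on it implies weak convergence.
omit [IsProbabilityMeasure P] in
theorem isWeakLimit_of_tendsto_real [TopologicalSpace T] [SecondCountableTopology T]
    [BorelSpace T] {G : ℕ → Ω → Measure T} {κ : Kernel Ω T} [IsMarkovKernel κ]
    (hu : ∀ n, ∀ᵐ ω ∂P, G n ω Set.univ = 1)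
    (h : ∀ A, MeasurableSet A →
      ∀ᵐ ω ∂P, Tendsto (fun n => (G n ω).real A) atTop (𝓝 ((κ ω).real A))) :
    IsWeakLimit P G κ := by
  set 𝒜 := generateSetAlgebra (TopologicalSpace.countableBasis T) with h𝒜
  have hc : 𝒜.Countable := countable_generateSetAlgebra (TopologicalSpace.countable_countableBasis T)
  have hm : ∀ A ∈ 𝒜, MeasurableSet A := fun A hA => by
    have h1 := MeasurableSpace.measurableSet_generateFrom hA
    rw [h𝒜, generateFrom_generateSetAlgebra_eq,
      ← (TopologicalSpace.isBasis_countableBasis T).borel_eq_generateFrom,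
      ← BorelSpace.measurable_eq] at h1
    exact h1
  filter_upwards [(ae_ball_iff hc).2 fun A hA => h A (hm A hA), ae_all_iff.2 hu] with ω h1 h2
  let μs : ℕ → ProbabilityMeasure T := fun n => ⟨G n ω, ⟨h2 n⟩⟩
  let μ' : ProbabilityMeasure T := ⟨κ ω, inferInstance⟩
  have ht : Tendsto μs atTop (𝓝 μ') := by
    refine IsPiSystem.tendsto_probabilityMeasure_of_tendsto_of_mem (S := 𝒜)
      (IsSetAlgebra.isSetRing isSetAlgebra_generateSetAlgebra).isSetSemiring.isPiSystem hm
      (fun u hu x hx => ?_) fun A hA => ?_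
    · obtain ⟨s, hs, hxs, hsu⟩ :=
        (TopologicalSpace.isBasis_countableBasis T).exists_subset_of_mem_open hx hu
      exact ⟨s, self_subset_generateSetAlgebra hs,
        ((TopologicalSpace.isBasis_countableBasis T).isOpen hs).mem_nhds hxs, hsu⟩
    · exact NNReal.tendsto_coe.1 (h1 A hA)
  exact ProbabilityMeasure.tendsto_iff_forall_integral_tendsto.1 ht

-- Weak convergence alone gives no limit of `G_n(A)` for a general Borel set `A`. Uniqueness
-- identifies any weak limit with the setwise limit constructed above.
omit [IsProbabilityMeasure P] in
theorem IsWeakLimit.ae_eq [TopologicalSpace T] [HasOuterApproxClosed T] [BorelSpace T]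
    {G : ℕ → Ω → Measure T} {κ κ' : Kernel Ω T} [IsMarkovKernel κ] [IsMarkovKernel κ']
    (h : IsWeakLimit P G κ) (h' : IsWeakLimit P G κ') : ∀ᵐ ω ∂P, κ ω = κ' ω := by
  filter_upwards [h, h'] with ω h1 h2
  exact ext_of_forall_integral_eq_of_IsFiniteMeasure fun g => tendsto_nhds_unique (h1 g) (h2 g)

end SetwiseLimit

/-! ### Newton's model yields a Newton sequence. -/

section Model

variable {Ω S T : Type*} {m0 : MeasurableSpace Ω} [MeasurableSpace S] [MeasurableSpace T]

/-- The filtration generated by the observations `X 1, X 2, …`. -/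
def pastFiltration (X : ℕ → Ω → S) (hX : ∀ n, 1 ≤ n → Measurable (X n)) : Filtration ℕ m0 where
  seq := past X
  mono' _ _ hij := biSup_mono fun _ hk => Finset.Icc_subset_Icc_right hij hk
  le' _ := iSup₂_le fun i hi => (hX i (Finset.mem_Icc.1 hi).1).comap_le

omit [MeasurableSpace S] in
theorem newtonG_univ_le {f : S → T → ℝ≥0} {α : ℕ → ℝ} {G₀ : Measure T} [IsProbabilityMeasure G₀]
    (hα : ∀ n, 1 ≤ n → α n ∈ Set.Ioo (0 : ℝ) 1) (x : ℕ → S) (n : ℕ) :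
    newtonG f α G₀ x n Set.univ ≤ 1 := by
  induction n with
  | zero => exact prob_le_one (μ := G₀)
  | succ n ih =>
    obtain ⟨h0, h1⟩ := hα (n + 1) n.succ_pos
    rw [newtonG, Measure.add_apply, Measure.smul_apply, Measure.smul_apply, smul_eq_mul,
      smul_eq_mul]
    calc ENNReal.ofReal (1 - α (n + 1)) * newtonG f α G₀ x n Set.univ +
          ENNReal.ofReal (α (n + 1)) * mixPosterior f (newtonG f α G₀ x n) (x (n + 1)) Set.univ
        ≤ ENNReal.ofReal (1 - α (n + 1)) * 1 + ENNReal.ofReal (α (n + 1)) * 1 := by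
          gcongr
          exact mixPosterior_univ_le f _ _
      _ = 1 := by
          rw [mul_one, mul_one, ← ENNReal.ofReal_add (sub_pos.2 h1).le h0.le, sub_add_cancel,
            ENNReal.ofReal_one]

theorem measurable_mixPosterior_comp {f : S → T → ℝ≥0} {G : Ω → Measure T} {Z : Ω → S}
    (hf : Measurable (Function.uncurry f)) (hG : Measurable G) (hG1 : ∀ ω, G ω Set.univ ≤ 1)
    (hZ : Measurable Z) : Measurable fun ω => mixPosterior f (G ω) (Z ω) :=
  (measurable_mixPosterior hf hG hG1).comp (measurable_id.prodMk hZ)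

theorem measurable_newtonG {f : S → T → ℝ≥0} (hf : Measurable (Function.uncurry f)) {α : ℕ → ℝ}
    {G₀ : Measure T} [IsProbabilityMeasure G₀] (hα : ∀ n, 1 ≤ n → α n ∈ Set.Ioo (0 : ℝ) 1)
    (X : ℕ → Ω → S) (n : ℕ) :
    Measurable[past X n] fun ω => newtonG f α G₀ (fun i => X i ω) n := by
  induction n with
  | zero => exact measurable_const
  | succ n ih =>
    have hle : past X n ≤ past X (n + 1) :=
      biSup_mono fun _ hk => Finset.Icc_subset_Icc_right n.le_succ hk
    have h1 : Measurable[past X (n + 1)] fun ω => newtonG f α G₀ (fun i => X i ω) n :=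
      ih.mono hle le_rfl
    have hX : Measurable[past X (n + 1)] (X (n + 1)) :=
      (comap_measurable (X (n + 1))).mono
        (le_iSup₂_of_le (n + 1) (Finset.mem_Icc.2 ⟨n.succ_pos, le_rfl⟩) le_rfl) le_rfl
    have h3 : Measurable[past X (n + 1)] fun ω =>
        mixPosterior f (newtonG f α G₀ (fun i => X i ω) n) (X (n + 1) ω) :=
      @measurable_mixPosterior_comp Ω S T (past X (n + 1)) _ _ f
        (fun ω => newtonG f α G₀ (fun i => X i ω) n) (X (n + 1)) hf h1
        (fun ω => newtonG_univ_le hα _ n) hX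
    refine @Measure.measurable_of_measurable_coe _ _ _ (past X (n + 1)) _ fun A hA => ?_
    simp only [newtonG, Measure.add_apply, Measure.smul_apply, smul_eq_mul]
    have h4 : Measurable[past X (n + 1)] fun ω => newtonG f α G₀ (fun i => X i ω) n A :=
      (Measure.measurable_coe hA).comp h1
    have h5 : Measurable[past X (n + 1)] fun ω =>
        mixPosterior f (newtonG f α G₀ (fun i => X i ω) n) (X (n + 1) ω) A :=
      (Measure.measurable_coe hA).comp h3
    exact (h4.const_mul _).add (h5.const_mul _)

variable {P : Measure Ω} [IsProbabilityMeasure P] {μ : Measure S} [SFinite μ]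
  {f : S → T → ℝ≥0} {α : ℕ → ℝ} {G₀ : Measure T} [IsProbabilityMeasure G₀] {X : ℕ → Ω → S}
  {θ : ℕ → Ω → T}

/-- Integrating out `θ (n + 1)` by the tower property leaves the mixture as conditional law of the
next observation. -/
theorem IsNewtonModel.isNewtonSequence [StandardBorelSpace T]
    (h : IsNewtonModel P μ f α G₀ X θ) (hf : Measurable (Function.uncurry f))
    (hf_one : ∀ t, ∫⁻ x, (f x t : ℝ≥0∞) ∂μ = 1) (hα : ∀ n, 1 ≤ n → α n ∈ Set.Ioo (0 : ℝ) 1) :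
    IsNewtonSequence P μ f (fun n => α (n + 1)) (pastFiltration X h.measurable_obs)
      (fun n ω => newtonG f α G₀ (fun i => X i ω) n) (fun n => X (n + 1)) where
  measurable_density := hf
  density_one := hf_one
  weight_mem n := hα (n + 1) n.succ_pos
  measurable_measure n := measurable_newtonG hf hα X n
  univ_le n ω := newtonG_univ_le hα _ n
  measurable_obs n := h.measurable_obs (n + 1) n.succ_pos
  step n ω := rfl
  univ_eq n := by
    -- Mass one comes from the model itself: `G_n` is a conditional law, so degenerate posteriors
    -- occur with probability zero.
    have h1 := h.latent_law n Set.univ MeasurableSet.univ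
    have hm : past X n ≤ m0 := (pastFiltration X h.measurable_obs).le n
    simp only [Set.preimage_univ, Set.indicator_univ] at h1
    rw [condExp_const hm] at h1
    filter_upwards [h1] with ω hω
    exact (ENNReal.toReal_eq_one_iff _).1 hω.symm
  obs_law n B hB := by
    have hm : past X n ≤ m0 := (pastFiltration X h.measurable_obs).le n
    have hθ := h.measurable_latent (n + 1) n.succ_pos
    have hm' : past X n ⊔ MeasurableSpace.comap (θ (n + 1)) inferInstance ≤ m0 :=
      sup_le hm hθ.comap_le
    have hmk := isMarkovKernel_obsKernel (μ := μ) hf hf_one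
    have hreal : Measurable fun t => (obsKernel μ f hf t).real B :=
      ((Measure.measurable_coe hB).comp (obsKernel μ f hf).measurable).ennreal_toReal
    have hfin : ∀ ω, IsFiniteMeasure (newtonG f α G₀ (fun i => X i ω) n) := fun ω =>
      ⟨(newtonG_univ_le hα _ n).trans_lt ENNReal.one_lt_top⟩
    have h1 := condExp_condExp_of_le (μ := P) (f := (X (n + 1) ⁻¹' B).indicator fun _ => (1 : ℝ))
      (le_sup_left : past X n ≤ past X n ⊔ MeasurableSpace.comap (θ (n + 1)) inferInstance) hm'
    have h2 := condExp_congr_ae (m := past X n) (h.obs_law n B hB)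
    have h3 := condExp_eq_integral_of_condLaw hm hθ (h.latent_law n)
      (g := fun q => (obsKernel μ f hf q.2).real B) (hreal.comp measurable_snd)
      (Integrable.of_bound (hreal.comp hθ).aestronglyMeasurable 1 (Eventually.of_forall fun ω => by
        rw [Real.norm_of_nonneg measureReal_nonneg]
        exact measureReal_le_one_of_univ_le prob_le_one _))
    refine h1.symm.trans (h2.trans (h3.trans (Eventually.of_forall fun ω => ?_)))
    change ∫ t, (obsKernel μ f hf t B).toReal ∂_ = (mixMeasure μ f _ B).toReal
    rw [mixMeasure_apply hf (newtonG_univ_le hα _ n) hB]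
    exact integral_toReal ((Measure.measurable_coe hB).comp
      (obsKernel μ f hf).measurable).aemeasurable (Eventually.of_forall fun t => measure_lt_top _ _)

omit [IsProbabilityMeasure G₀] in
theorem IsNewtonSequence.integral_real [StandardBorelSpace S] {β : ℕ → ℝ} {ℱ : Filtration ℕ m0}
    {G : ℕ → Ω → Measure T} {Z : ℕ → Ω → S} (h : IsNewtonSequence P μ f β ℱ G Z)
    (hG₀ : ∀ ω, G 0 ω = G₀) (n : ℕ) {A : Set T} (hA : MeasurableSet A) :
    ∫ ω, (G n ω).real A ∂P = G₀.real A := by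
  have hi : ∀ n, Integrable (fun ω => (G n ω).real A) P := fun n =>
    Integrable.of_bound ((h.measurable_real n hA).mono (ℱ.le n) le_rfl).aestronglyMeasurable 1
      (Eventually.of_forall fun ω => h.abs_real_le n ω A)
  induction n with
  | zero => simp [hG₀]
  | succ n ih =>
    have h1 := integral_condExp (μ := P) (ℱ.le n)
      (f := fun ω => (G (n + 1) ω).real A - (G n ω).real A)
    rw [integral_congr_ae (h.condExp_real_succ_sub n hA), integral_sub (hi _) (hi _), ih] at h1
    simp only [Pi.zero_apply, integral_zero] at h1
    linarith

end Model

end NewtonRule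

/-! ### The credible ellipsoids of Newton's rule. -/

theorem mainTheorem10 {Ω S T : Type*} [MeasurableSpace Ω]
    [MeasurableSpace S] [StandardBorelSpace S]
    [TopologicalSpace T] [TopologicalSpace.MetrizableSpace T] [SecondCountableTopology T]
    [MeasurableSpace T] [BorelSpace T] [StandardBorelSpace T]
    (P : Measure Ω) [IsProbabilityMeasure P]
    (μ : Measure S) [SigmaFinite μ]
    (f : S → T → ℝ≥0) (hf : Measurable (Function.uncurry f))
    (hf_one : ∀ t, ∫⁻ x, (f x t : ℝ≥0∞) ∂μ = 1)
    (G₀ : Measure T) [IsProbabilityMeasure G₀]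
    (α : ℕ → ℝ) (hα : ∀ n, 1 ≤ n → α n ∈ Set.Ioo (0 : ℝ) 1)
    (hα_sum : ¬ Summable α) (hα_sq : Summable fun n => α n ^ 2)
    (r : ℕ → ℝ) (hr_pos : ∀ n, 1 ≤ n → 0 < r n) (hr_mono : MonotoneOn r (Set.Ici 1))
    (hr_equiv : Asymptotics.IsEquivalent atTop r
      (fun n => (∑' j : ℕ, α (n + 1 + j) ^ 2)⁻¹))
    (hr_sup : Tendsto (fun n => √(r n) * ⨆ j : ℕ, α (n + j)) atTop (𝓝 0))
    (hr_sum : Summable fun n => r n ^ 2 * α (n + 1) ^ 4)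
    (X : ℕ → Ω → S) (θ : ℕ → Ω → T)
    (hmodel : NewtonRule.IsNewtonModel P μ f α G₀ X θ) :
    (∃ G : Kernel Ω T, IsMarkovKernel G ∧
      NewtonRule.IsWeakLimit P
        (fun n ω => NewtonRule.newtonG f α G₀ (fun i => X i ω) n) G) ∧
    ∀ G : Kernel Ω T, IsMarkovKernel G →
      NewtonRule.IsWeakLimit P
        (fun n ω => NewtonRule.newtonG f α G₀ (fun i => X i ω) n) G →
      ∀ k : ℕ, 1 ≤ k → ∀ A : Fin k → Set T, (∀ i, MeasurableSet (A i)) →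
      ∀ γ : ℝ, 0 < γ → γ < 1 → ∀ ε : ℝ, 0 < ε →
        ∀ᵐ ω ∂P, 1 - γ ≤ liminf (fun n =>
          (P⟦{ω' | (fun i => (G ω').real (A i)) ∈
              NewtonRule.ellipsoid
                (fun i => (NewtonRule.newtonG f α G₀ (fun j => X j ω') n).real (A i))
                (NewtonRule.covMatrix μ f
                  (NewtonRule.newtonG f α G₀ (fun j => X j ω') n) A)
                ε (NewtonRule.quantile (NewtonRule.chiSquare k) (1 - γ) / r n)}
            | NewtonRule.past X n⟧) ω) atTop := by
  have h := hmodel.isNewtonSequence hf hf_one hα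
  set ℱ := NewtonRule.pastFiltration X hmodel.measurable_obs with hℱ
  obtain ⟨κ, hκ, hκlim⟩ := NewtonRule.exists_kernel_tendsto_real (ν₀ := G₀)
    (fun n => (h.measurable_measure n).mono (ℱ.le n) le_rfl) h.univ_le h.univ_eq
    (fun A hA => h.ae_exists_tendsto_real hA) fun n A hA => h.integral_real (fun _ => rfl) n hA
  have hκw := NewtonRule.isWeakLimit_of_tendsto_real h.univ_eq hκlim
  refine ⟨⟨κ, hκ, hκw⟩, fun G hG hGw k hk A hA γ hγ0 hγ1 ε hε => ?_⟩
  have hbdd : ∀ n, BddAbove (Set.range fun j : ℕ => α (n + j)) := fun n =>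
    -- The value `α 0` is unconstrained and enters the supremum at `n = 0`.
    ⟨max (α 0) 1, by
      rintro _ ⟨j, rfl⟩
      rcases Nat.eq_zero_or_pos (n + j) with h0 | h0
      · simp only [h0]; exact le_max_left _ _
      · exact (hα _ h0).2.le.trans (le_max_right _ _)⟩
  have hcov := h.ae_exists_tendsto_covMatrix hA
  have hsq : ∀ n, Summable fun j : ℕ => α (n + j) ^ 2 := fun n => by
    simpa only [add_comm] using (summable_nat_add_iff n).2 hα_sq
  refine NewtonRule.le_liminf_condProb_ellipsoid ℱ hk
    (M := fun n ω i => (NewtonRule.newtonG f α G₀ (fun j => X j ω) n).real (A i))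
    (M' := fun ω i => (G ω).real (A i))
    (C := fun n ω => NewtonRule.covMatrix μ f (NewtonRule.newtonG f α G₀ (fun j => X j ω) n) A)
    (C' := fun ω => limUnder atTop fun n =>
      NewtonRule.covMatrix μ f (NewtonRule.newtonG f α G₀ (fun j => X j ω) n) A)
    -- The step from `n` to `n + 1` has weight `α (n + 1)`, so the tail sum from `n` of `β ^ 2` is
    -- the sum of `α j ^ 2` over `j > n`.
    (β := fun n => α (n + 1)) (η := fun n => √(r n) * ⨆ j : ℕ, α (n + j))
    (fun n => (h.weight_mem n).1.le) (fun n i => h.measurable_real n (hA i))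
    (fun i => (G.measurable_coe (hA i)).ennreal_toReal) (fun n ω i => h.abs_real_le n ω (A i))
    (fun ω i => ?_) (fun n i l => ?_)
    (fun n ω => NewtonRule.posSemidef_covMatrix hf hf_one (h.univ_le n ω) hA)
    (fun n ω i l => NewtonRule.abs_covMatrix_le hf hf_one (h.univ_le n ω) i l)
    (fun n ω i => h.abs_real_succ_sub_le n ω (A i)) (fun n i => h.condExp_real_succ_sub n (hA i))
    (fun n i l => h.condExp_real_succ_sub_mul n hA i l) ?_ ?_ hr_pos ?_ ?_ (fun n i => ?_) hr_sup hε
    (sub_pos.2 hγ1) (sub_lt_self 1 hγ0)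
  · rw [abs_of_nonneg measureReal_nonneg]
    exact measureReal_le_one
  · exact @NewtonRule.measurable_covMatrix Ω S T _ _ μ _ f k A (ℱ n) _ hf hf_one
      (h.measurable_measure n) (h.univ_le n) hA i l
  -- The given weak limit `G` is replaced by the setwise limit `κ`.
  · filter_upwards [hGw.ae_eq hκw, ae_all_iff.2 fun i => hκlim (A i) (hA i)] with ω h1 h2 i
    rw [h1]
    exact h2 i
  · filter_upwards [hcov] with ω hω
    exact tendsto_nhds_limUnder hω
  · simpa only [add_comm] using hsq 1
  · have hpos : ∀ n, 0 < ∑' j : ℕ, α (n + 1 + j) ^ 2 := fun n =>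
      (hsq (n + 1)).tsum_pos (fun j => sq_nonneg _) 0 (pow_pos (hα _ (by omega)).1 2)
    have h1 := (Asymptotics.isEquivalent_iff_tendsto_one
      (Eventually.of_forall fun n => (inv_pos.2 (hpos n)).ne')).1 hr_equiv
    refine h1.congr fun n => ?_
    rw [Pi.div_apply, div_inv_eq_mul]
    simp only [add_right_comm]
  · exact mul_le_mul_of_nonneg_left (le_ciSup (hbdd n) (i + 1)) (Real.sqrt_nonneg _)
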